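/- **Definitions.** All algorithms are randomized word-RAM algorithms (unit-cost arithmetic, bitwise, comparison and memory operations, and fair coin flips) whose words have $O(\log N)$ bits, where $N$ is the size parameter of the input. Time bounds hold for all outcomes of the coin flips. *Unbalanced 3-Hitting-Set* with constants $a,b>0$: given sets $U,V,W\subseteq\{0,1\}^d$ with $|U|=n$, $|V|=\lceil n^a\rceil$, $|W|=\lceil n^b\rceil$, decide whether there are $u\in U$ and $w\in W$ such that for all $v\in V$, $\sum_{i=1}^d u[i]\,v[i]\,w[i]\neq 0$. The *unbalanced 3-Hitting-Set hypothesis* says that for all constants $a,b>0$ and $\eta>0$ no randomized algorithm with words of $O(\log(n+d))$ bits solves this problem, with error probability at most $1/3$, in time $O(n^{1+a+b-\eta}\,\mathrm{poly}(d))$. A *fully dynamic algorithm for $\alpha$-approximate Radius* preprocesses an undirected unweighted graph on $n\ge 1$ vertices and then processes a sequence of edge insertions, edge deletions and queries, using words of $O(\log n)$ bits. For every sequence of operations fixed in advance, a query made when the current graph is connected and has radius $R=\min_v\max_u d(v,u)$ must be answered, with probability at least $2/3$, by an integer $\hat R$ with $R\le\hat R\le\alpha R$. In the *incremental* (*decremental*)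 setting there are no deletions (no insertions). Operations take *amortized* time $T$ if every sequence of $k$ operations following the preprocessing takes total time at most $kT$, and *worst-case* time $T$ if every single operation takes time at most $T$. **Theorem.** Assume the unbalanced 3-Hitting-Set hypothesis, and let $t,\epsilon,\epsilon'>0$ be constants. Then there is no fully dynamic algorithm for $(3/2-\epsilon)$-approximate Radius on undirected, unweighted graphs with $n$ vertices and $\tilde O(n)$ edges (at all times) that has preprocessing time $O(n^t)$, amortized update time $O(n^{2-\epsilon'})$ and amortized query time $O(n^{2-\epsilon'})$. The same holds in the incremental setting and in the decremental setting for worst-case update and query times $O(n^{2-\epsilon'})$. Here $\tilde O(n)$ may be any fixed bound $c\,n\,(\lfloor\log_2 n\rfloor+1)^k$ with $c\ge 2$ real and $k\ge 0$ an integer; in particular the result already holds for graphs with at most $2n$ edges. -/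

import Mathlib

noncomputable section

namespace WordRAM

/-! ### A randomized word RAM

The memory consists of finitely many arrays (those named in the program) of words, all cells being
`0` initially unless they hold the input; a register is a cell of an array with a constant index. Programs are finite pieces
of structured code. Every operation on words costs one unit of time. A word must be
smaller than a bound `B = 2 ^ w`, where `w` is the word length: a computation in which a larger
value occurs is aborted, so a legal program never overflows. -/

/-- Memory contents: array name, index, word. -/
abbrev Memory : Type := ℕ → ℕ → ℕ

/-- The word operations: arithmetic, bitwise operations, shifts, comparisons. -/
inductive BinOp : Type
  | add | sub | mul | div | mod | and | or | xor | shl | shr | lt | eq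

def BinOp.eval : BinOp → ℕ → ℕ → ℕ
  | .add, x, y => x + y
  | .sub, x, y => x - y
  | .mul, x, y => x * y
  | .div, x, y => x / y
  | .mod, x, y => x % y
  | .and, x, y => x &&& y
  | .or, x, y => x ||| y
  | .xor, x, y => x ^^^ y
  | .shl, x, y => x <<< y
  | .shr, x, y => x >>> y
  | .lt, x, y => if x < y then 1 else 0
  | .eq, x, y => if x = y then 1 else 0

/-- Expressions: constants, the content of cell `i` of array `a`, word operations. -/
inductive Expr : Type
  | const (k : ℕ)
  | read (a : ℕ) (i : Expr)
  | bin (o : BinOp) (e f : Expr)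

/-- The time needed to evaluate an expression: one unit per constant, memory access, operation. -/
def Expr.cost : Expr → ℕ
  | .const _ => 1
  | .read _ i => i.cost + 1
  | .bin _ e f => e.cost + f.cost + 1

/-- The value `x` if it fits into a word. -/
def word (B x : ℕ) : Option ℕ := if x < B then some x else none

/-- The value of an expression; `none` if a value that does not fit into a word occurs. -/
def Expr.eval (B : ℕ) (s : Memory) : Expr → Option ℕ
  | .const k => word B k
  | .read a i => (i.eval B s).bind fun j => word B (s a j)
  | .bin o e f => (e.eval B s).bind fun x => (f.eval B s).bind fun y => word B (o.eval x y)

/-- Programs: `store a i e` is the assignment `a[i] := e`, `flip a i` stores a fair random bit in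
`a[i]`, and `ite`, `loop` treat `0` as false and every other word as true. -/
inductive Program : Type
  | skip
  | store (a : ℕ) (i e : Expr)
  | flip (a : ℕ) (i : Expr)
  | seq (p q : Program)
  | ite (e : Expr) (p q : Program)
  | loop (e : Expr) (p : Program)

/-- The memory after the word `v` has been written into cell `j` of array `a`. -/
def Memory.set (s : Memory) (a j v : ℕ) : Memory :=
  Function.update s a (Function.update (s a) j v)

/-- The outcome of a computation with a time budget: `some (T, s)` if it halted with memory
contents `s` and unused budget `T`, and `none` if it exceeded its budget or overflowed. -/
abbrev Outcome : Type := Option (ℕ × Memory)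

/-- Continue a computation with the remaining budget. -/
def andThen {α : Type} (p : PMF Outcome) (f : ℕ → Memory → PMF (Option α)) : PMF (Option α) :=
  p.bind fun
    | none => PMF.pure none
    | some (T, s) => f T s

/-- Pay `k` units of time out of the budget `T`. -/
def pay (k T : ℕ) (f : ℕ → PMF Outcome) : PMF Outcome :=
  if k ≤ T then f (T - k) else PMF.pure none

/-- Evaluate an expression. -/
def evalThen (B : ℕ) (s : Memory) (e : Expr) (f : ℕ → PMF Outcome) : PMF Outcome :=
  match e.eval B s with
  | none => PMF.pure none
  | some v => f v

/-- At most `k - 1` rounds of the loop `while e ≠ 0 do body`, every test costing at least one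
unit. -/
def loopExec (B : ℕ) (e : Expr) (body : ℕ → Memory → PMF Outcome) :
    ℕ → ℕ → Memory → PMF Outcome
  | 0, _, _ => PMF.pure none
  | k + 1, T, s =>
      pay (e.cost + 1) T fun T' => evalThen B s e fun v =>
        if v = 0 then PMF.pure (some (T', s))
        else andThen (body T' s) (loopExec B e body k)

/-- The random outcome of running a program with words smaller than `B` and time budget `T` on the
memory contents `s`. (A loop with budget `T` makes fewer than `T` tests, so the bound on the number
of rounds in the last clause is no restriction.) -/
def Program.exec (B : ℕ) : Program → ℕ → Memory → PMF Outcome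
  | .skip, T, s => pay 1 T fun T' => PMF.pure (some (T', s))
  | .store a i e, T, s =>
      pay (i.cost + e.cost + 1) T fun T' => evalThen B s i fun j => evalThen B s e fun v =>
        PMF.pure (some (T', s.set a j v))
  | .flip a i, T, s =>
      pay (i.cost + 1) T fun T' => evalThen B s i fun j =>
        (PMF.uniformOfFintype Bool).bind fun r => PMF.pure (some (T', s.set a j r.toNat))
  | .seq p q, T, s => andThen (p.exec B T s) (q.exec B)
  | .ite e p q, T, s =>
      pay (e.cost + 1) T fun T' => evalThen B s e fun v =>
        if v = 0 then q.exec B T' s else p.exec B T' s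
  | .loop e p, T, s => loopExec B e (p.exec B) T T s

/-- The memory after the list `l` has been written into cells `0, 1, 2, …` of array `0`, which
serves for input and output. -/
def Memory.input (s : Memory) (l : List ℕ) : Memory :=
  fun a j => if a = 0 then (l[j]?).getD (s 0 j) else s a j

/-- The initial memory with input `l`. -/
def initial (l : List ℕ) : Memory := Memory.input (fun _ _ => 0) l

/-- The bound `2 ^ w` for words of length `w = κ (⌊log₂ N⌋ + 1)`, that is, of `O(log N)` bits. -/
def wordBound (κ N : ℕ) : ℕ := 2 ^ (κ * (Nat.log 2 N + 1))

end WordRAM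

/-- `u · v · w`, the generalized inner product of three 0/1-vectors. -/
def tripleProduct {d : ℕ} (u v w : Fin d → Bool) : ℕ :=
  ∑ c, (u c).toNat * (v c).toNat * (w c).toNat

/-- The question of 3-Hitting-Set: are there `u ∈ U`, `w ∈ W` with `u · v · w ≠ 0` for all
`v ∈ V`? -/
def HasHittingSet {p q r d : ℕ} (U : Fin p → Fin d → Bool) (V : Fin q → Fin d → Bool)
    (W : Fin r → Fin d → Bool) : Prop :=
  ∃ i k, ∀ j, tripleProduct (U i) (V j) (W k) ≠ 0

/-- The entries of a list of vectors, vector by vector. -/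
def vectorEntries {p d : ℕ} (U : Fin p → Fin d → Bool) : List ℕ :=
  (List.ofFn fun i => List.ofFn fun c => (U i c).toNat).flatten

/-- A 3-Hitting-Set instance as input of a word RAM. -/
def hittingSetInput {p q r d : ℕ} (U : Fin p → Fin d → Bool) (V : Fin q → Fin d → Bool)
    (W : Fin r → Fin d → Bool) : List ℕ :=
  [p, q, r, d] ++ vectorEntries U ++ vectorEntries V ++ vectorEntries W

open WordRAM in
/-- The randomized program `P`, with words of `O(log (n + d))` bits, solves unbalanced
3-Hitting-Set with `|U| = n`, `|V| = ⌈n ^ a⌉`, `|W| = ⌈n ^ b⌉` in dimension `d` with error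
probability at most `1/3` in time `O(n ^ τ · poly(d))`. The sets are given as lists
without repetitions. -/
def SolvesUnbalancedHS (P : Program) (a b τ : ℝ) : Prop :=
  ∃ (κ k : ℕ) (C : ℝ), ∀ n d : ℕ, 1 ≤ n → 1 ≤ d →
    ∀ (U : Fin n → Fin d → Bool) (V : Fin ⌈(n : ℝ) ^ a⌉₊ → Fin d → Bool)
      (W : Fin ⌈(n : ℝ) ^ b⌉₊ → Fin d → Bool),
      Function.Injective U → Function.Injective V → Function.Injective W →
      let r : PMF Outcome := P.exec (wordBound κ (n + d)) ⌊C * (n : ℝ) ^ τ * (d : ℝ) ^ k⌋₊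
        (initial (hittingSetInput U V W))
      none ∉ r.support ∧
      2 / 3 ≤ r.toOuterMeasure
        {o | ∃ T s, o = some (T, s) ∧ (s 0 0 ≠ 0 ↔ HasHittingSet U V W)}

/-- The unbalanced 3-Hitting-Set hypothesis: for all constants `a, b > 0` the problem requires time
`n ^ (1 + a + b - o(1))` on a randomized word RAM. -/
def UnbalancedHSHypothesis : Prop :=
  ∀ a b : ℝ, 0 < a → 0 < b → ∀ η : ℝ, 0 < η →
    ¬ ∃ P : WordRAM.Program, SolvesUnbalancedHS P a b (1 + a + b - η)

/-! ### Dynamic graph algorithms -/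

/-- The operations of a dynamic graph problem on the vertex set `{0, …, n - 1}`. -/
inductive GraphOp (n : ℕ) : Type
  | insert (u v : Fin n)
  | delete (u v : Fin n)
  | query

/-- The graph after an operation. -/
def GraphOp.apply {n : ℕ} : GraphOp n → SimpleGraph (Fin n) → SimpleGraph (Fin n)
  | .insert u v, G => G ⊔ SimpleGraph.edge u v
  | .delete u v, G => G.deleteEdges {s(u, v)}
  | .query, G => G

/-- Only absent edges are inserted and only present edges are deleted. -/
def GraphOp.Valid {n : ℕ} : GraphOp n → SimpleGraph (Fin n) → Prop
  | .insert u v, G => u ≠ v ∧ ¬ G.Adj u v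
  | .delete u v, G => G.Adj u v
  | .query, _ => True

/-- The data handed over to the algorithm with an operation. -/
def GraphOp.args {n : ℕ} : GraphOp n → List ℕ
  | .insert u v => [u, v]
  | .delete u v => [u, v]
  | .query => []

inductive DynamicSetting : Type
  | fullyDynamic | incremental | decremental

/-- The operations that a setting permits. -/
def DynamicSetting.Permits {n : ℕ} : DynamicSetting → GraphOp n → Prop
  | .incremental, .delete _ _ => False
  | .decremental, .insert _ _ => False
  | _, _ => True

/-- At most `c n (⌊log₂ n⌋ + 1) ^ k` edges. -/
def IsSparse (c : ℝ) (k : ℕ) {n : ℕ} (G : SimpleGraph (Fin n)) : Prop :=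
  (G.edgeSet.ncard : ℝ) ≤ c * n * ((Nat.log 2 n : ℝ) + 1) ^ k

/-- The operation sequences of a setting that start at a given graph and always keep the graph
sparse. -/
def AdmissibleOps (S : DynamicSetting) (c : ℝ) (k : ℕ) {n : ℕ} :
    SimpleGraph (Fin n) → List (GraphOp n) → Prop
  | G, [] => IsSparse c k G
  | G, o :: os => IsSparse c k G ∧ S.Permits o ∧ o.Valid G ∧ AdmissibleOps S c k (o.apply G) os

/-- The graph after a sequence of operations. -/
def finalGraph {n : ℕ} (G : SimpleGraph (Fin n)) (ops : List (GraphOp n)) : SimpleGraph (Fin n) :=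
  ops.foldl (fun H o => o.apply H) G

/-- `l` lists every edge of `G` exactly once, in arbitrary order and orientation. -/
def IsEdgeList {n : ℕ} (G : SimpleGraph (Fin n)) (l : List (Fin n × Fin n)) : Prop :=
  (l.map fun e => s(e.1, e.2)).Nodup ∧ ∀ x : Sym2 (Fin n),
    x ∈ l.map (fun e => s(e.1, e.2)) ↔ x ∈ G.edgeSet

/-- A graph as input of a word RAM: the numbers of vertices and edges and the list of edges. -/
def graphInput (n : ℕ) (l : List (Fin n × Fin n)) : List ℕ :=
  [n, l.length] ++ l.flatMap fun e => [(e.1 : ℕ), (e.2 : ℕ)]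

/-- A dynamic algorithm: word RAM programs for the preprocessing and for the operations, which work
on a common memory. -/
structure DynamicAlgorithm where
  preprocess : WordRAM.Program
  insert : WordRAM.Program
  delete : WordRAM.Program
  query : WordRAM.Program

def DynamicAlgorithm.program (A : DynamicAlgorithm) {n : ℕ} : GraphOp n → WordRAM.Program
  | .insert _ _ => A.insert
  | .delete _ _ => A.delete
  | .query => A.query

/-- How the time of the operations is measured. -/
inductive TimeMeasure : Type
  | amortized | worstCase

/-- The time budget for `k` operations at a rate `τ` per operation: in the amortized case a common
budget for all of them, in the worst case a budget for each single one. -/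
def TimeMeasure.budget (M : TimeMeasure) (τ : ℝ) (k : ℕ) : ℕ :=
  match M with
  | .amortized => ⌊τ * k⌋₊
  | .worstCase => ⌊τ⌋₊

open WordRAM in
/-- Process a sequence of operations. With amortized time the unused part of the budget `T` is
handed on to the following operations; with worst-case time every operation has budget `T`. -/
def DynamicAlgorithm.runOps (A : DynamicAlgorithm) (M : TimeMeasure) (B : ℕ) {n : ℕ} :
    List (GraphOp n) → ℕ → Memory → PMF (Option Memory)
  | [], _, s => PMF.pure (some s)
  | o :: os, T, s =>
      andThen ((A.program o).exec B T (s.input o.args)) fun T' s' =>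
        A.runOps M B os (match M with | .amortized => T' | .worstCase => T) s'

open WordRAM in
/-- Preprocess the graph with edge list `l` with budget `T₀`, then process the operations. -/
def DynamicAlgorithm.run (A : DynamicAlgorithm) (M : TimeMeasure) (B : ℕ) {n : ℕ}
    (l : List (Fin n × Fin n)) (T₀ : ℕ) (ops : List (GraphOp n)) (T : ℕ) :
    PMF (Option Memory) :=
  andThen (A.preprocess.exec B T₀ (initial (graphInput n l))) fun _ s => A.runOps M B ops T s

/-- `r` is an `α`-approximation of the radius of `G`. -/
def ApproximatesRadius {n : ℕ} (α : ℝ) (G : SimpleGraph (Fin n)) (r : ℕ) : Prop :=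
  G.radius ≤ (r : ℕ∞) ∧ (r : ℝ) ≤ α * (G.radius.toNat : ℝ)

/-- `A` is a randomized `α`-approximation algorithm for Radius in the given setting, on undirected
unweighted `n`-vertex graphs that have at most `c n (⌊log₂ n⌋ + 1) ^ k` edges at all times, with
words of `O(log n)` bits, preprocessing time `O(n ^ t)`, and update and query time `O(n ^ τ)`
(amortized or worst-case, for all outcomes of the coin flips). For every sequence of
operations fixed in advance, each query is answered correctly with probability at least `2/3`;
nothing is required of the answer when the graph is disconnected. -/
def DynamicAlgorithm.SolvesRadius (A : DynamicAlgorithm) (S : DynamicSetting) (M : TimeMeasure)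
    (α c : ℝ) (k : ℕ) (t τ : ℝ) : Prop :=
  ∃ (κ : ℕ) (C : ℝ), ∀ n : ℕ, 1 ≤ n →
    ∀ (G : SimpleGraph (Fin n)) (l : List (Fin n × Fin n)), IsEdgeList G l →
    ∀ ops : List (GraphOp n), AdmissibleOps S c k G ops →
      let r : PMF (Option WordRAM.Memory) :=
        A.run M (WordRAM.wordBound κ n) l ⌊C * (n : ℝ) ^ t⌋₊ ops
          (M.budget (C * (n : ℝ) ^ τ) ops.length)
      none ∉ r.support ∧
      (ops.getLast? = some GraphOp.query → (finalGraph G ops).Connected →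
        2 / 3 ≤ r.toOuterMeasure
          {o | ∃ s, o = some s ∧ ApproximatesRadius α (finalGraph G ops) (s 0 0)})

end

/-! The theorem is a reduction: a fast dynamic algorithm for Radius would solve unbalanced
3-Hitting-Set with |U| = |V| = n and |W| = ⌈n^t⌉ too quickly. W is chosen this large so that a
preprocessing time of n^t does no harm: the preprocessing is repeated only O(d) times, which stays
below n^(2+t-η) poly(d).

Gadget. U and V determine a sparse graph; w only decides which of 2d switchable edges are present.
There are two copies of a construction in which every coordinate c has a port on the U side and a
port on the V side, joined by a switchable edge exactly when w[c] = 1. Every vector has a star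
centre, joined by paths of length g + 1 to the ports of its ones. The centre of u is also joined to
a leaf of u, which is common to both copies, and the centre of v to a leaf in its own copy. A hub
and dummy ports keep each copy together. If u and w hit all of V, the leaf of u reaches every star
centre within 3(g+1)+1 steps, hence every vertex within 4(g+1)+1 (`radius_le`). If every u misses
some v, each vertex has eccentricity at least 6(g+1) (`le_radius`), as certified by the potential
`level`. Two copies are needed because otherwise a hub or a star centre could be central; with two
copies the other one is reached only through the leaves of U. For g about 1/ε the gap exceeds the
factor 3/2 - ε (`lt_iff_hitsAll`). The graph has N = O(g n d) vertices and at most 2N edges.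

Rollback. A vector w costs at most 2d switchings and a query, starting with no switchable edge
(insertions only) or with all of them (deletions only). Afterwards the graph is not restored by
further operations; instead the memory of the dynamic algorithm is reset to its state after the
preprocessing. To make this possible in constant time, the memory is simulated with two time-stamped
versions of every cell, at constant slowdown (`wp_sim`, `Ctx.incHi`). Every operation sequence thus
directly follows the preprocessing, which allows amortized and worst-case bounds to be treated
alike. All vectors together cost n^t · n^(2-η) poly(d).

Probability. Within one repetition all vectors share the coins of the preprocessing, so their votes
are dependent. For a single w, however, the repetitions use fresh coins and each vote is wrong with
probability at most 1/3, since the operations depend on the input alone. The weight 2^(number of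
wrong votes) therefore grows by an expected factor of at most 4/3 per repetition (`wp_repetitions`).
A wrong majority among 12(d+2) votes forces weight at least 2^(6(d+2)), and Markov's inequality with
a union bound over at most 2^d vectors leaves error 1/4 (`failure_bound`). All this is computed with
the expectation transformer `wp`, in which failure has value ∞; a finite bound thus also shows that
the program neither overflows nor exceeds its time. -/

open scoped ENNReal

/-! ### Expectations -/

/-- The expectation of a nonnegative function. -/
noncomputable def PMF.ev {α : Type*} (μ : PMF α) (f : α → ℝ≥0∞) : ℝ≥0∞ := ∑' a, μ a * f a

namespace PMF

variable {α β : Type*}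

theorem ev_pure (a : α) (f : α → ℝ≥0∞) : (PMF.pure a).ev f = f a := by
  unfold ev
  rw [tsum_eq_single a]
  · simp
  · intro b hb; simp [hb]

theorem ev_bind (μ : PMF α) (k : α → PMF β) (f : β → ℝ≥0∞) :
    (μ.bind k).ev f = μ.ev fun a => (k a).ev f := by
  unfold ev
  simp_rw [PMF.bind_apply, ← ENNReal.tsum_mul_right, ← ENNReal.tsum_mul_left]
  rw [ENNReal.tsum_comm]
  simp_rw [mul_assoc]

theorem ev_mono_support {μ : PMF α} {f g : α → ℝ≥0∞} (h : ∀ a ∈ μ.support, f a ≤ g a) :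
    μ.ev f ≤ μ.ev g := by
  refine ENNReal.tsum_le_tsum fun a => ?_
  by_cases ha : a ∈ μ.support
  · exact mul_le_mul_right (h a ha) _
  · simp [(PMF.apply_eq_zero_iff μ a).2 ha]

theorem ev_mono {μ : PMF α} {f g : α → ℝ≥0∞} (h : ∀ a, f a ≤ g a) : μ.ev f ≤ μ.ev g :=
  ev_mono_support fun a _ => h a

theorem ev_const (μ : PMF α) (c : ℝ≥0∞) : μ.ev (fun _ => c) = c := by
  simp [ev, ENNReal.tsum_mul_right, PMF.tsum_coe]

theorem ev_add (μ : PMF α) (f g : α → ℝ≥0∞) : μ.ev (fun a => f a + g a) = μ.ev f + μ.ev g := by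
  simp [ev, mul_add, ENNReal.tsum_add]

theorem ev_const_mul (μ : PMF α) (c : ℝ≥0∞) (f : α → ℝ≥0∞) :
    μ.ev (fun a => c * f a) = c * μ.ev f := by
  simp [ev, ← ENNReal.tsum_mul_left, mul_left_comm]

theorem ev_sum {ι : Type*} (μ : PMF α) (s : Finset ι) (f : ι → α → ℝ≥0∞) :
    μ.ev (fun a => ∑ i ∈ s, f i a) = ∑ i ∈ s, μ.ev (f i) := by
  classical
  induction s using Finset.induction_on with
  | empty => simp [ev]
  | insert i s hi ih => simp [Finset.sum_insert hi, ev_add, ih]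

theorem toOuterMeasure_eq_ev (μ : PMF α) (S : Set α) :
    μ.toOuterMeasure S = μ.ev (S.indicator 1) := by
  rw [PMF.toOuterMeasure_apply]
  refine tsum_congr fun a => ?_
  by_cases h : a ∈ S <;> simp [h]

/-- With failure valued at ∞, a finite expectation bound rules out failure outright; this yields the
condition on time and overflow for free. -/
theorem apply_eq_zero_of_ev_ne_top {μ : PMF α} {f : α → ℝ≥0∞} (h : μ.ev f ≠ ⊤) {a : α}
    (ha : f a = ⊤) : μ a = 0 := by
  by_contra h0
  apply h
  refine top_le_iff.1 (le_trans ?_ (ENNReal.le_tsum a))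
  simp [ha, ENNReal.mul_top h0]

theorem ev_indicator_compl (μ : PMF α) (S : Set α) :
    μ.toOuterMeasure S + μ.ev (Sᶜ.indicator 1) = 1 := by
  rw [toOuterMeasure_eq_ev, ← ev_add]
  convert μ.ev_const 1 using 3 with a
  by_cases h : a ∈ S <;> simp [h]

theorem bind_congr_support {μ : PMF α} {f g : α → PMF β} (h : ∀ a ∈ μ.support, f a = g a) :
    μ.bind f = μ.bind g := by
  ext b
  simp_rw [PMF.bind_apply]
  refine tsum_congr fun a => ?_
  by_cases ha : a ∈ μ.support
  · rw [h a ha]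
  · simp [(PMF.apply_eq_zero_iff μ a).2 ha]

end PMF

/-- Extend a function to optional values, failure counting as infinitely bad. -/
def liftTop {α : Type*} (f : α → ℝ≥0∞) : Option α → ℝ≥0∞
  | none => ⊤
  | some a => f a

@[simp] theorem liftTop_none {α : Type*} (f : α → ℝ≥0∞) : liftTop f none = ⊤ := rfl
@[simp] theorem liftTop_some {α : Type*} (f : α → ℝ≥0∞) (a : α) : liftTop f (some a) = f a := rfl

theorem liftTop_mono {α : Type*} {f g : α → ℝ≥0∞} (h : ∀ a, f a ≤ g a) (o : Option α) :
    liftTop f o ≤ liftTop g o := by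
  cases o <;> simp [h]

/-- Votes on vectors other than the one under consideration are integrated out by this equality. It
needs that failure is impossible, not merely unlikely. -/
theorem PMF.ev_liftTop_const {α : Type*} {μ : PMF (Option α)} (h : none ∉ μ.support) (c : ℝ≥0∞) :
    μ.ev (liftTop fun _ => c) = c := by
  conv_rhs => rw [← μ.ev_const c]
  apply le_antisymm <;> refine PMF.ev_mono_support fun a ha => ?_ <;> cases a
  · exact absurd ha h
  · simp
  · exact absurd ha h
  · simp

/-! ### Expectation transformers for programs -/

namespace WordRAM

/-- Post-expectations: functions of the remaining budget and the memory. -/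
abbrev Post : Type := ℕ × Memory → ℝ≥0∞

theorem ev_andThen {α : Type} (p : PMF Outcome) (k : ℕ → Memory → PMF (Option α))
    (f : α → ℝ≥0∞) :
    (andThen p k).ev (liftTop f) = p.ev (liftTop fun x => (k x.1 x.2).ev (liftTop f)) := by
  unfold andThen
  rw [PMF.ev_bind]
  congr 1
  funext o
  rcases o with _ | ⟨T, s⟩ <;> simp [PMF.ev_pure]

/-- The expected value of `F` after running `P`, failure counting as infinity. -/
noncomputable def wp (B : ℕ) (P : Program) (F : Post) (x : ℕ × Memory) : ℝ≥0∞ :=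
  (P.exec B x.1 x.2).ev (liftTop F)

theorem wp_mono {B : ℕ} {P : Program} {F G : Post} (h : ∀ x, F x ≤ G x) (x : ℕ × Memory) :
    wp B P F x ≤ wp B P G x :=
  PMF.ev_mono (liftTop_mono h)

theorem wp_seq (B : ℕ) (P Q : Program) (F : Post) (x : ℕ × Memory) :
    wp B (.seq P Q) F x = wp B P (wp B Q F) x := by
  unfold wp
  rw [Program.exec, ev_andThen]

theorem evalThen_some {B : ℕ} {s : Memory} {e : Expr} {v : ℕ} (h : e.eval B s = some v)
    (f : ℕ → PMF Outcome) : evalThen B s e f = f v := by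
  simp [evalThen, h]

theorem evalThen_none {B : ℕ} {s : Memory} {e : Expr} (h : e.eval B s = none)
    (f : ℕ → PMF Outcome) : evalThen B s e f = PMF.pure none := by
  simp [evalThen, h]

theorem mem_support_pay {k T : ℕ} {f : ℕ → PMF Outcome} {T' : ℕ} {s : Memory}
    (h : some (T', s) ∈ (pay k T f).support) : k ≤ T ∧ some (T', s) ∈ (f (T - k)).support := by
  unfold pay at h
  split_ifs at h with hk
  · exact ⟨hk, h⟩
  · simp at h

theorem mem_support_evalThen {B : ℕ} {m : Memory} {e : Expr} {f : ℕ → PMF Outcome} {T' : ℕ}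
    {s : Memory} (h : some (T', s) ∈ (evalThen B m e f).support) :
    ∃ v, e.eval B m = some v ∧ some (T', s) ∈ (f v).support := by
  unfold evalThen at h
  split at h
  · simp at h
  · exact ⟨_, by assumption, h⟩

theorem mem_support_andThen {α : Type} {p : PMF Outcome} {f : ℕ → Memory → PMF (Option α)} {a : α}
    (h : some a ∈ (andThen p f).support) :
    ∃ T s, some (T, s) ∈ p.support ∧ some a ∈ (f T s).support := by
  unfold andThen at h
  rw [PMF.mem_support_bind_iff] at h
  obtain ⟨o, ho, h⟩ := h
  rcases o with _ | ⟨T, s⟩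
  · simp at h
  · exact ⟨T, s, ho, h⟩

theorem loopExec_budget_le {B : ℕ} {e : Expr} {body : ℕ → Memory → PMF Outcome}
    (hb : ∀ T s T' s', some (T', s') ∈ (body T s).support → T' ≤ T) :
    ∀ k T s T' s', some (T', s') ∈ (loopExec B e body k T s).support → T' ≤ T := by
  intro k
  induction k with
  | zero => intro T s T' s' h; simp [loopExec] at h
  | succ k ih =>
    intro T s T' s' h
    rw [loopExec] at h
    obtain ⟨_, h⟩ := mem_support_pay h
    obtain ⟨v, _, h⟩ := mem_support_evalThen h
    split_ifs at h with hv
    · simp at h; omega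
    · obtain ⟨T₁, s₁, h₁, h₂⟩ := mem_support_andThen h
      have := hb _ _ _ _ h₁
      have := ih _ _ _ _ h₂
      omega

/-- Every construct only spends budget. This is what shows that the round counter of a loop, which
is set to the budget, never runs out first. -/
theorem exec_budget_le {B : ℕ} (P : Program) :
    ∀ T s T' s', some (T', s') ∈ (P.exec B T s).support → T' ≤ T := by
  induction P with
  | skip =>
    intro T s T' s' h
    obtain ⟨_, h⟩ := mem_support_pay h
    simp at h; omega
  | store a i e =>
    intro T s T' s' h
    obtain ⟨_, h⟩ := mem_support_pay h
    obtain ⟨v, _, h⟩ := mem_support_evalThen h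
    obtain ⟨v, _, h⟩ := mem_support_evalThen h
    simp at h; omega
  | flip a i =>
    intro T s T' s' h
    obtain ⟨_, h⟩ := mem_support_pay h
    obtain ⟨v, _, h⟩ := mem_support_evalThen h
    rw [PMF.mem_support_bind_iff] at h
    obtain ⟨r, _, h⟩ := h
    simp at h; omega
  | seq p q hp hq =>
    intro T s T' s' h
    obtain ⟨T₁, s₁, h₁, h₂⟩ := mem_support_andThen h
    exact (hq _ _ _ _ h₂).trans (hp _ _ _ _ h₁)
  | ite e p q hp hq =>
    intro T s T' s' h
    obtain ⟨_, h⟩ := mem_support_pay h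
    obtain ⟨v, _, h⟩ := mem_support_evalThen h
    split_ifs at h
    · exact (hq _ _ _ _ h).trans (Nat.sub_le _ _)
    · exact (hp _ _ _ _ h).trans (Nat.sub_le _ _)
  | loop e p hp => exact fun T s T' s' h => loopExec_budget_le hp _ _ _ _ _ h

/-- Each test costs at least one unit, so a loop with budget T makes at most T tests and any two
round counters that are at least T give the same result. -/
theorem loopExec_fuel {B : ℕ} {e : Expr} {body : ℕ → Memory → PMF Outcome}
    (hb : ∀ T s T' s', some (T', s') ∈ (body T s).support → T' ≤ T) :
    ∀ k k' T s, T ≤ k → T ≤ k' → loopExec B e body k T s = loopExec B e body k' T s := by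
  -- With empty budget not even one test can be paid, whatever the round counter is.
  have h0 : ∀ k s, loopExec B e body k 0 s = PMF.pure none := by
    intro k s; cases k <;> simp [loopExec, pay]
  intro k
  induction k with
  | zero => intro k' T s h h'; obtain rfl : T = 0 := by omega
            rw [h0, h0]
  | succ k ih =>
    intro k' T s h h'
    rcases k' with _ | k'
    · obtain rfl : T = 0 := by omega
      rw [h0, h0]
    rw [loopExec, loopExec]
    unfold pay
    split_ifs with hT
    · unfold evalThen
      split
      · rfl
      · beta_reduce
        split_ifs
        · rfl
        · unfold andThen
          refine PMF.bind_congr_support fun o ho => ?_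
          rcases o with _ | ⟨T₁, s₁⟩
          · rfl
          · have := hb _ _ _ _ ho
            exact ih _ _ _ (by omega) (by omega)
    · rfl

/-- One round of a loop. -/
theorem exec_loop (B : ℕ) (e : Expr) (p : Program) (T : ℕ) (s : Memory) :
    (Program.loop e p).exec B T s =
      pay (e.cost + 1) T fun T' => evalThen B s e fun v =>
        if v = 0 then PMF.pure (some (T', s))
        else andThen (p.exec B T' s) ((Program.loop e p).exec B) := by
  rw [Program.exec, loopExec_fuel (exec_budget_le p) T (T + 1) T s le_rfl (by omega), loopExec]
  unfold pay
  split_ifs with hT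
  · beta_reduce
    congr 1; funext v
    split_ifs
    · rfl
    · refine PMF.bind_congr_support fun o ho => ?_
      rcases o with _ | ⟨T₁, s₁⟩
      · rfl
      · have := exec_budget_le _ _ _ _ _ ho
        exact loopExec_fuel (exec_budget_le p) _ _ _ _ (by omega) le_rfl
  · rfl

theorem wp_loop_true {B : ℕ} {e : Expr} {p : Program} {F : Post} {T : ℕ} {s : Memory} {v : ℕ}
    (he : e.eval B s = some v) (hv : v ≠ 0) (hT : e.cost + 1 ≤ T) :
    wp B (.loop e p) F (T, s) = wp B p (wp B (.loop e p) F) (T - (e.cost + 1), s) := by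
  unfold wp
  rw [exec_loop, pay, if_pos hT, evalThen_some he, if_neg hv, ev_andThen]

theorem wp_loop_false {B : ℕ} {e : Expr} {p : Program} {F : Post} {T : ℕ} {s : Memory}
    (he : e.eval B s = some 0) (hT : e.cost + 1 ≤ T) :
    wp B (.loop e p) F (T, s) = F (T - (e.cost + 1), s) := by
  unfold wp
  rw [exec_loop, pay, if_pos hT, evalThen_some he, if_pos rfl, PMF.ev_pure, liftTop_some]

theorem wp_store {B : ℕ} {a : ℕ} {i e : Expr} {F : Post} {T : ℕ} {s : Memory} {j v : ℕ}
    (hi : i.eval B s = some j) (he : e.eval B s = some v) (hT : i.cost + e.cost + 1 ≤ T) :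
    wp B (.store a i e) F (T, s) = F (T - (i.cost + e.cost + 1), s.set a j v) := by
  unfold wp
  rw [Program.exec, pay, if_pos hT, evalThen_some hi, evalThen_some he, PMF.ev_pure, liftTop_some]

theorem wp_ite {B : ℕ} {e : Expr} {p q : Program} {F : Post} {T : ℕ} {s : Memory} {v : ℕ}
    (he : e.eval B s = some v) (hT : e.cost + 1 ≤ T) :
    wp B (.ite e p q) F (T, s) =
      if v = 0 then wp B q F (T - (e.cost + 1), s) else wp B p F (T - (e.cost + 1), s) := by
  unfold wp
  rw [Program.exec, pay, if_pos hT, evalThen_some he]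
  split_ifs <;> rfl

/-! ### Deterministic computations -/

/-- Run on `s`, the program `P` makes no random choice that matters, takes time at most `D`, and
ends in a memory satisfying `Q`. -/
def Det (B : ℕ) (P : Program) (s : Memory) (D : ℕ) (Q : Memory → Prop) : Prop :=
  ∃ c s', c ≤ D ∧ Q s' ∧ ∀ T, c ≤ T → P.exec B T s = PMF.pure (some (T - c, s'))

theorem Det.mono {B : ℕ} {P : Program} {s : Memory} {D D' : ℕ} {Q Q' : Memory → Prop}
    (h : Det B P s D Q) (hD : D ≤ D') (hQ : ∀ s', Q s' → Q' s') : Det B P s D' Q' := by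
  obtain ⟨c, s', hc, hq, h⟩ := h
  exact ⟨c, s', hc.trans hD, hQ _ hq, h⟩

theorem Det.seq {B : ℕ} {P P' : Program} {s : Memory} {D D' : ℕ} {Q Q' : Memory → Prop}
    (h : Det B P s D Q) (h' : ∀ s', Q s' → Det B P' s' D' Q') :
    Det B (.seq P P') s (D + D') Q' := by
  obtain ⟨c, s', hc, hq, h⟩ := h
  obtain ⟨c', s'', hc', hq', h'⟩ := h' s' hq
  refine ⟨c + c', s'', by omega, hq', fun T hT => ?_⟩
  rw [Program.exec, h T (by omega), andThen, PMF.pure_bind]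
  simp only
  rw [h' _ (by omega), Nat.sub_sub]

theorem Det.store {B : ℕ} {a : ℕ} {i e : Expr} {s : Memory} {j v : ℕ} {Q : Memory → Prop}
    (hi : i.eval B s = some j) (he : e.eval B s = some v) (hQ : Q (s.set a j v)) :
    Det B (.store a i e) s (i.cost + e.cost + 1) Q := by
  refine ⟨_, _, le_rfl, hQ, fun T hT => ?_⟩
  rw [Program.exec, pay, if_pos hT, evalThen_some hi, evalThen_some he]

theorem Det.skip {B : ℕ} {s : Memory} {Q : Memory → Prop} (hQ : Q s) : Det B .skip s 1 Q := by
  refine ⟨_, _, le_rfl, hQ, fun T hT => ?_⟩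
  rw [Program.exec, pay, if_pos hT]

theorem Det.ite {B : ℕ} {e : Expr} {p q : Program} {s : Memory} {v D : ℕ} {Q : Memory → Prop}
    (he : e.eval B s = some v) (hq : v = 0 → Det B q s D Q) (hp : v ≠ 0 → Det B p s D Q) :
    Det B (.ite e p q) s (e.cost + 1 + D) Q := by
  by_cases hv : v = 0
  · obtain ⟨c, s', hc, h, hr⟩ := hq hv
    refine ⟨e.cost + 1 + c, s', by omega, h, fun T hT => ?_⟩
    rw [Program.exec, pay, if_pos (by omega), evalThen_some he, if_pos hv, hr _ (by omega),
      Nat.sub_sub]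
  · obtain ⟨c, s', hc, h, hr⟩ := hp hv
    refine ⟨e.cost + 1 + c, s', by omega, h, fun T hT => ?_⟩
    rw [Program.exec, pay, if_pos (by omega), evalThen_some he, if_neg hv, hr _ (by omega),
      Nat.sub_sub]

/-- `I j` is the invariant before round j. The induction is on the number k of rounds still to come,
and the final summand pays for the test that fails. -/
theorem Det.loop {B : ℕ} {e : Expr} {p : Program} {D n : ℕ} {I : ℕ → Memory → Prop}
    (he : ∀ j < n, ∀ s, I j s → ∃ v, v ≠ 0 ∧ e.eval B s = some v)
    (hn : ∀ s, I n s → e.eval B s = some 0)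
    (hp : ∀ j < n, ∀ s, I j s → Det B p s D (I (j + 1))) :
    ∀ k j s, j + k = n → I j s → Det B (.loop e p) s (k * (D + (e.cost + 1)) + (e.cost + 1)) (I n) := by
  intro k
  induction k with
  | zero =>
    intro j s hj hs
    obtain rfl : j = n := by omega
    refine ⟨e.cost + 1, s, by omega, hs, fun T hT => ?_⟩
    rw [exec_loop, pay, if_pos hT, evalThen_some (hn s hs), if_pos rfl]
  | succ k ih =>
    intro j s hj hs
    obtain ⟨v, hv, hev⟩ := he j (by omega) s hs
    obtain ⟨c, s', hc, hq, hr⟩ := hp j (by omega) s hs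
    obtain ⟨c', s'', hc', hq', hr'⟩ := ih (j + 1) s' (by omega) hq
    refine ⟨e.cost + 1 + (c + c'), s'', by rw [Nat.succ_mul]; omega, hq', fun T hT => ?_⟩
    rw [exec_loop, pay, if_pos (by omega), evalThen_some hev, if_neg hv, hr _ (by omega), andThen,
      PMF.pure_bind]
    simp only
    rw [hr' _ (by omega)]
    congr 3; omega

/-- The bridge from deterministic pieces to expectations: only the budget bound and the final
property remain visible, not the exact running time. -/
theorem wp_det {B : ℕ} {P : Program} {s : Memory} {D : ℕ} {Q : Memory → Prop}
    (h : Det B P s D Q) {T : ℕ} (hT : D ≤ T) {F : Post} {v : ℝ≥0∞}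
    (hF : ∀ T' s', T - D ≤ T' → Q s' → F (T', s') ≤ v) : wp B P F (T, s) ≤ v := by
  obtain ⟨c, s', hc, hq, h⟩ := h
  rw [wp, h T (by omega), PMF.ev_pure, liftTop_some]
  exact hF _ _ (by omega) hq

end WordRAM

/-! ### Memory updates and evaluation of expressions -/

namespace WordRAM

theorem Memory.set_apply (s : Memory) (a j v a' j' : ℕ) :
    s.set a j v a' j' = if a' = a ∧ j' = j then v else s a' j' := by
  unfold Memory.set
  by_cases h : a' = a
  · subst h
    by_cases h' : j' = j
    · subst h'; simp
    · simp [h']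
  · simp [h]

theorem Memory.set_of_ne (s : Memory) {a a' : ℕ} (j v : ℕ) (h : a' ≠ a) : s.set a j v a' = s a' := by
  unfold Memory.set
  simp [h]

theorem Expr.eval_lt {B : ℕ} {s : Memory} {e : Expr} {v : ℕ} (h : e.eval B s = some v) : v < B := by
  have hw : ∀ x y, word B x = some y → y < B := by
    intro x y h
    unfold word at h
    split_ifs at h with hx
    · simp at h; omega
  cases e with
  | const k => exact hw _ _ h
  | read a i =>
    simp only [Expr.eval, Option.bind_eq_some_iff] at h
    obtain ⟨_, _, h⟩ := h
    exact hw _ _ h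
  | bin o e f =>
    simp only [Expr.eval, Option.bind_eq_some_iff] at h
    obtain ⟨_, _, _, _, h⟩ := h
    exact hw _ _ h

theorem Expr.eval_const {B : ℕ} {s : Memory} {k : ℕ} (h : k < B) :
    (Expr.const k).eval B s = some k := by
  simp [Expr.eval, word, h]

theorem Expr.eval_read {B : ℕ} {s : Memory} {a : ℕ} {i : Expr} {j : ℕ} (hi : i.eval B s = some j)
    (h : s a j < B) : (Expr.read a i).eval B s = some (s a j) := by
  simp [Expr.eval, word, h, hi]

theorem Expr.eval_bin {B : ℕ} {s : Memory} {o : BinOp} {e f : Expr} {x y : ℕ}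
    (he : e.eval B s = some x) (hf : f.eval B s = some y) (h : o.eval x y < B) :
    (Expr.bin o e f).eval B s = some (o.eval x y) := by
  simp [Expr.eval, word, h, he, hf]

/-! ### Simulating a program with a two-level versioned memory

Cell `i` of the simulated array `a` has two versions, kept in cells `2 i` and `2 i + 1` of array
`2 a + 4`, with time stamps in the same cells of array `2 a + 5`. A version counts if its stamp is
the current one. The current stamps of the two levels are kept in the registers `1` and `2`, and
register `3` tells which level is written to. Increasing register `2` undoes all changes of the
upper level at once. -/

/-- Register `k`. -/
abbrev reg (k : ℕ) : Expr := .read 1 (.const k)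

/-- The simulated content of a cell with index `I`. -/
def simRead (a : ℕ) (I : Expr) : Expr :=
  let lo : Expr := .bin .mul (.const 2) I
  let hi : Expr := .bin .add lo (.const 1)
  let b₁ : Expr := .bin .eq (.read (2 * a + 5) hi) (reg 2)
  let b₀ : Expr := .bin .eq (.read (2 * a + 5) lo) (reg 1)
  .bin .add (.bin .mul b₁ (.read (2 * a + 4) hi))
    (.bin .mul (.bin .sub (.const 1) b₁) (.bin .mul b₀ (.read (2 * a + 4) lo)))

/-- The cell that is written to, the simulated index being kept in cell `0` of array `2`. -/
def simCell : Expr := .bin .add (.bin .mul (.const 2) (.read 2 (.const 0))) (reg 3)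

/-- Stamp the cell that has just been written. -/
def simStamp (a : ℕ) : Program :=
  .store (2 * a + 5) simCell (.read 1 (.bin .add (.const 1) (reg 3)))

/-- Simulated assignment. -/
def simStore (a : ℕ) (i e : Expr) : Program :=
  .seq (.store 2 (.const 0) i) (.seq (.store 2 (.const 1) e)
    (.seq (.store (2 * a + 4) simCell (.read 2 (.const 1))) (simStamp a)))

/-- Simulated coin flip. -/
def simFlip (a : ℕ) (i : Expr) : Program :=
  .seq (.store 2 (.const 0) i) (.seq (.flip (2 * a + 4) simCell) (simStamp a))

def Expr.sim : Expr → Expr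
  | .const k => .const k
  | .read a i => simRead a i.sim
  | .bin o e f => .bin o e.sim f.sim

def Program.sim : Program → Program
  | .skip => .skip
  | .store a i e => simStore a i.sim e.sim
  | .flip a i => simFlip a i.sim
  | .seq p q => .seq p.sim q.sim
  | .ite e p q => .ite e.sim p.sim q.sim
  | .loop e p => .loop e.sim p.sim

/-- The factor by which the simulation is slower. -/
def Program.overhead : Program → ℕ
  | .skip => 1
  | .store _ i e => i.sim.cost + e.sim.cost + 27
  | .flip _ i => i.sim.cost + 23
  | .seq p q => max p.overhead q.overhead
  | .ite e p q => max (e.sim.cost + 1) (max p.overhead q.overhead)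
  | .loop e p => max (e.sim.cost + 1) p.overhead

/-- The simulated memory. -/
def simMem (σ : Memory) : Memory := fun a i =>
  if σ (2 * a + 5) (2 * i + 1) = σ 1 2 then σ (2 * a + 4) (2 * i + 1)
  else if σ (2 * a + 5) (2 * i) = σ 1 1 then σ (2 * a + 4) (2 * i) else 0

/-- The lower level of the simulated memory. -/
def simBase (σ : Memory) : Memory := fun a i =>
  if σ (2 * a + 5) (2 * i) = σ 1 1 then σ (2 * a + 4) (2 * i) else 0

/-- A well-formed memory: words are at most `X`, stamps are not from the future, and the upper
level is void while the lower one is being written. -/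
structure SimWf (X : ℕ) (σ : Memory) : Prop where
  bdd : ∀ a i, σ a i ≤ X
  mode : σ 1 3 = 0 ∨ σ 1 3 = 1
  lower : ∀ a i, σ (2 * a + 5) (2 * i) ≤ σ 1 1
  upper : ∀ a i, σ (2 * a + 5) (2 * i + 1) ≤ σ 1 2
  clean : σ 1 3 = 0 → ∀ a i, σ (2 * a + 5) (2 * i + 1) < σ 1 2

/-- `σ` simulates the memory `s` and arises from `σ₀` by simulated steps. -/
structure SimRel (X : ℕ) (σ₀ s σ : Memory) : Prop where
  wf : SimWf X σ
  mem : simMem σ = s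
  input : σ 0 = σ₀ 0
  regs : σ 1 = σ₀ 1
  counters : σ 3 = σ₀ 3
  base : σ 1 3 = 1 → simBase σ = simBase σ₀

theorem SimRel.refl {X : ℕ} {σ : Memory} (h : SimWf X σ) : SimRel X σ (simMem σ) σ :=
  ⟨h, rfl, rfl, rfl, rfl, fun _ => rfl⟩

/-- Array 2 is scratch space: neither versions nor stamps nor registers live there, so the simulated
memory does not see it. -/
theorem SimRel.temp {X : ℕ} {σ₀ s σ : Memory} (h : SimRel X σ₀ s σ) (j : ℕ) {v : ℕ} (hv : v ≤ X) :
    SimRel X σ₀ s (σ.set 2 j v) := by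
  have h0 : (σ.set 2 j v) 0 = σ 0 := Memory.set_of_ne _ _ _ (by omega)
  have h1 : (σ.set 2 j v) 1 = σ 1 := Memory.set_of_ne _ _ _ (by omega)
  have h3 : (σ.set 2 j v) 3 = σ 3 := Memory.set_of_ne _ _ _ (by omega)
  have h4 : ∀ a, (σ.set 2 j v) (2 * a + 4) = σ (2 * a + 4) :=
    fun a => Memory.set_of_ne _ _ _ (by omega)
  have h5 : ∀ a, (σ.set 2 j v) (2 * a + 5) = σ (2 * a + 5) :=
    fun a => Memory.set_of_ne _ _ _ (by omega)
  refine ⟨⟨fun a i => ?_, ?_, ?_, ?_, ?_⟩, ?_, ?_, ?_, ?_, ?_⟩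
  · rw [Memory.set_apply]; split_ifs
    · exact hv
    · exact h.wf.bdd a i
  · rw [h1]; exact h.wf.mode
  · intro a i; rw [h1, h5]; exact h.wf.lower a i
  · intro a i; rw [h1, h5]; exact h.wf.upper a i
  · rw [h1]; intro hm a i; rw [h5]; exact h.wf.clean hm a i
  · rw [← h.mem]; funext a i; simp only [simMem, h1, h4, h5]
  · rw [h0, h.input]
  · rw [h1, h.regs]
  · rw [h3, h.counters]
  · rw [h1]; intro hm; rw [← h.base hm]; funext a i; simp only [simBase, h1, h4, h5]

/-- In mode 0 the write goes to the even cell with the stamp of register 1, and it is visible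
because all upper versions are void. In mode 1 it goes to the odd cell with the stamp of register 2;
it then hides the lower version without touching it, so that `simBase` survives. -/
theorem SimRel.put {X : ℕ} {σ₀ s σ : Memory} (h : SimRel X σ₀ s σ) (a x : ℕ) {y : ℕ} (hy : y ≤ X) :
    SimRel X σ₀ (s.set a x y) ((σ.set (2 * a + 4) (2 * x + σ 1 3) y).set (2 * a + 5)
      (2 * x + σ 1 3) (σ 1 (1 + σ 1 3))) := by
  set σ' := (σ.set (2 * a + 4) (2 * x + σ 1 3) y).set (2 * a + 5)
      (2 * x + σ 1 3) (σ 1 (1 + σ 1 3)) with hσ'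
  have hlow : ∀ b, b < 4 → σ' b = σ b := fun b hb => by
    rw [hσ', Memory.set_of_ne _ _ _ (by omega), Memory.set_of_ne _ _ _ (by omega)]
  have hval : ∀ b j, σ' (2 * b + 4) j = if b = a ∧ j = 2 * x + σ 1 3 then y else σ (2 * b + 4) j := by
    intro b j
    rw [hσ', Memory.set_of_ne _ _ _ (by omega), Memory.set_apply]
    congr 1
    simp
  have hst : ∀ b j, σ' (2 * b + 5) j =
      if b = a ∧ j = 2 * x + σ 1 3 then σ 1 (1 + σ 1 3) else σ (2 * b + 5) j := by
    intro b j
    rw [hσ', Memory.set_apply, Memory.set_of_ne _ _ _ (by omega)]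
    congr 1
    simp
  have h1 := hlow 1 (by omega)
  refine ⟨⟨fun b i => ?_, ?_, ?_, ?_, ?_⟩, ?_, ?_, ?_, ?_, ?_⟩
  · rw [hσ', Memory.set_apply, Memory.set_apply]
    split_ifs
    · exact h.wf.bdd _ _
    · exact hy
    · exact h.wf.bdd _ _
  · rw [h1]; exact h.wf.mode
  · intro b i; rw [h1, hst]
    split_ifs with hc
    · rcases h.wf.mode with hm | hm
      · rw [hm]
      · omega
    · exact h.wf.lower b i
  · intro b i; rw [h1, hst]
    split_ifs with hc
    · rcases h.wf.mode with hm | hm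
      · omega
      · rw [hm]
    · exact h.wf.upper b i
  · rw [h1]; intro hm b i; rw [hst, if_neg (by omega)]; exact h.wf.clean hm b i
  · funext b i
    rw [Memory.set_apply, ← h.mem]
    simp only [simMem, h1, hval, hst]
    rcases h.wf.mode with hm | hm
    · have := h.wf.clean hm b i
      have e1 : ¬ (b = a ∧ 2 * i + 1 = 2 * x + σ 1 3) := by omega
      rw [if_neg e1, if_neg e1, if_neg this.ne]
      by_cases hc : b = a ∧ i = x
      · have e2 : b = a ∧ 2 * i = 2 * x + σ 1 3 := by omega
        rw [if_pos hc, if_pos e2, if_pos e2, hm, if_pos rfl]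
      · have e2 : ¬ (b = a ∧ 2 * i = 2 * x + σ 1 3) := by omega
        rw [if_neg hc, if_neg e2, if_neg e2, if_neg this.ne]
    · have e2 : ¬ (b = a ∧ 2 * i = 2 * x + σ 1 3) := by omega
      by_cases hc : b = a ∧ i = x
      · have e1 : b = a ∧ 2 * i + 1 = 2 * x + σ 1 3 := by omega
        rw [if_pos hc, if_pos e1, if_pos e1, hm, if_pos rfl]
      · have e1 : ¬ (b = a ∧ 2 * i + 1 = 2 * x + σ 1 3) := by omega
        rw [if_neg hc, if_neg e1, if_neg e1, if_neg e2, if_neg e2]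
  · rw [hlow 0 (by omega), h.input]
  · rw [h1, h.regs]
  · rw [hlow 3 (by omega), h.counters]
  · rw [h1]; intro hm; rw [← h.base hm]; funext b i
    have e2 : ¬ (b = a ∧ 2 * i = 2 * x + σ 1 3) := by omega
    simp only [simBase, h1, hval, hst, if_neg e2]

section

variable {X B' : ℕ}

theorem eval_reg (hB' : 2 * X + 4 ≤ B') {σ : Memory} (hσ : ∀ a i, σ a i ≤ X) {k : ℕ} (hk : k < 4) :
    (reg k).eval B' σ = some (σ 1 k) :=
  Expr.eval_read (Expr.eval_const (by omega)) (by have := hσ 1 k; omega)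

theorem eval_simRead (hB' : 2 * X + 4 ≤ B') {σ : Memory} (hσ : ∀ a i, σ a i ≤ X) (a : ℕ) {I : Expr} {i : ℕ}
    (hI : I.eval B' σ = some i) (hi : i ≤ X) :
    (simRead a I).eval B' σ = some (simMem σ a i) := by
  have c1 : (Expr.const 1).eval B' σ = some 1 := Expr.eval_const (by omega)
  have lo : (Expr.bin .mul (.const 2) I).eval B' σ = some (2 * i) :=
    Expr.eval_bin (Expr.eval_const (by omega)) hI (by simp [BinOp.eval]; omega)
  have hi' : (Expr.bin .add (.bin .mul (.const 2) I) (.const 1)).eval B' σ = some (2 * i + 1) :=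
    Expr.eval_bin lo c1 (by simp [BinOp.eval]; omega)
  have rd : ∀ b J j, J.eval B' σ = some j → (Expr.read b J).eval B' σ = some (σ b j) :=
    fun b J j hJ => Expr.eval_read hJ (by have := hσ b j; omega)
  have hbit : ∀ x y, BinOp.eval .eq x y ≤ 1 := by
    intro x y; simp only [BinOp.eval]; split_ifs <;> omega
  have b1 := Expr.eval_bin (o := .eq) (rd (2 * a + 5) _ _ hi') (eval_reg hB' hσ (k := 2) (by omega))
    (by have := hbit (σ (2 * a + 5) (2 * i + 1)) (σ 1 2); omega)
  have b0 := Expr.eval_bin (o := .eq) (rd (2 * a + 5) _ _ lo) (eval_reg hB' hσ (k := 1) (by omega))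
    (by have := hbit (σ (2 * a + 5) (2 * i)) (σ 1 1); omega)
  have v1 := hσ (2 * a + 4) (2 * i + 1)
  have v0 := hσ (2 * a + 4) (2 * i)
  have hs1 := Expr.eval_bin (o := .mul) b1 (rd (2 * a + 4) _ _ hi')
    (by simp only [BinOp.eval]; split_ifs <;> omega)
  have hs0 := Expr.eval_bin (o := .mul) b0 (rd (2 * a + 4) _ _ lo)
    (by simp only [BinOp.eval]; split_ifs <;> omega)
  have hs2 := Expr.eval_bin (o := .mul) (Expr.eval_bin (o := .sub) c1 b1
    (by simp only [BinOp.eval]; split_ifs <;> omega)) hs0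
    (by simp only [BinOp.eval]; split_ifs <;> omega)
  have := Expr.eval_bin (o := .add) hs1 hs2 (by simp only [BinOp.eval]; split_ifs <;> omega)
  rw [simRead, this]
  simp only [BinOp.eval, simMem]
  split_ifs <;> simp

/-- The simulated machine has words below B ≤ X, the simulating one below B' ≥ 2X + 4. The room is
needed for the cell index 2i + 1; values themselves are unchanged. -/
theorem Expr.eval_sim (hB' : 2 * X + 4 ≤ B') {B : ℕ} (hB : B ≤ X) {σ₀ s σ : Memory} (h : SimRel X σ₀ s σ) (e : Expr) :
    ∀ v, e.eval B s = some v → e.sim.eval B' σ = some v := by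
  induction e with
  | const k =>
    intro v hv
    have := Expr.eval_lt hv
    simp only [Expr.eval, word] at hv
    split_ifs at hv with hk
    simp only [Option.some.injEq] at hv
    subst hv
    exact Expr.eval_const (by omega)
  | read a i ih =>
    intro v hv
    simp only [Expr.eval, Option.bind_eq_some_iff] at hv
    obtain ⟨j, hj, hv⟩ := hv
    unfold word at hv
    split_ifs at hv
    simp only [Option.some.injEq] at hv
    subst hv
    rw [← h.mem]
    exact eval_simRead hB' h.wf.bdd a (ih j hj) (by have := Expr.eval_lt hj; omega)
  | bin o e f he hf =>
    intro v hv
    simp only [Expr.eval, Option.bind_eq_some_iff] at hv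
    obtain ⟨x, hx, y, hy, hv⟩ := hv
    unfold word at hv
    split_ifs at hv
    simp only [Option.some.injEq] at hv
    subst hv
    exact Expr.eval_bin (he x hx) (hf y hy) (by omega)

theorem eval_simCell (hB' : 2 * X + 4 ≤ B') {σ : Memory} (h : SimWf X σ) :
    simCell.eval B' σ = some (2 * σ 2 0 + σ 1 3) := by
  have h0 := h.bdd 2 0
  have hm := h.mode
  exact Expr.eval_bin (o := .add) (Expr.eval_bin (o := .mul) (Expr.eval_const (by omega))
    (Expr.eval_read (Expr.eval_const (by omega)) (by omega)) (by simp only [BinOp.eval]; omega))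
    (eval_reg hB' h.bdd (by omega)) (by simp only [BinOp.eval]; omega)

theorem eval_stamp (hB' : 2 * X + 4 ≤ B') {σ : Memory} (h : SimWf X σ) :
    (Expr.read 1 (.bin .add (.const 1) (reg 3))).eval B' σ = some (σ 1 (1 + σ 1 3)) := by
  have hm := h.mode
  exact Expr.eval_read (Expr.eval_bin (o := .add) (Expr.eval_const (by omega))
    (eval_reg hB' h.bdd (by omega)) (by simp only [BinOp.eval]; omega))
    (by have := h.bdd 1 (1 + σ 1 3); omega)

/-- The stores that finish a simulated assignment or coin flip. -/
theorem det_simStamp (hB' : 2 * X + 4 ≤ B') {σ₀ s σ : Memory} (h : SimRel X σ₀ s σ) (a : ℕ) {y : ℕ} (hy : y ≤ X) :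
    Det B' (simStamp a) (σ.set (2 * a + 4) (2 * σ 2 0 + σ 1 3) y) 13
      (SimRel X σ₀ (s.set a (σ 2 0) y)) := by
  set τ := σ.set (2 * a + 4) (2 * σ 2 0 + σ 1 3) y with hτ
  have h1 : τ 1 = σ 1 := Memory.set_of_ne _ _ _ (by omega)
  have h2 : τ 2 = σ 2 := Memory.set_of_ne _ _ _ (by omega)
  have hτb : ∀ b i, τ b i ≤ X := fun b i => by
    rw [hτ, Memory.set_apply]; split_ifs
    · exact hy
    · exact h.wf.bdd _ _
  have h5 : ∀ b, τ (2 * b + 5) = σ (2 * b + 5) := fun b => Memory.set_of_ne _ _ _ (by omega)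
  have hwf : SimWf X τ := ⟨hτb, by rw [h1]; exact h.wf.mode,
    fun b i => by rw [h1, h5]; exact h.wf.lower b i, fun b i => by rw [h1, h5]; exact h.wf.upper b i,
    by rw [h1]; intro hm b i; rw [h5]; exact h.wf.clean hm b i⟩
  refine Det.store (eval_simCell hB' hwf) (eval_stamp hB' hwf) ?_
  rw [h1, h2]
  exact h.put a _ hy

theorem det_simStore (hB' : 2 * X + 4 ≤ B') {σ₀ s σ : Memory} (h : SimRel X σ₀ s σ) (a : ℕ) {i e : Expr} {x y : ℕ}
    (hi : i.eval B' σ = some x) (hx : x ≤ X) (he : e.eval B' (σ.set 2 0 x) = some y)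
    (hy : y ≤ X) :
    Det B' (simStore a i e) σ (i.cost + e.cost + 27) (SimRel X σ₀ (s.set a x y)) := by
  have h1 := h.temp 0 hx
  have h2 := h1.temp 1 hy
  refine Det.mono (Det.seq (Det.store (Expr.eval_const (by omega)) hi rfl) ?_)
    (D := (1 + i.cost + 1) + ((1 + e.cost + 1) + (10 + 13))) (by omega) fun _ h => h
  rintro _ rfl
  refine Det.seq (Det.store (Expr.eval_const (by omega)) he rfl) ?_
  rintro _ rfl
  refine Det.seq (Q := fun τ => τ = _) (Det.store (eval_simCell hB' h2.wf)
    (Expr.eval_read (Expr.eval_const (by omega)) (j := 1) ?_) rfl) ?_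
  · have := h2.wf.bdd 2 1; omega
  · rintro _ rfl
    have := det_simStamp hB' h2 a hy
    have e0 : ((σ.set 2 0 x).set 2 1 y) 2 0 = x := by simp [Memory.set_apply]
    have e1 : ((σ.set 2 0 x).set 2 1 y) 2 1 = y := by simp [Memory.set_apply]
    rw [e0] at this
    rw [e0, e1]
    exact this

/-- The simulated flip draws the same fair bit, so the comparison may be made separately for each
value `r` of the bit. -/
theorem wp_simFlip (hB' : 2 * X + 4 ≤ B') {σ₀ s σ : Memory} (h : SimRel X σ₀ s σ) (hX : 1 ≤ X) (a : ℕ) {i : Expr} {x : ℕ}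
    (hi : i.eval B' σ = some x) (hx : x ≤ X) {F : Post} {T : ℕ} (hT : i.cost + 23 ≤ T)
    {v : Bool → ℝ≥0∞}
    (hF : ∀ r : Bool, ∀ T' σ', T - (i.cost + 23) ≤ T' → SimRel X σ₀ (s.set a x r.toNat) σ' →
      F (T', σ') ≤ v r) :
    wp B' (simFlip a i) F (T, σ) ≤ (PMF.uniformOfFintype Bool).ev v := by
  have h1 := h.temp 0 hx
  have hc : simCell.cost = 7 := rfl
  rw [simFlip, wp_seq, wp_store (Expr.eval_const (by omega)) hi (by simp [Expr.cost]; omega), wp_seq]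
  rw [wp, Program.exec, pay, if_pos (by simp [Expr.cost, hc]; omega),
    evalThen_some (eval_simCell hB' h1.wf), PMF.ev_bind]
  refine PMF.ev_mono fun r => ?_
  rw [PMF.ev_pure, liftTop_some]
  have hr : r.toNat ≤ X := by cases r <;> simp; omega
  refine wp_det (det_simStamp hB' h1 a hr) (by simp [Expr.cost, hc]; omega) fun T' σ' hT' hr' => ?_
  have e0 : (σ.set 2 0 x) 2 0 = x := by simp [Memory.set_apply]
  rw [e0] at hr'
  refine hF r T' σ' ?_ hr'
  simp [Expr.cost, hc] at hT'
  omega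

end

/-- An original step of cost k ≥ 1 releases K · k ≥ K units of simulation budget, which covers a
simulated step of cost c ≤ K. The slack E passes through untouched and is reserved for the code that
follows. -/
theorem budget_step {K T T' E k c : ℕ} (hc : c ≤ K) (hk : 1 ≤ k) (hkT : k ≤ T)
    (h : K * T + E ≤ T') : c ≤ T' ∧ K * (T - k) + E ≤ T' - c := by
  obtain ⟨u, rfl⟩ := Nat.exists_eq_add_of_le hkT
  rw [Nat.add_sub_cancel_left]
  have : K ≤ K * k := Nat.le_mul_of_pos_right K hk
  rw [mul_add] at h
  omega

/-- The simulation is correct: expectations do not become larger, provided that the budget is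
sufficient. -/
theorem wp_sim {X B B' : ℕ} (hB' : 2 * X + 4 ≤ B') (hB : B ≤ X) (hX : 1 ≤ X) {K : ℕ} (P : Program)
    (σ₀ : Memory) (E : ℕ) :
    P.overhead ≤ K → ∀ (T T' : ℕ) (s σ : Memory) (F G : Post), SimRel X σ₀ s σ → K * T + E ≤ T' →
    (∀ T₁ s₁ T₁' σ₁, SimRel X σ₀ s₁ σ₁ → K * T₁ + E ≤ T₁' → F (T₁', σ₁) ≤ G (T₁, s₁)) →
    wp B' P.sim F (T', σ) ≤ wp B P G (T, s) := by
  induction P with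
  | skip =>
    intro hK T T' s σ F G h hT hFG
    rw [wp, wp, Program.exec, pay]
    split_ifs with hk
    · obtain ⟨h1, h2⟩ := budget_step hK le_rfl hk hT
      replace h1 : 1 ≤ T' := h1
      rw [Program.sim, Program.exec, pay, if_pos h1, PMF.ev_pure, PMF.ev_pure]
      exact hFG _ _ _ _ h h2
    · simp [PMF.ev_pure]
  | store a i e =>
    intro hK T T' s σ F G h hT hFG
    rw [wp.eq_def B, Program.exec, pay]
    split_ifs with hk
    · rcases hi : i.eval B s with _ | x
      · simp [evalThen_none hi, PMF.ev_pure]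
      rcases he : e.eval B s with _ | y
      · simp [evalThen_some hi, evalThen_none he, PMF.ev_pure]
      simp only [evalThen_some hi, evalThen_some he, PMF.ev_pure, liftTop_some]
      have hx := Expr.eval_lt hi
      have hy := Expr.eval_lt he
      obtain ⟨h1, h2⟩ := budget_step hK (by omega) hk hT
      refine wp_det (det_simStore hB' h a (Expr.eval_sim hB' hB h i x hi) (by omega)
        (Expr.eval_sim hB' hB (h.temp 0 (by omega)) e y he) (by omega)) h1 fun T₁ σ₁ hT₁ hσ₁ => ?_
      exact hFG _ _ _ _ hσ₁ (h2.trans hT₁)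
    · simp [PMF.ev_pure]
  | flip a i =>
    intro hK T T' s σ F G h hT hFG
    rw [wp.eq_def B, Program.exec, pay]
    split_ifs with hk
    · rcases hi : i.eval B s with _ | x
      · simp [evalThen_none hi, PMF.ev_pure]
      have hx := Expr.eval_lt hi
      simp only [evalThen_some hi, PMF.ev_bind, PMF.ev_pure, liftTop_some]
      obtain ⟨h1, h2⟩ := budget_step hK (by omega) hk hT
      refine wp_simFlip hB' h hX a (Expr.eval_sim hB' hB h i x hi) (by omega) h1
        fun r T₁ σ₁ hT₁ hσ₁ => ?_
      exact hFG _ _ _ _ hσ₁ (h2.trans hT₁)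
    · simp [PMF.ev_pure]
  | seq p q hp hq =>
    intro hK T T' s σ F G h hT hFG
    rw [Program.sim, wp_seq, wp_seq]
    exact hp (le_trans (le_max_left _ _) hK) T T' s σ _ _ h hT fun T₁ s₁ T₁' σ₁ h₁ hT₁ =>
      hq (le_trans (le_max_right _ _) hK) T₁ T₁' s₁ σ₁ _ _ h₁ hT₁ hFG
  | ite e p q hp hq =>
    intro hK T T' s σ F G h hT hFG
    simp only [Program.overhead, max_le_iff] at hK
    rw [wp.eq_def B, Program.exec, pay]
    split_ifs with hk
    · rcases he : e.eval B s with _ | x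
      · simp [evalThen_none he, PMF.ev_pure]
      obtain ⟨h1, h2⟩ := budget_step hK.1 (by omega) hk hT
      simp only [evalThen_some he]
      rw [Program.sim, wp_ite (Expr.eval_sim hB' hB h e x he) h1]
      split_ifs
      · exact hq hK.2.2 _ _ _ _ _ _ h h2 hFG
      · exact hp hK.2.1 _ _ _ _ _ _ h h2 hFG
    · simp [PMF.ev_pure]
  | loop e p hp =>
    intro hK T T' s σ F G h hT hFG
    simp only [Program.overhead, max_le_iff] at hK
    rw [wp.eq_def B, Program.exec]
    -- The induction runs on the round counter of the original loop only. When it is exhausted the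
    -- right-hand side is ∞; otherwise both loops are unfolded by one round.
    suffices H : ∀ k T T' s σ, SimRel X σ₀ s σ → K * T + E ≤ T' →
        wp B' (Program.loop e p).sim F (T', σ) ≤
          (loopExec B e (p.exec B) k T s).ev (liftTop G) from H T T T' s σ h hT
    intro k
    induction k with
    | zero => intro T T' s σ _ _; simp [loopExec, PMF.ev_pure]
    | succ k ih =>
      intro T T' s σ h hT
      rw [loopExec, pay]
      split_ifs with hk
      · rcases he : e.eval B s with _ | x
        · simp [evalThen_none he, PMF.ev_pure]
        obtain ⟨h1, h2⟩ := budget_step hK.1 (by omega) hk hT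
        simp only [evalThen_some he]
        have he' := Expr.eval_sim hB' hB h e x he
        split_ifs with hx
        · subst hx
          rw [Program.sim, wp_loop_false he' h1, PMF.ev_pure, liftTop_some]
          exact hFG _ _ _ _ h h2
        · rw [ev_andThen]
          rw [Program.sim, wp_loop_true he' hx h1]
          exact hp hK.2 _ _ _ _ _ (fun x => (loopExec B e (p.exec B) k x.1 x.2).ev (liftTop G))
            h h2 fun T₁ s₁ T₁' σ₁ h₁ hT₁ => ih T₁ T₁' s₁ σ₁ h₁ hT₁
      · simp [PMF.ev_pure]

end WordRAM

/-! ### Subdivided graphs with switchable edges -/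

/-- Nodes joined by paths of length `g + 1`, and pairs of nodes that may be joined by an edge. The
nodes and the inner vertices of the paths are numbered by `e`. -/
structure PathScheme (N S ι V : Type) (g : ℕ) where
  e : N ⊕ S × Fin g ≃ V
  fst : S → N
  snd : S → N
  left : ι → N
  right : ι → N

namespace PathScheme

variable {N S ι V : Type} {g : ℕ} (H : PathScheme N S ι V g)

/-- The vertex of a node. -/
def node (x : N) : V := H.e (.inl x)

/-- The vertex number `k` of a path. -/
def pt (s : S) (k : ℕ) : V :=
  if k = 0 then H.node (H.fst s)
  else if h : k - 1 < g then H.e (.inr (s, ⟨k - 1, h⟩)) else H.node (H.snd s)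

theorem pt_zero (s : S) : H.pt s 0 = H.node (H.fst s) := by simp [pt]

theorem pt_inner (s : S) (k : Fin g) : H.pt s (k + 1) = H.e (.inr (s, k)) := by
  simp [pt]

theorem pt_last (s : S) : H.pt s (g + 1) = H.node (H.snd s) := by
  simp [pt]

/-- The edge number `k` of a path. -/
def pathEdge (p : S × Fin (g + 1)) : Sym2 V := s(H.pt p.1 p.2, H.pt p.1 (p.2 + 1))

/-- A switchable edge. -/
def switchEdge (t : ι) : Sym2 V := s(H.node (H.left t), H.node (H.right t))

/-- All paths, and the switchable edges selected by `on`. -/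
def edges (on : ι → Prop) : Set (Sym2 V) :=
  Set.range H.pathEdge ∪ H.switchEdge '' {t | on t}

def graph (on : ι → Prop) : SimpleGraph V := SimpleGraph.fromEdgeSet (H.edges on)

/-- Different switchable edges join different pairs of nodes, and there are no loops. -/
structure Proper : Prop where
  pos : 1 ≤ g
  ends : ∀ s, H.fst s ≠ H.snd s
  switch_ends : ∀ t, H.left t ≠ H.right t
  switch_inj : Function.Injective fun t => s(H.left t, H.right t)

variable {H}

theorem node_injective : Function.Injective H.node := fun x y h => by
  simpa [node] using h

theorem Proper.pt_injOn (h : H.Proper) (s : S) {j k : ℕ} (hj : j ≤ g + 1) (hk : k ≤ g + 1)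
    (hjk : H.pt s j = H.pt s k) : j = k := by
  have he := h.ends s
  unfold pt node at hjk
  split_ifs at hjk with h1 h2 h3 h4 h5 <;> simp [he, he.symm] at hjk <;> omega

/-- An inner vertex determines the path and its position. -/
theorem pt_eq_inner {s s' : S} {j k : ℕ} (hj : j ≠ 0) (hjg : j ≤ g)
    (hjk : H.pt s j = H.pt s' k) : s = s' ∧ j = k := by
  unfold pt node at hjk
  rw [if_neg hj, dif_pos (by omega)] at hjk
  split_ifs at hjk with h1 h2
  · simp at hjk
  · simp at hjk; exact ⟨hjk.1, by omega⟩
  · simp at hjk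

theorem Proper.not_isDiag_pathEdge (h : H.Proper) (p : S × Fin (g + 1)) :
    ¬ (H.pathEdge p).IsDiag := by
  intro hd
  rw [pathEdge, Sym2.mk_isDiag_iff] at hd
  have := h.pt_injOn p.1 (by omega) (by omega) hd
  omega

theorem Proper.not_isDiag_switchEdge (h : H.Proper) (t : ι) : ¬ (H.switchEdge t).IsDiag := by
  intro hd
  rw [switchEdge, Sym2.mk_isDiag_iff] at hd
  exact h.switch_ends t (node_injective hd)

/-- Since g ≥ 1, every edge of a path has an inner vertex as an end, and an inner vertex determines
its path. Hence parallel paths between the same two nodes do no harm. -/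
theorem Proper.pathEdge_injective (h : H.Proper) : Function.Injective H.pathEdge := by
  have hg := h.pos
  rintro ⟨s, k⟩ ⟨s', k'⟩ hp
  have hs : s = s' := by
    rw [pathEdge, pathEdge, Sym2.eq_iff] at hp
    simp only at hp
    -- The first edge has its far end as an inner vertex, every other edge its near end.
    by_cases hk : (k : ℕ) = 0
    · rcases hp with hp | hp
      · exact (pt_eq_inner (by omega) (by omega) hp.2).1
      · exact (pt_eq_inner (by omega) (by omega) hp.2).1
    · rcases hp with hp | hp
      · exact (pt_eq_inner hk (by omega) hp.1).1
      · exact (pt_eq_inner hk (by omega) hp.1).1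
  subst hs
  rw [pathEdge, pathEdge, Sym2.eq_iff] at hp
  simp only at hp
  rcases hp with hp | hp
  · have := h.pt_injOn s (by omega) (by omega) hp.1
    simp [Fin.ext_iff, this]
  · have h1 := h.pt_injOn s (by omega) (by omega) hp.1
    have h2 := h.pt_injOn s (by omega) (by omega) hp.2
    omega

theorem Proper.switchEdge_injective (h : H.Proper) : Function.Injective H.switchEdge := by
  intro t t' ht
  apply h.switch_inj
  simp only [switchEdge, Sym2.eq_iff] at ht ⊢
  rcases ht with ht | ht
  · exact .inl ⟨node_injective ht.1, node_injective ht.2⟩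
  · exact .inr ⟨node_injective ht.1, node_injective ht.2⟩

theorem Proper.pathEdge_ne_switchEdge (h : H.Proper) (p : S × Fin (g + 1)) (t : ι) :
    H.pathEdge p ≠ H.switchEdge t := by
  have hg := h.pos
  obtain ⟨s, k⟩ := p
  have hne : ∀ (j : ℕ) (x : N), j ≠ 0 → j ≤ g → H.pt s j ≠ H.node x := by
    intro j x hj hjg hx
    unfold pt node at hx
    rw [if_neg hj, dif_pos (by omega)] at hx
    simp at hx
  intro hp
  rw [pathEdge, switchEdge, Sym2.eq_iff] at hp
  simp only at hp
  by_cases hk : (k : ℕ) = 0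
  · rcases hp with hp | hp <;> exact hne _ _ (by omega) (by omega) hp.2
  · rcases hp with hp | hp <;> exact hne _ _ hk (by omega) hp.1

theorem Proper.edgeSet_graph (h : H.Proper) (on : ι → Prop) :
    (H.graph on).edgeSet = H.edges on := by
  rw [graph, SimpleGraph.edgeSet_fromEdgeSet, sdiff_eq_left, Set.disjoint_left]
  rintro x (⟨p, rfl⟩ | ⟨t, _, rfl⟩)
  · exact h.not_isDiag_pathEdge p
  · exact h.not_isDiag_switchEdge t

theorem Proper.adj_pt (h : H.Proper) (on : ι → Prop) (s : S) {k : ℕ} (hk : k ≤ g) :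
    (H.graph on).Adj (H.pt s k) (H.pt s (k + 1)) := by
  rw [← SimpleGraph.mem_edgeSet, h.edgeSet_graph]
  exact .inl ⟨(s, ⟨k, by omega⟩), rfl⟩

theorem Proper.adj_switch (h : H.Proper) {on : ι → Prop} {t : ι} (ht : on t) :
    (H.graph on).Adj (H.node (H.left t)) (H.node (H.right t)) := by
  rw [← SimpleGraph.mem_edgeSet, h.edgeSet_graph]
  exact .inr ⟨t, ht, rfl⟩

theorem Proper.edist_pt_le (h : H.Proper) (on : ι → Prop) (s : S) {k : ℕ} (hk : k ≤ g + 1) :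
    (H.graph on).edist (H.node (H.fst s)) (H.pt s k) ≤ k := by
  induction k with
  | zero => simp [pt_zero]
  | succ k ih =>
    refine (SimpleGraph.edist_triangle (v := H.pt s k)).trans ?_
    push_cast
    exact add_le_add (ih (by omega))
      (SimpleGraph.edist_eq_one_iff_adj.2 (h.adj_pt on s (by omega))).le

theorem Proper.edist_ends_le (h : H.Proper) (on : ι → Prop) (s : S) :
    (H.graph on).edist (H.node (H.fst s)) (H.node (H.snd s)) ≤ (g + 1 : ℕ) := by
  rw [← pt_last]
  exact h.edist_pt_le on s le_rfl

/-- The extension of a function on the nodes to the inner vertices of the paths. -/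
def potential (H : PathScheme N S ι V g) (φ : N → ℕ) (v : V) : ℕ :=
  match H.e.symm v with
  | .inl x => φ x
  | .inr (s, k) => min (φ (H.fst s) + (k + 1)) (φ (H.snd s) + (g - k))

theorem potential_node (φ : N → ℕ) (x : N) : H.potential φ (H.node x) = φ x := by
  simp [potential, node]

theorem potential_inner (φ : N → ℕ) (s : S) (k : Fin g) :
    H.potential φ (H.e (.inr (s, k))) =
      min (φ (H.fst s) + (k + 1)) (φ (H.snd s) + (g - k)) := by
  simp [potential]

/-- `φ` varies by at most `g + 1` along a path, and not at all along a switchable edge. -/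
structure IsPotential (H : PathScheme N S ι V g) (on : ι → Prop) (φ : N → ℕ) : Prop where
  fst_le : ∀ s, φ (H.fst s) ≤ φ (H.snd s) + (g + 1)
  snd_le : ∀ s, φ (H.snd s) ≤ φ (H.fst s) + (g + 1)
  switch : ∀ t, on t → φ (H.left t) = φ (H.right t)

/-- By the two Lipschitz conditions the formula for inner vertices also holds at both ends of the
path, so path edges need no case distinction afterwards. -/
theorem IsPotential.pt {on : ι → Prop} {φ : N → ℕ} (hφ : H.IsPotential on φ) (s : S) {k : ℕ}
    (hk : k ≤ g + 1) :
    H.potential φ (H.pt s k) = min (φ (H.fst s) + k) (φ (H.snd s) + (g + 1 - k)) := by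
  have h1 := hφ.fst_le s
  have h2 := hφ.snd_le s
  rcases Nat.eq_zero_or_pos k with rfl | hk0
  · rw [pt_zero, potential_node]; omega
  · rcases hk.eq_or_lt with rfl | hk'
    · rw [pt_last, potential_node]; omega
    · obtain ⟨j, rfl⟩ : ∃ j, k = j + 1 := ⟨k - 1, by omega⟩
      have := H.pt_inner s ⟨j, by omega⟩
      simp only at this
      rw [this, potential_inner]
      simp

theorem IsPotential.adj {on : ι → Prop} {φ : N → ℕ} (hφ : H.IsPotential on φ) {x y : V}
    (h : (H.graph on).Adj x y) : H.potential φ x ≤ H.potential φ y + 1 := by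
  rw [graph, SimpleGraph.fromEdgeSet_adj] at h
  rcases h.1 with ⟨⟨s, k⟩, hp⟩ | ⟨t, ht, hp⟩
  · have h1 := hφ.pt s (k := k) (by omega)
    have h2 := hφ.pt s (k := k + 1) (by omega)
    rw [pathEdge, Sym2.eq_iff] at hp
    rcases hp with ⟨rfl, rfl⟩ | ⟨rfl, rfl⟩ <;> rw [h1, h2] <;> omega
  · have := hφ.switch t ht
    rw [switchEdge, Sym2.eq_iff] at hp
    rcases hp with ⟨rfl, rfl⟩ | ⟨rfl, rfl⟩ <;> rw [potential_node, potential_node] <;> omega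

/-- A potential changes by at most one along every edge, hence by at most the length along a walk.
Exhibiting a potential thus certifies a lower bound on distances. -/
theorem IsPotential.le_edist {on : ι → Prop} {φ : N → ℕ} (hφ : H.IsPotential on φ) (x y : V) :
    (H.potential φ x : ℕ∞) ≤ H.potential φ y + (H.graph on).edist x y := by
  by_cases hr : (H.graph on).Reachable x y
  · obtain ⟨p, hp⟩ := hr.exists_walk_length_eq_edist
    rw [← hp]
    have : ∀ {x y} (p : (H.graph on).Walk x y),
        H.potential φ x ≤ H.potential φ y + p.length := by
      intro x y p
      induction p with
      | nil => simp
      | cons h p ih =>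
        have := hφ.adj h
        rw [SimpleGraph.Walk.length_cons]; omega
    exact_mod_cast this p
  · rw [SimpleGraph.edist_eq_top_of_not_reachable hr]; simp

end PathScheme

/-! ### The radius instance of a hitting set instance -/

namespace HittingGraph

open PathScheme

/-- The nodes: leaves of the vectors in `U`, leaves of the vectors in `V` (in two copies), a star
centre for every vector and a hub (in two copies), two ports per coordinate (in two copies). -/
abbrev Node (n q d : ℕ) : Type :=
  Fin n ⊕ (Fin 2 × Fin q) ⊕ (Fin 2 × Fin (n + q + 1)) ⊕ (Fin 2 × (Fin 2 × Fin (d + 1)))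

/-- A slot is a path, given by its copy, a row z and a column c. Rows z < n + q belong to the star
centres of the vectors; rows n + q and n + q + 1 both start at the hub and serve the two sides of
ports. Columns c < d are coordinates, column d leads to the dummy port, and column d + 1 to the
leaf. For the hub the last column merely duplicates the path to the dummy port, which keeps the
numbering of slots a plain product. -/
abbrev Slot (n q d : ℕ) : Type := Fin 2 × (Fin (n + q + 2) × Fin (d + 2))

variable {n q d : ℕ}

def leafU (z : Fin n) : Node n q d := .inl z
def leafV (i : Fin 2) (v : Fin q) : Node n q d := .inr (.inl (i, v))
def star (i : Fin 2) (z : Fin (n + q + 1)) : Node n q d := .inr (.inr (.inl (i, z)))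
def port (i s : Fin 2) (c : Fin (d + 1)) : Node n q d := .inr (.inr (.inr (i, (s, c))))

abbrev numNodes (n q d : ℕ) : ℕ := n + (2 * q + (2 * (n + q + 1) + 2 * (2 * (d + 1))))
abbrev numSlots (n q d : ℕ) : ℕ := 2 * ((n + q + 2) * (d + 2))
abbrev numVertices (n q d g : ℕ) : ℕ := numNodes n q d + numSlots n q d * g

def nodeEquiv (n q d : ℕ) : Node n q d ≃ Fin (numNodes n q d) :=
  (Equiv.sumCongr (Equiv.refl _) ((Equiv.sumCongr finProdFinEquiv ((Equiv.sumCongr finProdFinEquiv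
    ((Equiv.prodCongr (Equiv.refl _) finProdFinEquiv).trans finProdFinEquiv)).trans
      finSumFinEquiv)).trans finSumFinEquiv)).trans finSumFinEquiv

def slotEquiv (n q d : ℕ) : Slot n q d ≃ Fin (numSlots n q d) :=
  (Equiv.prodCongr (Equiv.refl _) finProdFinEquiv).trans finProdFinEquiv

def vertexEquiv (n q d g : ℕ) : Node n q d ⊕ Slot n q d × Fin g ≃ Fin (numVertices n q d g) :=
  (Equiv.sumCongr (nodeEquiv n q d) ((Equiv.prodCongr (slotEquiv n q d) (Equiv.refl _)).trans
    finProdFinEquiv)).trans finSumFinEquiv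

/-- The port that a vector selects for coordinate `c`: the last one if the entry is `0`. -/
def select (b : Fin d → Bool) (c : ℕ) : Fin (d + 1) :=
  if h : c < d then (if b ⟨c, h⟩ then ⟨c, by omega⟩ else Fin.last d) else Fin.last d

/-- The end of a path. -/
def slotEnd (U : Fin n → Fin d → Bool) (V : Fin q → Fin d → Bool) (s : Slot n q d) : Node n q d :=
  if hz : s.2.1.val < n then
    if s.2.2.val = d + 1 then leafU ⟨s.2.1, hz⟩ else port s.1 0 (select (U ⟨s.2.1, hz⟩) s.2.2)
  else if hz' : s.2.1.val < n + q then
    if s.2.2.val = d + 1 then leafV s.1 ⟨s.2.1 - n, by omega⟩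
    else port s.1 1 (select (V ⟨s.2.1 - n, by omega⟩) s.2.2)
  else port s.1 ⟨s.2.1 - (n + q), by omega⟩ ⟨min s.2.2 d, by omega⟩

/-- The graph: the switchable edges join the two ports of a coordinate. -/
def scheme (g : ℕ) (U : Fin n → Fin d → Bool) (V : Fin q → Fin d → Bool) :
    PathScheme (Node n q d) (Slot n q d) (Fin 2 × Fin d) (Fin (numVertices n q d g)) g where
  e := vertexEquiv n q d g
  fst s := star s.1 ⟨min s.2.1 (n + q), by omega⟩
  snd := slotEnd U V
  left t := port t.1 0 t.2.castSucc
  right t := port t.1 1 t.2.castSucc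

variable {g : ℕ} {U : Fin n → Fin d → Bool} {V : Fin q → Fin d → Bool}

theorem proper (hg : 1 ≤ g) : (scheme g U V).Proper where
  pos := hg
  ends s := by
    simp only [scheme, slotEnd, star, leafU, leafV, port]
    split_ifs <;> simp
  switch_ends t := by simp [scheme, port]
  switch_inj := by
    rintro ⟨i, c⟩ ⟨i', c'⟩ h
    simp [scheme, port] at h
    simp [h]

/-- `u`, `v` and `w` have a common one. -/
def Hits (u v w : Fin d → Bool) : Prop := ∃ c, u c ∧ v c ∧ w c

theorem tripleProduct_ne_zero_iff (u v w : Fin d → Bool) : tripleProduct u v w ≠ 0 ↔ Hits u v w := by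
  unfold tripleProduct Hits
  rw [Ne, Finset.sum_eq_zero_iff]
  push Not
  simp only [Finset.mem_univ, true_and]
  refine exists_congr fun c => ?_
  cases u c <;> cases v c <;> cases w c <;> simp

abbrev graph (g : ℕ) (U : Fin n → Fin d → Bool) (V : Fin q → Fin d → Bool) (w : Fin d → Bool) :
    SimpleGraph (Fin (numVertices n q d g)) :=
  (scheme g U V).graph fun t => w t.2 = true

/-! #### Short distances -/

theorem select_last (b : Fin d → Bool) : select b d = Fin.last d := by simp [select]

theorem select_of_true {b : Fin d → Bool} {c : Fin d} (h : b c = true) :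
    select b c = c.castSucc := by
  simp only [select, c.2, dif_pos, h, if_true]
  rfl

theorem star_cases {P : Fin (n + q + 1) → Prop} (hU : ∀ u : Fin n, P ⟨u, by omega⟩)
    (hV : ∀ v : Fin q, P ⟨n + v, by omega⟩) (hH : P (Fin.last (n + q))) (z : Fin (n + q + 1)) :
    P z := by
  by_cases h1 : z.val < n
  · exact hU ⟨z, h1⟩
  · by_cases h2 : z.val < n + q
    · have := hV ⟨z - n, by omega⟩
      simpa [show n + (z.val - n) = z from by omega] using this
    · have : z = Fin.last (n + q) := by ext; simp; omega
      rwa [this]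

theorem edist_star_end (hg : 1 ≤ g) (on : Fin 2 × Fin d → Prop) (s : Slot n q d) :
    ((scheme g U V).graph on).edist ((scheme g U V).node (star s.1 ⟨min s.2.1 (n + q), by omega⟩))
      ((scheme g U V).node (slotEnd U V s)) ≤ (g + 1 : ℕ) :=
  (proper hg).edist_ends_le on s

theorem edist_star_leafU (hg : 1 ≤ g) (on : Fin 2 × Fin d → Prop) (i : Fin 2) (u : Fin n) :
    ((scheme g U V).graph on).edist ((scheme g U V).node (star i ⟨u, by omega⟩))
      ((scheme g U V).node (leafU u)) ≤ (g + 1 : ℕ) := by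
  have := edist_star_end (U := U) (V := V) hg on (i, ⟨u, by omega⟩, ⟨d + 1, by omega⟩)
  simp only [slotEnd, u.2, dif_pos, if_pos, show min u.val (n + q) = u from by omega] at this
  exact this

theorem edist_star_leafV (hg : 1 ≤ g) (on : Fin 2 × Fin d → Prop) (i : Fin 2) (v : Fin q) :
    ((scheme g U V).graph on).edist ((scheme g U V).node (star i ⟨n + v, by omega⟩))
      ((scheme g U V).node (leafV i v)) ≤ (g + 1 : ℕ) := by
  have := edist_star_end (U := U) (V := V) hg on (i, ⟨n + v, by omega⟩, ⟨d + 1, by omega⟩)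
  simpa [slotEnd, show min (n + v.val) (n + q) = n + v from by omega] using this

theorem edist_star_portU (hg : 1 ≤ g) (on : Fin 2 × Fin d → Prop) (i : Fin 2) (u : Fin n) (c : Fin (d + 1)) :
    ((scheme g U V).graph on).edist ((scheme g U V).node (star i ⟨u, by omega⟩))
      ((scheme g U V).node (port i 0 (select (U u) c))) ≤ (g + 1 : ℕ) := by
  have := edist_star_end (U := U) (V := V) hg on (i, ⟨u, by omega⟩, ⟨c, by omega⟩)
  simpa [slotEnd, show min u.val (n + q) = u from by omega,
    show c.val ≠ d + 1 from by omega] using this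

theorem edist_star_portV (hg : 1 ≤ g) (on : Fin 2 × Fin d → Prop) (i : Fin 2) (v : Fin q) (c : Fin (d + 1)) :
    ((scheme g U V).graph on).edist ((scheme g U V).node (star i ⟨n + v, by omega⟩))
      ((scheme g U V).node (port i 1 (select (V v) c))) ≤ (g + 1 : ℕ) := by
  have := edist_star_end (U := U) (V := V) hg on (i, ⟨n + v, by omega⟩, ⟨c, by omega⟩)
  simpa [slotEnd, show min (n + v.val) (n + q) = n + v from by omega,
    show c.val ≠ d + 1 from by omega] using this

theorem edist_hub_port (hg : 1 ≤ g) (on : Fin 2 × Fin d → Prop) (i s : Fin 2) (c : Fin (d + 1)) :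
    ((scheme g U V).graph on).edist ((scheme g U V).node (star i (Fin.last (n + q))))
      ((scheme g U V).node (port i s c)) ≤ (g + 1 : ℕ) := by
  have := edist_star_end (U := U) (V := V) hg on (i, ⟨n + q + s, by omega⟩, ⟨c, by omega⟩)
  simpa [slotEnd, show ¬ (n + q + s.val < n) from by omega, show min c.val d = c from by omega,
    Fin.last] using this

/-- Every vertex is close to a star centre. -/
theorem exists_star_edist_le (hg : 1 ≤ g) (on : Fin 2 × Fin d → Prop) (x : Fin (numVertices n q d g)) : ∃ i z,
    ((scheme g U V).graph on).edist ((scheme g U V).node (star i z)) x ≤ (g + 1 : ℕ) := by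
  obtain ⟨y, rfl⟩ := (scheme g U V).e.surjective x
  rcases y with (u | ⟨i, v⟩ | ⟨i, z⟩ | ⟨i, s, c⟩) | ⟨s, k⟩
  · exact ⟨0, _, edist_star_leafU hg on 0 u⟩
  · exact ⟨i, _, edist_star_leafV hg on i v⟩
  · refine ⟨i, z, ?_⟩
    change ((scheme g U V).graph on).edist _ ((scheme g U V).node (star i z)) ≤ _
    simp
  · exact ⟨i, _, edist_hub_port hg on i s c⟩
  · refine ⟨s.1, ⟨min s.2.1 (n + q), by omega⟩, ?_⟩
    rw [← PathScheme.pt_inner]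
    refine ((proper hg).edist_pt_le on s (k := k + 1) (by omega)).trans ?_
    exact_mod_cast (by omega : k.val + 1 ≤ g + 1)

theorem edist_star_hub_U (hg : 1 ≤ g) (on : Fin 2 × Fin d → Prop) (i : Fin 2) (u : Fin n) :
    ((scheme g U V).graph on).edist ((scheme g U V).node (star i ⟨u, by omega⟩))
      ((scheme g U V).node (star i (Fin.last (n + q)))) ≤ (2 * (g + 1) : ℕ) := by
  have h1 := edist_star_portU (U := U) (V := V) hg on i u (Fin.last d)
  have h2 := edist_hub_port (U := U) (V := V) hg on i 0 (Fin.last d)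
  rw [Fin.val_last, select_last] at h1
  rw [SimpleGraph.edist_comm] at h2
  refine SimpleGraph.edist_triangle.trans ((add_le_add h1 h2).trans ?_)
  exact_mod_cast (by omega)

theorem edist_star_hub_V (hg : 1 ≤ g) (on : Fin 2 × Fin d → Prop) (i : Fin 2) (v : Fin q) :
    ((scheme g U V).graph on).edist ((scheme g U V).node (star i ⟨n + v, by omega⟩))
      ((scheme g U V).node (star i (Fin.last (n + q)))) ≤ (2 * (g + 1) : ℕ) := by
  have h1 := edist_star_portV (U := U) (V := V) hg on i v (Fin.last d)
  have h2 := edist_hub_port (U := U) (V := V) hg on i 1 (Fin.last d)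
  rw [Fin.val_last, select_last] at h1
  rw [SimpleGraph.edist_comm] at h2
  refine SimpleGraph.edist_triangle.trans ((add_le_add h1 h2).trans ?_)
  exact_mod_cast (by omega)

/-- Dummy ports join all star centres of a copy to its hub, and the leaf of any u belongs to both
copies. The switchable edges play no role, so the graph is connected for every w; only U must be
nonempty. -/
theorem connected (hg : 1 ≤ g) (on : Fin 2 × Fin d → Prop) (hn : 0 < n) : ((scheme g U V).graph on).Connected := by
  set G := (scheme g U V).graph on
  have reach : ∀ {x y : Fin (numVertices n q d g)} {k : ℕ}, G.edist x y ≤ k → G.Reachable x y :=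
    fun h => SimpleGraph.reachable_of_edist_ne_top fun ht => by rw [ht] at h; simp at h
  have hleaf : ∀ i, G.Reachable ((scheme g U V).node (star i (Fin.last (n + q))))
      ((scheme g U V).node (leafU ⟨0, hn⟩)) := fun i =>
    (reach (edist_star_hub_U hg on i ⟨0, hn⟩)).symm.trans (reach (edist_star_leafU hg on i ⟨0, hn⟩))
  have hstar : ∀ i z, G.Reachable ((scheme g U V).node (star i z))
      ((scheme g U V).node (leafU ⟨0, hn⟩)) := fun i z => by
    refine star_cases (P := fun z => G.Reachable ((scheme g U V).node (star i z))
      ((scheme g U V).node (leafU ⟨0, hn⟩))) (fun u => ?_) (fun v => ?_) ?_ z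
    · exact (reach (edist_star_hub_U hg on i u)).trans (hleaf i)
    · exact (reach (edist_star_hub_V hg on i v)).trans (hleaf i)
    · exact hleaf i
  have hall : ∀ x, G.Reachable x ((scheme g U V).node (leafU ⟨0, hn⟩)) := fun x => by
    obtain ⟨i, z, h⟩ := exists_star_edist_le (U := U) (V := V) hg on x
    exact (reach h).symm.trans (hstar i z)
  have : Nonempty (Fin (numVertices n q d g)) := ⟨(scheme g U V).node (leafU ⟨0, hn⟩)⟩
  exact ⟨fun x y => (hall x).trans (hall y).symm⟩

/-- If `u` and `w` hit all of `V`, then the leaf of `u` is close to all vertices. -/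
theorem radius_le (hg : 1 ≤ g) {w : Fin d → Bool} {u : Fin n} (hu : ∀ v, Hits (U u) (V v) w) :
    (graph g U V w).radius ≤ (4 * (g + 1) + 1 : ℕ) := by
  set on : Fin 2 × Fin d → Prop := fun t => w t.2 = true with hon
  set G := (scheme g U V).graph on
  refine SimpleGraph.radius_le_eccent.trans (b := G.eccent ((scheme g U V).node (leafU u))) ?_
  rw [SimpleGraph.eccent_le_iff]
  have h0 : ∀ i, G.edist ((scheme g U V).node (leafU u))
      ((scheme g U V).node (star i ⟨u, by omega⟩)) ≤ (g + 1 : ℕ) := fun i => by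
    rw [SimpleGraph.edist_comm]; exact edist_star_leafU hg on i u
  -- Star centres of U are reached through the dummy port, those of V through a common one and its
  -- switchable edge, which costs the extra 1, and the hub through the dummy port again.
  have hstar : ∀ i z, G.edist ((scheme g U V).node (leafU u)) ((scheme g U V).node (star i z)) ≤
      (3 * (g + 1) + 1 : ℕ) := fun i z => by
    refine star_cases (P := fun z => G.edist ((scheme g U V).node (leafU u))
      ((scheme g U V).node (star i z)) ≤ (3 * (g + 1) + 1 : ℕ)) (fun u' => ?_) (fun v => ?_) ?_ z
    · have h1 := edist_star_portU (U := U) (V := V) hg on i u (Fin.last d)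
      have h2 := edist_star_portU (U := U) (V := V) hg on i u' (Fin.last d)
      rw [Fin.val_last, select_last] at h1 h2
      rw [SimpleGraph.edist_comm] at h2
      refine SimpleGraph.edist_triangle.trans ((add_le_add (h0 i)
        (SimpleGraph.edist_triangle.trans (add_le_add h1 h2))).trans ?_)
      exact_mod_cast (by omega)
    · obtain ⟨c, hc1, hc2, hc3⟩ := hu v
      have h1 := edist_star_portU (U := U) (V := V) hg on i u c.castSucc
      have h2 := edist_star_portV (U := U) (V := V) hg on i v c.castSucc
      rw [Fin.val_castSucc, select_of_true hc1] at h1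
      rw [Fin.val_castSucc, select_of_true hc2] at h2
      rw [SimpleGraph.edist_comm] at h2
      have h3 : G.edist ((scheme g U V).node (port i 0 c.castSucc))
          ((scheme g U V).node (port i 1 c.castSucc)) = 1 :=
        SimpleGraph.edist_eq_one_iff_adj.2 ((proper hg).adj_switch (t := (i, c)) hc3)
      refine SimpleGraph.edist_triangle.trans ((add_le_add (h0 i)
        (SimpleGraph.edist_triangle.trans (add_le_add h1
          (SimpleGraph.edist_triangle.trans (add_le_add h3.le h2))))).trans ?_)
      exact_mod_cast (by omega)
    · refine SimpleGraph.edist_triangle.trans ((add_le_add (h0 i)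
        (edist_star_hub_U hg on i u)).trans ?_)
      exact_mod_cast (by omega)
  intro x
  obtain ⟨i, z, h⟩ := exists_star_edist_le (U := U) (V := V) hg on x
  refine SimpleGraph.edist_triangle.trans ((add_le_add (hstar i z) h).trans ?_)
  exact_mod_cast (by omega)

/-! #### Long distances -/

section lower

open Classical in
/-- A lower bound, in units of `g + 1`, for the distance to the leaf of `v₀` in copy `i₀`. -/
noncomputable def level (U : Fin n → Fin d → Bool) (V : Fin q → Fin d → Bool) (w : Fin d → Bool)
    (v₀ : Fin q) (i₀ : Fin 2) : Node n q d → ℕ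
  | .inl u => if Hits (U u) (V v₀) w then 4 else 6
  | .inr (.inl (i, v)) => if i = i₀ then (if v = v₀ then 0 else 3) else 6
  | .inr (.inr (.inl (i, z))) =>
    if hz : z.val < n then
      if Hits (U ⟨z, hz⟩) (V v₀) w then (if i = i₀ then 3 else 5) else (if i = i₀ then 5 else 6)
    else if i = i₀ then (if z.val = n + v₀ then 1 else 3) else 6
  | .inr (.inr (.inr (i, (s, c)))) =>
    if i = i₀ then
      if s = 0 then (if ∃ h : c.val < d, V v₀ ⟨c, h⟩ ∧ w ⟨c, h⟩ then 2 else 4)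
      else (if ∀ h : c.val < d, V v₀ ⟨c, h⟩ then 2 else 4)
    else 6

/-- Two places carry the content. If u is not hit, its centre in copy `i₀` has level 5, so it must
not select a port of level 2. The centre of `v₀` has level 1, so it must select only ports of level
2. The remaining cases compare constants. -/
theorem level_ends (w : Fin d → Bool) (v₀ : Fin q) (i₀ : Fin 2) (s : Slot n q d) :
    level U V w v₀ i₀ ((scheme g U V).fst s) ≤ level U V w v₀ i₀ (slotEnd U V s) + 1 ∧
    level U V w v₀ i₀ (slotEnd U V s) ≤ level U V w v₀ i₀ ((scheme g U V).fst s) + 1 := by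
  obtain ⟨i, ⟨z, hz⟩, ⟨c, hc⟩⟩ := s
  simp only [scheme, slotEnd, star, leafU, leafV, port]
  by_cases h1 : z < n
  · have e1 : (⟨min z (n + q), by omega⟩ : Fin (n + q + 1)) = ⟨z, by omega⟩ := by ext; simp; omega
    simp only [e1]
    simp only [h1, dif_pos, level]
    by_cases h2 : c = d + 1
    · simp only [h2, if_true]
      split_ifs <;> simp
    · simp only [h2, if_false]
      by_cases h3 : Hits (U ⟨z, h1⟩) (V v₀) w
      · simp only [if_pos h3]
        split_ifs <;> simp
      -- A selected U-port of level 2 would be a coordinate in which u, `v₀` and w are all 1.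
      · have : ¬ ∃ h : (select (U ⟨z, h1⟩) c).val < d, V v₀ ⟨_, h⟩ ∧ w ⟨_, h⟩ := by
          rintro ⟨h, h4, h5⟩
          unfold select at h h4 h5
          split_ifs at h h4 h5 with h6 h7
          · exact h3 ⟨⟨c, h6⟩, h7, h4, h5⟩
          · simp at h
          · simp at h
        rw [if_neg h3, if_neg this]
        split_ifs <;> simp_all
  · simp only [h1, dif_neg, not_false_eq_true]
    by_cases h2 : z < n + q
    · have e1 : min z (n + q) = z := by omega
      simp only [h2, dif_pos, e1]
      by_cases h3 : c = d + 1
      · simp only [h3, if_true, level, h1, dif_neg, not_false_eq_true]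
        by_cases h4 : z = n + v₀
        · have : (⟨z - n, by omega⟩ : Fin q) = v₀ := by ext; simp; omega
          simp only [h4]
          split_ifs <;> simp_all
        · have : ¬ (⟨z - n, by omega⟩ : Fin q) = v₀ := by rw [Fin.ext_iff]; simp; omega
          simp only [h4, this]
          split_ifs <;> simp
      · simp only [h3, if_false, level, h1, dif_neg, not_false_eq_true]
        by_cases h4 : z = n + v₀
        · have e : (⟨z - n, by omega⟩ : Fin q) = v₀ := by ext; simp; omega
          -- Every port that `v₀` selects is either one of its ones or the dummy port, for which the
          -- condition is void.
          have : ∀ h : (select (V ⟨z - n, by omega⟩) c).val < d, V v₀ ⟨_, h⟩ := by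
            rw [e]
            intro h
            unfold select at h ⊢
            split_ifs at h ⊢ with h6 h7
            · exact h7
            · simp at h
            · simp at h
          rw [if_pos this]
          split_ifs <;> simp_all
        · rw [if_neg h4]
          split_ifs <;> simp_all
    · have e1 : min z (n + q) = n + q := by omega
      simp only [h2, dif_neg, not_false_eq_true, e1, level]
      have : ¬ n + q < n := by omega
      have : ¬ n + q = n + v₀ := by omega
      split_ifs <;> simp

/-- Where w[c] = 1 the level conditions on the two ports of c both reduce to the entry of `v₀`, so
the level is constant along every switchable edge that is present. -/
theorem isPotential (w : Fin d → Bool) (v₀ : Fin q) (i₀ : Fin 2) :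
    (scheme g U V).IsPotential (fun t => w t.2 = true)
      fun x => (g + 1) * level U V w v₀ i₀ x where
  fst_le s := by
    have := (level_ends (g := g) (U := U) (V := V) w v₀ i₀ s).1
    calc _ ≤ (g + 1) * (level U V w v₀ i₀ (slotEnd U V s) + 1) := Nat.mul_le_mul_left _ this
      _ = _ := by rw [Nat.mul_succ]; rfl
  snd_le s := by
    have := (level_ends (g := g) (U := U) (V := V) w v₀ i₀ s).2
    calc _ ≤ (g + 1) * (level U V w v₀ i₀ ((scheme g U V).fst s) + 1) := Nat.mul_le_mul_left _ this
      _ = _ := by rw [Nat.mul_succ]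
  switch t ht := by
    simp only [scheme, port, level]
    congr 1
    simp [ht]

/-- If for every `u` some element of `V` is missed, then all vertices have large eccentricity. -/
theorem le_radius {w : Fin d → Bool} (hn : 0 < n) (hu : ∀ u, ∃ v, ¬ Hits (U u) (V v) w) :
    ((6 * (g + 1) : ℕ) : ℕ∞) ≤ (graph g U V w).radius := by
  refine le_iInf fun x => ?_
  -- The vertex far from x is the leaf of v in copy i, which has level 0. It suffices to choose i
  -- and v so that the potential of x is at least 6 (g + 1).
  suffices H : ∃ i v, ∀ y, y = x → 6 * (g + 1) ≤
      (scheme g U V).potential (fun x => (g + 1) * level U V w v i x) y by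
    obtain ⟨i, v, h⟩ := H
    have h1 := (isPotential (g := g) (U := U) (V := V) w v i).le_edist x
      ((scheme g U V).node (leafV i v))
    rw [potential_node] at h1
    simp only [leafV, level, if_true, mul_zero, Nat.cast_zero, zero_add] at h1
    refine le_trans ?_ (h1.trans SimpleGraph.edist_le_eccent)
    exact_mod_cast h x rfl
  have key : ∀ {a : ℕ}, 6 ≤ a → 6 * (g + 1) ≤ (g + 1) * a := fun h => by
    rw [mul_comm]; exact Nat.mul_le_mul_left _ h
  -- The target copy will be the one that does not contain x; for the common leaves of U either copy
  -- will do.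
  have hi : ∀ i : Fin 2, ∃ j : Fin 2, i ≠ j := fun i => by
    rcases i with ⟨_ | _ | i, h⟩
    · exact ⟨1, by simp⟩
    · exact ⟨0, by simp⟩
    · omega
  have nodeCase : ∀ {i v} (x : Node n q d), 6 ≤ level U V w v i x →
      ∀ y, y = (scheme g U V).e (.inl x) → 6 * (g + 1) ≤
        (scheme g U V).potential (fun x => (g + 1) * level U V w v i x) y := by
    rintro i v x hx _ rfl
    exact (key hx).trans_eq (potential_node (H := scheme g U V)
      (fun x => (g + 1) * level U V w v i x) x).symm
  obtain ⟨y, rfl⟩ := (scheme g U V).e.surjective x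
  rcases y with (u | ⟨i, v⟩ | ⟨i, z⟩ | ⟨i, s, c⟩) | ⟨⟨i, z, c⟩, k⟩
  · obtain ⟨v, hv⟩ := hu u
    refine ⟨0, v, fun y hy => nodeCase _ ?_ y hy⟩
    simp [level, hv]
  · obtain ⟨v', hv⟩ := hu ⟨0, hn⟩
    obtain ⟨j, hj⟩ := hi i
    refine ⟨j, v', fun y hy => nodeCase _ ?_ y hy⟩
    simp [level, hj]
  · obtain ⟨j, hj⟩ := hi i
    by_cases hz : z.val < n
    · obtain ⟨v', hv⟩ := hu ⟨z, hz⟩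
      refine ⟨j, v', fun y hy => nodeCase _ ?_ y hy⟩
      simp [level, hj, hz, hv]
    · obtain ⟨v', hv⟩ := hu ⟨0, hn⟩
      refine ⟨j, v', fun y hy => nodeCase _ ?_ y hy⟩
      simp [level, hj, hz]
  · obtain ⟨v', hv⟩ := hu ⟨0, hn⟩
    obtain ⟨j, hj⟩ := hi i
    refine ⟨j, v', fun y hy => nodeCase _ ?_ y hy⟩
    simp [level, hj]
  · obtain ⟨j, hj⟩ := hi i
    -- For an inner vertex of a path it is enough that both ends have level 6. On a path from the
    -- centre of u, the target v' must be missed by u; elsewhere any missed v' will do.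
    suffices H : ∃ v', 6 ≤ level U V w v' j ((scheme g U V).fst (i, z, c)) ∧
        6 ≤ level U V w v' j (slotEnd U V (i, z, c)) by
      obtain ⟨v', h1, h2⟩ := H
      refine ⟨j, v', ?_⟩
      rintro _ rfl
      rw [potential_inner]
      have h1 := key h1
      have h2 := key h2
      exact le_min (h1.trans (Nat.le_add_right _ _)) (h2.trans (Nat.le_add_right _ _))
    by_cases hz : z.val < n
    · obtain ⟨v', hv⟩ := hu ⟨z, hz⟩
      refine ⟨v', ?_, ?_⟩
      · simp [scheme, star, level, hz, hv, hj, show min z.val (n + q) = z from by omega]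
      · simp only [slotEnd, hz, dif_pos, leafU, port]
        split_ifs
        · simp [level, hv]
        · simp [level, hj]
    · obtain ⟨v', hv⟩ := hu ⟨0, hn⟩
      refine ⟨v', ?_, ?_⟩
      · simp [scheme, star, level, hj, hz]
      · rw [slotEnd, dif_neg hz]
        simp only [leafV, port]
        split_ifs <;> simp [level, hj]

end lower

end HittingGraph

/-! ### Switching single edges and counting edges -/

namespace PathScheme

variable {N S ι V : Type} {g : ℕ} {H : PathScheme N S ι V g}

theorem graph_sup_edge {on on' : ι → Prop} {t : ι} (h : ∀ t', on' t' ↔ on t' ∨ t' = t) :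
    H.graph on ⊔ SimpleGraph.edge (H.node (H.left t)) (H.node (H.right t)) = H.graph on' := by
  rw [graph, SimpleGraph.edge, ← SimpleGraph.fromEdgeSet_union, graph]
  congr 1
  ext x
  simp only [edges, Set.mem_union, Set.mem_range, Set.mem_image, Set.mem_ofPred_eq, h,
    Set.mem_singleton_iff, or_and_right, exists_or, exists_eq_left, ← or_assoc, eq_comm (a := x)]
  rfl

/-- Deleting one switchable edge must leave all others and all paths in place, which is where the
distinctness of the edges enters. -/
theorem Proper.deleteEdges_graph (hH : H.Proper) {on on' : ι → Prop} {t : ι}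
    (h : ∀ t', on' t' ↔ on t' ∧ t' ≠ t) :
    (H.graph on).deleteEdges {s(H.node (H.left t), H.node (H.right t))} = H.graph on' := by
  rw [graph, SimpleGraph.deleteEdges_fromEdgeSet, graph]
  congr 1
  ext x
  simp only [edges, Set.mem_sdiff, Set.mem_union, Set.mem_range, Set.mem_image, Set.mem_ofPred_eq, h,
    Set.mem_singleton_iff]
  constructor
  · rintro ⟨hp | ⟨t', ht', rfl⟩, hx⟩
    · exact .inl hp
    · exact .inr ⟨t', ⟨ht', fun h => hx (h ▸ rfl)⟩, rfl⟩
  · rintro (⟨p, rfl⟩ | ⟨t', ht', rfl⟩)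
    · exact ⟨.inl ⟨p, rfl⟩, hH.pathEdge_ne_switchEdge p t⟩
    · exact ⟨.inr ⟨t', ht'.1, rfl⟩, fun h => ht'.2 (hH.switchEdge_injective h)⟩

theorem Proper.adj_switch_iff (hH : H.Proper) {on : ι → Prop} {t : ι} :
    (H.graph on).Adj (H.node (H.left t)) (H.node (H.right t)) ↔ on t := by
  refine ⟨fun h => ?_, hH.adj_switch⟩
  rw [← SimpleGraph.mem_edgeSet, hH.edgeSet_graph] at h
  rcases h with ⟨p, hp⟩ | ⟨t', ht', hp⟩
  · exact absurd hp (hH.pathEdge_ne_switchEdge p t)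
  · rwa [← hH.switchEdge_injective hp]

theorem Proper.ncard_edgeSet_le [Fintype S] [Fintype ι] (hH : H.Proper) (on : ι → Prop) :
    (H.graph on).edgeSet.ncard ≤ Fintype.card S * (g + 1) + Fintype.card ι := by
  rw [hH.edgeSet_graph]
  refine (Set.ncard_union_le _ _).trans (add_le_add ?_ ?_)
  · rw [← Set.image_univ]
    refine (Set.ncard_image_le Set.finite_univ).trans ?_
    simp [Set.ncard_univ]
  · refine (Set.ncard_image_le (Set.toFinite _)).trans ?_
    rw [← Nat.card_eq_fintype_card, ← Set.ncard_univ]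
    exact Set.ncard_le_ncard (Set.subset_univ _)

end PathScheme

namespace HittingGraph

open PathScheme

variable {n q d g : ℕ} {U : Fin n → Fin d → Bool} {V : Fin q → Fin d → Bool}

/-! ### The operations belonging to a vector -/

/-- The switchable edge number `j`. -/
def switch (j : Fin (2 * d)) : Fin 2 × Fin d := finProdFinEquiv.symm j

/-- The operation that switches an edge from its initial state. -/
def switchOp (g : ℕ) (U : Fin n → Fin d → Bool) (V : Fin q → Fin d → Bool) (init : Bool)
    (t : Fin 2 × Fin d) : GraphOp (numVertices n q d g) :=
  if init then .delete ((scheme g U V).node (port t.1 0 t.2.castSucc))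
    ((scheme g U V).node (port t.1 1 t.2.castSucc))
  else .insert ((scheme g U V).node (port t.1 0 t.2.castSucc))
    ((scheme g U V).node (port t.1 1 t.2.castSucc))

/-- The operations for the vector `w` from the switchable edge number `j` on, and a query. -/
def opsFrom (g : ℕ) (U : Fin n → Fin d → Bool) (V : Fin q → Fin d → Bool) (init : Bool)
    (w : Fin d → Bool) (j : ℕ) : List (GraphOp (numVertices n q d g)) :=
  ((List.finRange (2 * d)).drop j).flatMap
    (fun j => if w (switch j).2 = init then [] else [switchOp g U V init (switch j)]) ++ [.query]

theorem opsFrom_of_lt {init : Bool} {w : Fin d → Bool} {j : ℕ} (hj : j < 2 * d) :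
    opsFrom g U V init w j = (if w (switch ⟨j, hj⟩).2 = init then []
      else [switchOp g U V init (switch ⟨j, hj⟩)]) ++ opsFrom g U V init w (j + 1) := by
  rw [opsFrom, List.drop_eq_getElem_cons (by simpa using hj), List.flatMap_cons, List.append_assoc,
    opsFrom]
  simp

theorem opsFrom_last {init : Bool} {w : Fin d → Bool} :
    opsFrom g U V init w (2 * d) = [.query] := by
  rw [opsFrom, List.drop_of_length_le (by simp)]
  rfl

theorem length_opsFrom_le {init : Bool} {w : Fin d → Bool} :
    (opsFrom g U V init w 0).length ≤ 2 * d + 1 := by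
  suffices H : ∀ k j, j + k = 2 * d → (opsFrom g U V init w j).length ≤ k + 1 from
    H (2 * d) 0 (by simp)
  intro k
  induction k with
  | zero => intro j hj; obtain rfl : j = 2 * d := by omega
            rw [opsFrom_last]; simp
  | succ k ih =>
    intro j hj
    rw [opsFrom_of_lt (by omega), List.length_append]
    have := ih (j + 1) (by omega)
    split_ifs <;> simp <;> omega

theorem getLast?_opsFrom {init : Bool} {w : Fin d → Bool} {j : ℕ} :
    (opsFrom g U V init w j).getLast? = some .query := by
  simp [opsFrom]

/-- The switchable edges that are present after the first `j` ones have been treated. -/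
def stateAt (init : Bool) (w : Fin d → Bool) (j : ℕ) (t : Fin 2 × Fin d) : Prop :=
  if (finProdFinEquiv t).val < j then w t.2 = true else init = true

theorem stateAt_succ_of_eq {init : Bool} {w : Fin d → Bool} {j : ℕ} (hj : j < 2 * d)
    (h : w (switch ⟨j, hj⟩).2 = init) : stateAt init w (j + 1) = stateAt init w j := by
  funext t
  unfold stateAt
  by_cases ht : (finProdFinEquiv t).val = j
  · have : t = switch ⟨j, hj⟩ := by
      rw [switch, Equiv.eq_symm_apply]; ext; exact ht
    rw [if_pos (by omega), if_neg (by omega), ← h, this]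
  · congr 1
    exact propext (by omega)

theorem finProdFinEquiv_eq_iff {j : ℕ} (hj : j < 2 * d) (t : Fin 2 × Fin d) :
    (finProdFinEquiv t).val = j ↔ t = switch ⟨j, hj⟩ := by
  rw [switch, Equiv.eq_symm_apply, Fin.ext_iff]

theorem stateAt_succ_insert {w : Fin d → Bool} {j : ℕ} (hj : j < 2 * d)
    (h : w (switch ⟨j, hj⟩).2 = true) (t : Fin 2 × Fin d) :
    stateAt false w (j + 1) t ↔ stateAt false w j t ∨ t = switch ⟨j, hj⟩ := by
  rw [← finProdFinEquiv_eq_iff]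
  unfold stateAt
  by_cases ht : (finProdFinEquiv t).val = j
  · have ht' := (finProdFinEquiv_eq_iff hj t).1 ht
    rw [if_pos (by omega)]
    exact iff_of_true (ht' ▸ h) (Or.inr ht)
  · by_cases hlt : (finProdFinEquiv t).val < j
    · rw [if_pos (by omega), if_pos hlt]; exact ⟨fun h => .inl h, fun h => h.resolve_right ht⟩
    · rw [if_neg (by omega), if_neg hlt]; exact ⟨fun h => .inl h, fun h => h.resolve_right ht⟩

theorem stateAt_succ_delete {w : Fin d → Bool} {j : ℕ} (hj : j < 2 * d)
    (h : w (switch ⟨j, hj⟩).2 = false) (t : Fin 2 × Fin d) :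
    stateAt true w (j + 1) t ↔ stateAt true w j t ∧ t ≠ switch ⟨j, hj⟩ := by
  rw [Ne, ← finProdFinEquiv_eq_iff]
  unfold stateAt
  by_cases ht : (finProdFinEquiv t).val = j
  · have ht' := (finProdFinEquiv_eq_iff hj t).1 ht
    rw [if_pos (by omega)]
    exact iff_of_false (by rw [ht', h]; simp) fun h => h.2 ht
  · by_cases hlt : (finProdFinEquiv t).val < j
    · rw [if_pos (by omega), if_pos hlt]; exact ⟨fun h => ⟨h, ht⟩, fun h => h.1⟩
    · rw [if_neg (by omega), if_neg hlt]; exact ⟨fun h => ⟨h, ht⟩, fun h => h.1⟩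

theorem stateAt_self {init : Bool} {w : Fin d → Bool} {j : ℕ} (hj : j < 2 * d) :
    stateAt init w j (switch ⟨j, hj⟩) ↔ init = true := by
  unfold stateAt
  rw [(finProdFinEquiv_eq_iff hj _).2 rfl, if_neg (lt_irrefl _)]

theorem switchOp_apply (hg : 1 ≤ g) {init : Bool} {w : Fin d → Bool} {j : ℕ} (hj : j < 2 * d)
    (h : w (switch ⟨j, hj⟩).2 ≠ init) :
    (switchOp g U V init (switch ⟨j, hj⟩)).apply ((scheme g U V).graph (stateAt init w j)) =
      (scheme g U V).graph (stateAt init w (j + 1)) := by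
  cases init
  · exact graph_sup_edge (H := scheme g U V) (t := switch ⟨j, hj⟩)
      (stateAt_succ_insert hj (by simpa using h))
  · exact (proper hg).deleteEdges_graph (H := scheme g U V) (t := switch ⟨j, hj⟩)
      (stateAt_succ_delete hj (by simpa using h))

theorem switchOp_valid (hg : 1 ≤ g) {init : Bool} {w : Fin d → Bool} {j : ℕ} (hj : j < 2 * d) :
    (switchOp g U V init (switch ⟨j, hj⟩)).Valid ((scheme g U V).graph (stateAt init w j)) := by
  have h1 := (proper (U := U) (V := V) hg).adj_switch_iff (on := stateAt init w j)
    (t := switch ⟨j, hj⟩)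
  rw [stateAt_self] at h1
  cases init
  · refine ⟨fun h => ?_, fun h => ?_⟩
    · simpa [port] using node_injective h
    · simpa using h1.1 h
  · exact h1.2 rfl

/-- `stateAt` interpolates between the initial state and the state prescribed by w. Each operation
moves it on by one edge, and edges whose initial state is already right are skipped. -/
theorem finalGraph_opsFrom (hg : 1 ≤ g) {init : Bool} {w : Fin d → Bool} :
    ∀ k j, j + k = 2 * d → finalGraph ((scheme g U V).graph (stateAt init w j))
      (opsFrom g U V init w j) = graph g U V w := by
  intro k
  induction k with
  | zero =>
    intro j hj
    obtain rfl : j = 2 * d := by omega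
    rw [opsFrom_last]
    simp only [finalGraph, List.foldl_cons, List.foldl_nil, GraphOp.apply]
    congr 1
    funext t
    rw [stateAt, if_pos (finProdFinEquiv t).2]
  | succ k ih =>
    intro j hj
    rw [opsFrom_of_lt (by omega), ← ih (j + 1) (by omega)]
    split_ifs with h
    · rw [stateAt_succ_of_eq (by omega) h]; rfl
    · rw [← switchOp_apply hg (by omega) h]; rfl

/-- Each path has g inner vertices and g + 1 ≤ 2 g edges, so subdivision brings the number of edges
below twice the number of vertices; the nodes account for the 2 d switchable edges. -/
theorem isSparse (hg : 1 ≤ g) {c : ℝ} (hc : 2 ≤ c) (k : ℕ) (on : Fin 2 × Fin d → Prop) :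
    IsSparse c k ((scheme g U V).graph on) := by
  unfold IsSparse
  have h1 := (proper (U := U) (V := V) hg).ncard_edgeSet_le on
  simp only [Fintype.card_prod, Fintype.card_fin] at h1
  have h2 : ((scheme g U V).graph on).edgeSet.ncard ≤ 2 * numVertices n q d g := by
    refine h1.trans ?_
    have : 2 * ((n + q + 2) * (d + 2)) * (g + 1) ≤ 2 * ((n + q + 2) * (d + 2)) * (2 * g) :=
      Nat.mul_le_mul_left _ (by omega)
    have e : 2 * ((n + q + 2) * (d + 2)) * (2 * g) = 2 * (2 * ((n + q + 2) * (d + 2)) * g) := by ring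
    simp only [numVertices, numNodes, numSlots]
    omega
  have h3 : (1 : ℝ) ≤ ((Nat.log 2 (numVertices n q d g) : ℝ) + 1) ^ k :=
    one_le_pow₀ (by simp)
  calc (((scheme g U V).graph on).edgeSet.ncard : ℝ) ≤ (2 * numVertices n q d g : ℕ) := by
        exact_mod_cast h2
    _ = 2 * (numVertices n q d g : ℝ) * 1 := by push_cast; ring
    _ ≤ _ := by gcongr

/-- The setting permits the switching operations. -/
def PermitsSwitch (S : DynamicSetting) (init : Bool) : Prop :=
  if init then S ≠ .incremental else S ≠ .decremental

theorem admissible_opsFrom (hg : 1 ≤ g) {S : DynamicSetting} {init : Bool}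
    (hS : PermitsSwitch S init) {c : ℝ} (hc : 2 ≤ c) (m : ℕ) {w : Fin d → Bool} :
    ∀ k j, j + k = 2 * d → AdmissibleOps S c m ((scheme g U V).graph (stateAt init w j))
      (opsFrom g U V init w j) := by
  intro k
  induction k with
  | zero =>
    intro j hj
    obtain rfl : j = 2 * d := by omega
    rw [opsFrom_last]
    exact ⟨isSparse hg hc m _, by cases S <;> trivial, trivial, isSparse hg hc m _⟩
  | succ k ih =>
    intro j hj
    have := ih (j + 1) (by omega)
    rw [opsFrom_of_lt (by omega)]
    split_ifs with h
    · rw [stateAt_succ_of_eq (by omega) h] at this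
      exact this
    · rw [← switchOp_apply hg (by omega) h] at this
      refine ⟨isSparse hg hc m _, ?_, switchOp_valid hg (by omega), this⟩
      cases init <;> cases S <;> simp [PermitsSwitch] at hS <;> trivial

theorem stateAt_zero (init : Bool) (w : Fin d → Bool) :
    stateAt init w 0 = fun _ => init = true := by
  funext t
  simp [stateAt]

/-! ### Numbers of vertices -/

/-- The number of a port. -/
def portNum (n q d i s c : ℕ) : ℕ :=
  n + (2 * q + (2 * (n + q + 1) + ((c + (d + 1) * s) + 2 * (d + 1) * i)))

/-- The number of the end of a path; `b` tells whether the entry of the vector is `1`. -/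
def endNum (n q d i z c b : ℕ) : ℕ :=
  if z < n + q then
    if c = d + 1 then (if z < n then z else n + ((z - n) + q * i))
    else portNum n q d i (if z < n then 0 else 1) (if c < d then (if b = 1 then c else d) else d)
  else portNum n q d i (z - (n + q)) (if c < d then c else d)

/-- The number of vertex `k` of the path number `s`, where `inp` is the input. -/
def ptNum (n q d g : ℕ) (inp : ℕ → ℕ) (s k : ℕ) : ℕ :=
  let i := s / ((n + q + 2) * (d + 2))
  let z := s % ((n + q + 2) * (d + 2)) / (d + 2)
  let c := s % ((n + q + 2) * (d + 2)) % (d + 2)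
  if k = 0 then n + (2 * q + ((if z < n + q then z else n + q) + (n + q + 1) * i))
  else if k - 1 < g then numNodes n q d + ((k - 1) + g * s)
  else endNum n q d i z c (inp (4 + z * d + c))

/-- The number of an end of the edge number `e` of the initial graph. -/
def edgeNum (n q d g : ℕ) (inp : ℕ → ℕ) (e side : ℕ) : ℕ :=
  if e < numSlots n q d * (g + 1) then ptNum n q d g inp (e / (g + 1)) (e % (g + 1) + side)
  else portNum n q d ((e - numSlots n q d * (g + 1)) / d) side
    ((e - numSlots n q d * (g + 1)) % d)

/-- The program needs the vertex numbers as arithmetic expressions. These formulas unfold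
`vertexEquiv`: sums of types are concatenated, and in a product the first component counts with the
size of the second. -/
theorem node_port_val (i s : Fin 2) (c : Fin (d + 1)) :
    ((scheme g U V).node (port i s c)).val = portNum n q d i s c := by
  simp [PathScheme.node, scheme, vertexEquiv, nodeEquiv, port, portNum]

theorem node_star_val (i : Fin 2) (z : Fin (n + q + 1)) :
    ((scheme g U V).node (star i z)).val = n + (2 * q + (z + (n + q + 1) * i)) := by
  simp [PathScheme.node, scheme, vertexEquiv, nodeEquiv, star]

theorem node_leafU_val (u : Fin n) : ((scheme g U V).node (leafU u)).val = u := by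
  simp [PathScheme.node, scheme, vertexEquiv, nodeEquiv, leafU]

theorem node_leafV_val (i : Fin 2) (v : Fin q) :
    ((scheme g U V).node (leafV i v)).val = n + (v + q * i) := by
  simp [PathScheme.node, scheme, vertexEquiv, nodeEquiv, leafV]

theorem e_inner_val (s : Slot n q d) (k : Fin g) :
    ((scheme g U V).e (.inr (s, k))).val = numNodes n q d + (k + g * (slotEquiv n q d s)) := by
  simp [scheme, vertexEquiv]

/-- The array `inp` holds the vectors of `U` and `V`. -/
def Holds (U : Fin n → Fin d → Bool) (V : Fin q → Fin d → Bool) (inp : ℕ → ℕ) : Prop :=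
  (∀ (u : Fin n) (c : Fin d), inp (4 + u * d + c) = (U u c).toNat) ∧
  ∀ (v : Fin q) (c : Fin d), inp (4 + (n + v) * d + c) = (V v c).toNat

/-- The cell x is constrained only for c < d. For c = d the program still reads a cell, which
belongs to other data, but its value is discarded. -/
theorem select_val (b : Fin d → Bool) (c x : ℕ) (h : ∀ hc : c < d, x = (b ⟨c, hc⟩).toNat) :
    (select b c).val = if c < d then (if x = 1 then c else d) else d := by
  unfold select
  by_cases hc : c < d
  · rw [dif_pos hc, if_pos hc, h hc]
    cases b ⟨c, hc⟩ <;> simp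
  · rw [dif_neg hc, if_neg hc]; simp

theorem node_slotEnd_val {inp : ℕ → ℕ} (hin : Holds U V inp) (s : Slot n q d) :
    ((scheme g U V).node (slotEnd U V s)).val =
      endNum n q d s.1 s.2.1 s.2.2 (inp (4 + s.2.1 * d + s.2.2)) := by
  obtain ⟨i, ⟨z, hz⟩, ⟨c, hc⟩⟩ := s
  unfold slotEnd endNum
  simp only
  by_cases h1 : z < n
  · have h2 : z < n + q := by omega
    simp only [h1, h2, dif_pos, if_true]
    by_cases h3 : c = d + 1
    · simp only [h3, if_true, node_leafU_val]
    · simp only [h3, if_false, node_port_val]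
      congr 1
      exact select_val _ _ _ fun hc => hin.1 ⟨z, h1⟩ ⟨c, hc⟩
  · simp only [h1, dif_neg, not_false_eq_true, if_false]
    by_cases h2 : z < n + q
    · simp only [h2, dif_pos, if_true]
      by_cases h3 : c = d + 1
      · simp only [h3, if_true, node_leafV_val]
      · simp only [h3, if_false, node_port_val]
        congr 1
        refine select_val _ _ _ fun hc => ?_
        have := hin.2 ⟨z - n, by omega⟩ ⟨c, hc⟩
        simpa [show n + (z - n) = z from by omega] using this
    · simp only [h2, dif_neg, if_false, node_port_val, not_false_eq_true]
      congr 1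
      split_ifs <;> omega

theorem pt_val {inp : ℕ → ℕ} (hin : Holds U V inp) (s : Fin (numSlots n q d)) (k : ℕ) :
    ((scheme g U V).pt ((slotEquiv n q d).symm s) k).val = ptNum n q d g inp s k := by
  unfold PathScheme.pt ptNum
  simp only
  split_ifs with h1 h2
  · rw [show (scheme g U V).fst ((slotEquiv n q d).symm s) = star _ _ from rfl, node_star_val]
    simp [slotEquiv, Fin.divNat, Fin.modNat]
    omega
  · rw [show (scheme g U V).fst ((slotEquiv n q d).symm s) = star _ _ from rfl, node_star_val]
    simp [slotEquiv, Fin.divNat, Fin.modNat]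
    omega
  · rw [e_inner_val]; simp
  · rw [show (scheme g U V).snd ((slotEquiv n q d).symm s) = slotEnd U V _ from rfl,
      node_slotEnd_val hin]
    simp [slotEquiv, Fin.divNat, Fin.modNat]

/-! ### The list of edges -/

/-- The edges of the initial graph. -/
def edgeList (g : ℕ) (U : Fin n → Fin d → Bool) (V : Fin q → Fin d → Bool) (init : Bool) :
    List (Fin (numVertices n q d g) × Fin (numVertices n q d g)) :=
  (List.finRange (numSlots n q d * (g + 1))).map (fun e =>
    let s := (slotEquiv n q d).symm e.divNat
    ((scheme g U V).pt s e.modNat, (scheme g U V).pt s (e.modNat + 1))) ++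
  if init then (List.finRange (2 * d)).map fun j =>
    ((scheme g U V).node (port (switch j).1 0 (switch j).2.castSucc),
      (scheme g U V).node (port (switch j).1 1 (switch j).2.castSucc))
  else []

def numEdges (n q d g : ℕ) (init : Bool) : ℕ :=
  numSlots n q d * (g + 1) + if init then 2 * d else 0

theorem length_edgeList (init : Bool) : (edgeList g U V init).length = numEdges n q d g init := by
  cases init <;> simp [edgeList, numEdges]

theorem edgeList_map (init : Bool) :
    (edgeList g U V init).map (fun e => s(e.1, e.2)) =
      (List.finRange (numSlots n q d * (g + 1))).map (fun e =>
        (scheme g U V).pathEdge ((slotEquiv n q d).symm e.divNat, e.modNat)) ++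
      if init then (List.finRange (2 * d)).map fun j => (scheme g U V).switchEdge (switch j)
      else [] := by
  rw [edgeList, List.map_append, List.map_map]
  congr 1
  cases init
  · rfl
  · simp only [if_true, List.map_map]; rfl

theorem isEdgeList (hg : 1 ≤ g) (init : Bool) :
    IsEdgeList ((scheme g U V).graph fun _ => init = true) (edgeList g U V init) := by
  have hp := proper (U := U) (V := V) hg
  -- Edge number e of the list is edge `e.modNat` of path `e.divNat`; this is a bijection onto the
  -- pairs of a path and a position.
  have hinj : Function.Injective fun e : Fin (numSlots n q d * (g + 1)) =>
      (scheme g U V).pathEdge ((slotEquiv n q d).symm e.divNat, e.modNat) := by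
    intro e e' h
    have := hp.pathEdge_injective h
    simp only [Prod.mk.injEq, EmbeddingLike.apply_eq_iff_eq] at this
    exact finProdFinEquiv.symm.injective (Prod.ext this.1 this.2)
  have hrange : ∀ p, ∃ e : Fin (numSlots n q d * (g + 1)),
      (scheme g U V).pathEdge ((slotEquiv n q d).symm e.divNat, e.modNat) =
        (scheme g U V).pathEdge p := by
    intro p
    refine ⟨finProdFinEquiv (slotEquiv n q d p.1, p.2), ?_⟩
    have := finProdFinEquiv.symm_apply_apply (slotEquiv n q d p.1, p.2)
    rw [finProdFinEquiv_symm_apply, Prod.mk.injEq] at this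
    rw [this.1, this.2]
    simp
  unfold IsEdgeList
  rw [edgeList_map, hp.edgeSet_graph]
  constructor
  · refine List.nodup_append.2 ⟨List.Nodup.map hinj (List.nodup_finRange _), ?_, ?_⟩
    · cases init
      · simp
      · simp only [if_true]
        exact List.Nodup.map (hp.switchEdge_injective.comp finProdFinEquiv.symm.injective)
          (List.nodup_finRange _)
    · intro a ha b hb hab
      subst hab
      cases init
      · simp at hb
      · simp only [if_true, List.mem_map] at ha hb
        obtain ⟨e, _, rfl⟩ := ha
        obtain ⟨j, _, h⟩ := hb
        exact hp.pathEdge_ne_switchEdge _ _ h.symm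
  · intro x
    rw [List.mem_append, edges, Set.mem_union]
    refine or_congr ?_ ?_
    · simp only [List.mem_map, List.mem_finRange, true_and, Set.mem_range]
      constructor
      · rintro ⟨e, rfl⟩; exact ⟨_, rfl⟩
      · rintro ⟨p, rfl⟩; exact hrange p
    · cases init
      · simp
      · simp only [if_true, List.mem_map, List.mem_finRange, true_and, Set.mem_image,
          Set.mem_ofPred_eq]
        constructor
        · rintro ⟨j, rfl⟩; exact ⟨_, rfl⟩
        · rintro ⟨t, rfl⟩; exact ⟨finProdFinEquiv t, by simp [switch]⟩

/-- The input for the preprocessing, as a function. -/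
def inputNum (n q d g : ℕ) (init : Bool) (inp : ℕ → ℕ) (j : ℕ) : ℕ :=
  if j = 0 then numVertices n q d g
  else if j = 1 then numEdges n q d g init
  else edgeNum n q d g inp ((j - 2) / 2) ((j - 2) % 2)

theorem getElem?_flatMap_pair {α : Type*} (f f' : α → ℕ) (l : List α) (j : ℕ) :
    (l.flatMap fun a => [f a, f' a])[j]? =
      (l[j / 2]?).map fun a => if j % 2 = 0 then f a else f' a := by
  induction l generalizing j with
  | nil => simp
  | cons a l ih =>
    rw [List.flatMap_cons]
    rcases j with _ | _ | j
    · simp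
    · simp
    · simp [ih, show (j + 1 + 1) / 2 = j / 2 + 1 from by omega,
        show (j + 1 + 1) % 2 = j % 2 from by omega]

theorem length_graphInput (N : ℕ) (l : List (Fin N × Fin N)) :
    (graphInput N l).length = 2 + 2 * l.length := by
  have : (l.flatMap fun e => [(e.1 : ℕ), (e.2 : ℕ)]).length = 2 * l.length := by
    induction l with
    | nil => simp
    | cons a l ih => simp only [List.flatMap_cons, List.length_append, ih, List.length_cons]; simp; omega
  simp [graphInput]
  omega

theorem getElem?_edgeList {inp : ℕ → ℕ} (hin : Holds U V inp) (init : Bool) {e : ℕ}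
    (he : e < numEdges n q d g init) : ∃ p, (edgeList g U V init)[e]? = some p ∧
      p.1.val = edgeNum n q d g inp e 0 ∧ p.2.val = edgeNum n q d g inp e 1 := by
  unfold edgeNum
  by_cases h : e < numSlots n q d * (g + 1)
  · rw [edgeList, List.getElem?_append_left (by simpa using h)]
    refine ⟨_, by rw [List.getElem?_map, List.getElem?_eq_getElem (by simpa using h)]; rfl, ?_, ?_⟩
    · simp only [List.getElem_finRange, h, if_true]
      rw [pt_val hin]; simp [Fin.divNat, Fin.modNat]
    · simp only [List.getElem_finRange, h, if_true]
      rw [pt_val hin]; simp [Fin.divNat, Fin.modNat]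
  · unfold numEdges at he
    cases init
    · simp at he; omega
    · simp only [if_true] at he
      rw [edgeList, List.getElem?_append_right (by simpa using h)]
      have h' : e - numSlots n q d * (g + 1) < 2 * d := by omega
      refine ⟨_, by
        rw [if_pos rfl, List.getElem?_map, List.getElem?_eq_getElem (by simpa using h')]; rfl,
        ?_, ?_⟩
      · simp only [h, if_false]
        rw [node_port_val]
        simp [switch, Fin.divNat, Fin.modNat]
      · simp only [h, if_false]
        rw [node_port_val]
        simp [switch, Fin.divNat, Fin.modNat]

theorem getElem?_graphInput {inp : ℕ → ℕ} (hin : Holds U V inp) (init : Bool) {j : ℕ}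
    (hj : j < 2 + 2 * numEdges n q d g init) :
    (graphInput (numVertices n q d g) (edgeList g U V init))[j]? =
      some (inputNum n q d g init inp j) := by
  unfold graphInput inputNum
  rcases j with _ | _ | j
  · simp
  · simp [length_edgeList]
  · obtain ⟨p, hp, h1, h2⟩ := getElem?_edgeList (g := g) hin init (e := j / 2) (by omega)
    rw [List.getElem?_append_right (by simp)]
    simp only [List.length_cons, List.length_nil, Nat.zero_add]
    rw [getElem?_flatMap_pair, show j + 1 + 1 - (1 + 1) = j from by omega, hp]
    rw [if_neg (by omega), if_neg (by omega)]
    have : j % 2 = 0 ∨ j % 2 = 1 := by omega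
    rcases this with h | h <;> simp [h, h1, h2]

end HittingGraph

namespace WordRAM

/-! ### Overflow-free expressions -/

/-- The operations whose results are polynomially bounded. -/
def BinOp.Tame : BinOp → Prop
  | .shl | .or | .xor => False
  | _ => True

def Expr.Tame : Expr → Prop
  | .const _ => True
  | .read _ i => i.Tame
  | .bin o e f => o.Tame ∧ e.Tame ∧ f.Tame

/-- The value of an expression with unbounded words. -/
def Expr.val (s : Memory) : Expr → ℕ
  | .const k => k
  | .read a i => s a (i.val s)
  | .bin o e f => o.eval (e.val s) (f.val s)

/-- An exponent bounding the values that occur in the evaluation. -/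
def Expr.deg : Expr → ℕ
  | .const k => k
  | .read _ i => i.deg + 1
  | .bin _ e f => e.deg + f.deg + 1

/-- As p, r ≥ 1, even a sum is at most 2 p r, and the 2 is absorbed by X. This one factor X is the
summand 1 in the degree of a compound expression. -/
theorem BinOp.Tame.eval_le {o : BinOp} (h : o.Tame) {x y p r X : ℕ} (hx : x ≤ p) (hy : y ≤ r)
    (hp : 1 ≤ p) (hr : 1 ≤ r) (hX : 2 ≤ X) : o.eval x y ≤ p * r * X := by
  have h1 : p ≤ p * r := Nat.le_mul_of_pos_right p hr
  have h2 : r ≤ p * r := Nat.le_mul_of_pos_left r hp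
  have h3 : p * r * 2 ≤ p * r * X := Nat.mul_le_mul_left _ hX
  cases o <;> simp only [BinOp.Tame] at h <;> simp only [BinOp.eval]
  · omega
  · omega
  · have := Nat.mul_le_mul hx hy; omega
  · have := Nat.div_le_self x y; omega
  · have := Nat.mod_le x y; omega
  · have := Nat.and_le_left (n := x) (m := y); omega
  · have := Nat.shiftRight_le x y; omega
  · split_ifs <;> omega
  · split_ifs <;> omega

theorem Expr.Tame.val_le {X : ℕ} (hX : 2 ≤ X) {s : Memory} (hs : ∀ a i, s a i ≤ X) {e : Expr}
    (h : e.Tame) : e.val s ≤ X ^ e.deg := by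
  induction e with
  | const k => exact (Nat.lt_pow_self (by omega)).le
  | read a i =>
    refine (hs _ _).trans ?_
    exact Nat.le_self_pow (Nat.succ_ne_zero _) X
  | bin o e f he hf =>
    have := h.1.eval_le (he h.2.1) (hf h.2.2) (Nat.one_le_pow _ _ (by omega))
      (Nat.one_le_pow _ _ (by omega)) hX
    rwa [← pow_add, ← pow_succ] at this

/-- Subexpressions have no larger degree than the whole, so a single inequality excludes overflow at
every intermediate step. -/
theorem Expr.Tame.eval_eq {X B : ℕ} (hX : 2 ≤ X) {s : Memory} (hs : ∀ a i, s a i ≤ X) {e : Expr}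
    (h : e.Tame) (hB : X ^ e.deg < B) : e.eval B s = some (e.val s) := by
  have hv := h.val_le hX hs
  induction e with
  | const k => exact Expr.eval_const (by simp only [Expr.val] at hv; omega)
  | read a i ih =>
    refine Expr.eval_read (ih h (lt_of_le_of_lt ?_ hB) (Expr.Tame.val_le hX hs h)) (by
      simp only [Expr.val] at hv; omega)
    exact Nat.pow_le_pow_right (by omega) (by simp [Expr.deg])
  | bin o e f he hf =>
    refine Expr.eval_bin (he h.2.1 (lt_of_le_of_lt ?_ hB) (Expr.Tame.val_le hX hs h.2.1))
      (hf h.2.2 (lt_of_le_of_lt ?_ hB) (Expr.Tame.val_le hX hs h.2.2)) (by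
      simp only [Expr.val] at hv; omega)
    · exact Nat.pow_le_pow_right (by omega) (by simp only [Expr.deg]; omega)
    · exact Nat.pow_le_pow_right (by omega) (by simp only [Expr.deg]; omega)

namespace Expr

instance : Add Expr := ⟨.bin .add⟩
instance : Sub Expr := ⟨.bin .sub⟩
instance : Mul Expr := ⟨.bin .mul⟩
instance : Div Expr := ⟨.bin .div⟩
instance : Mod Expr := ⟨.bin .mod⟩

/-- Comparison, with value `0` or `1`. -/
def ltE (e f : Expr) : Expr := .bin .lt e f
def eqE (e f : Expr) : Expr := .bin .eq e f

/-- Case distinction by an expression with value `0` or `1`. -/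
def iteE (b e f : Expr) : Expr := b * e + (.const 1 - b) * f

variable (s : Memory) (e f b b' : Expr)

theorem val_add : (e + f).val s = e.val s + f.val s := rfl
theorem val_mul : (e * f).val s = e.val s * f.val s := rfl

theorem val_iteE_lt :
    (iteE (ltE b b') e f).val s = if b.val s < b'.val s then e.val s else f.val s := by
  change BinOp.eval .lt (b.val s) (b'.val s) * e.val s +
    (1 - BinOp.eval .lt (b.val s) (b'.val s)) * f.val s = _
  simp only [BinOp.eval]
  split_ifs <;> simp

theorem val_iteE_eq :
    (iteE (eqE b b') e f).val s = if b.val s = b'.val s then e.val s else f.val s := by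
  change BinOp.eval .eq (b.val s) (b'.val s) * e.val s +
    (1 - BinOp.eval .eq (b.val s) (b'.val s)) * f.val s = _
  simp only [BinOp.eval]
  split_ifs <;> simp

variable {e f b}

theorem Tame.add (he : e.Tame) (hf : f.Tame) : (e + f).Tame := ⟨trivial, he, hf⟩
theorem Tame.sub (he : e.Tame) (hf : f.Tame) : (e - f).Tame := ⟨trivial, he, hf⟩
theorem Tame.mul (he : e.Tame) (hf : f.Tame) : (e * f).Tame := ⟨trivial, he, hf⟩
theorem Tame.div (he : e.Tame) (hf : f.Tame) : (e / f).Tame := ⟨trivial, he, hf⟩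
theorem Tame.mod (he : e.Tame) (hf : f.Tame) : (e % f).Tame := ⟨trivial, he, hf⟩
theorem Tame.lt (he : e.Tame) (hf : f.Tame) : (ltE e f).Tame := ⟨trivial, he, hf⟩
theorem Tame.eq (he : e.Tame) (hf : f.Tame) : (eqE e f).Tame := ⟨trivial, he, hf⟩
theorem Tame.ite (hb : b.Tame) (he : e.Tame) (hf : f.Tame) : (iteE b e f).Tame :=
  (hb.mul he).add ((Tame.sub (e := .const 1) trivial hb).mul hf)

end Expr

/-! ### Counting loops -/

/-- Increase register `k`. -/
def incReg (k : ℕ) : Program := .store 1 (.const k) (reg k + .const 1)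

def whileLt (k : ℕ) (bound : Expr) (body : Program) : Program :=
  .loop (.ltE (reg k) bound) (.seq body (incReg k))

/-- Run `body` with register `k` counting from `0` to `bound - 1`. -/
def forLoop (k : ℕ) (bound : Expr) (body : Program) : Program :=
  .seq (.store 1 (.const k) (.const 0)) (whileLt k bound body)

theorem eval_reg_of_lt {B : ℕ} {s : Memory} {k j : ℕ} (hs : s 1 k = j) (hk : k < B) (hj : j < B) :
    (reg k).eval B s = some j := by
  rw [← hs]
  exact Expr.eval_read (Expr.eval_const hk) (by omega)

theorem eval_lt_reg {B : ℕ} {s : Memory} {k j n : ℕ} {bound : Expr} (hs : s 1 k = j) (hk : k < B)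
    (hj : j < B) (h1 : 1 < B) (hb : bound.eval B s = some n) :
    (Expr.ltE (reg k) bound).eval B s = some (if j < n then 1 else 0) :=
  Expr.eval_bin (o := .lt) (eval_reg_of_lt hs hk hj) hb (by simp only [BinOp.eval]; split_ifs <;> omega)

theorem eval_inc {B : ℕ} {s : Memory} {k j : ℕ} (hs : s 1 k = j) (hk : k < B) (hj : j + 1 < B) :
    (reg k + Expr.const 1).eval B s = some (j + 1) :=
  Expr.eval_bin (o := .add) (eval_reg_of_lt hs hk (by omega)) (Expr.eval_const (by omega)) hj

theorem wp_incReg {B : ℕ} {s : Memory} {k j T : ℕ} {F : Post} (hs : s 1 k = j) (hk : k < B)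
    (hj : j + 1 < B) (hT : 6 ≤ T) : wp B (incReg k) F (T, s) = F (T - 6, s.set 1 k (j + 1)) :=
  wp_store (Expr.eval_const hk) (eval_inc hs hk hj) hT

theorem wp_whileLt_step {B : ℕ} {s : Memory} {k j n T : ℕ} {F : Post} {bound : Expr} {body : Program}
    (hs : s 1 k = j) (hk : k < B) (hj : j < n) (hn : n < B) (hb : bound.eval B s = some n)
    (hT : bound.cost + 4 ≤ T) :
    wp B (whileLt k bound body) F (T, s) =
      wp B body (wp B (incReg k) (wp B (whileLt k bound body) F)) (T - (bound.cost + 4), s) := by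
  have hc : (Expr.ltE (reg k) bound).cost + 1 = bound.cost + 4 := by
    simp only [Expr.ltE, Expr.cost]; omega
  rw [whileLt, wp_loop_true (eval_lt_reg hs hk (by omega) (by omega) hb) (by simp [hj]) (by omega),
    wp_seq, hc]

theorem wp_whileLt_end {B : ℕ} {s : Memory} {k n T : ℕ} {F : Post} {bound : Expr} {body : Program}
    (hs : s 1 k = n) (hk : k < B) (hn : n < B) (h1 : 1 < B) (hb : bound.eval B s = some n)
    (hT : bound.cost + 4 ≤ T) :
    wp B (whileLt k bound body) F (T, s) = F (T - (bound.cost + 4), s) := by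
  have hc : (Expr.ltE (reg k) bound).cost + 1 = bound.cost + 4 := by
    simp only [Expr.ltE, Expr.cost]; omega
  have := eval_lt_reg hs hk hn h1 hb
  rw [if_neg (lt_irrefl _)] at this
  rw [whileLt, wp_loop_false this (by omega), hc]

/-- The body has to leave the counter alone, and the invariant for j + 1 is required only once the
counter has been increased. -/
theorem det_forLoop {B : ℕ} {k n D : ℕ} {bound : Expr} {body : Program} {I : ℕ → Memory → Prop}
    {s : Memory} (hk : k < B) (hn : n < B) (h1 : 1 < B)
    (hI : ∀ j ≤ n, ∀ s, I j s → s 1 k = j ∧ bound.eval B s = some n)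
    (hbody : ∀ j < n, ∀ s, I j s → Det B body s D fun s' => s' 1 k = j ∧ I (j + 1) (s'.set 1 k (j + 1)))
    (h0 : I 0 (s.set 1 k 0)) :
    Det B (forLoop k bound body) s (3 + (n * (D + 6 + (bound.cost + 4)) + (bound.cost + 4))) (I n) := by
  have hc : (Expr.ltE (reg k) bound).cost + 1 = bound.cost + 4 := by
    simp only [Expr.ltE, Expr.cost]; omega
  refine Det.seq (D := 3) (Det.store (Expr.eval_const hk) (Expr.eval_const (by omega)) rfl) ?_
  rintro _ rfl
  rw [← hc]
  refine Det.loop (n := n) (I := I) (fun j hj s hs => ?_) (fun s hs => ?_) (fun j hj s hs => ?_)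
    n 0 _ (by omega) h0
  · obtain ⟨h2, h3⟩ := hI j hj.le s hs
    exact ⟨_, by simp [hj], eval_lt_reg h2 hk (by omega) h1 h3⟩
  · obtain ⟨h2, h3⟩ := hI n le_rfl s hs
    have := eval_lt_reg h2 hk hn h1 h3
    rwa [if_neg (lt_irrefl _)] at this
  · refine Det.seq (hbody j hj s hs) fun s' hs' => ?_
    exact Det.store (Expr.eval_const hk) (eval_inc hs'.1 hk (by omega)) hs'.2

/-! ### States of the simulation -/

/-- The state of the simulation: input, vote counters, number of the repetition, stamps, mode. -/
structure Ctx (X : ℕ) (inp cnt : ℕ → ℕ) (rep lo hi m : ℕ) (σ : Memory) : Prop where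
  wf : SimWf X σ
  input : σ 0 = inp
  counters : σ 3 = cnt
  rep : σ 1 0 = rep
  lo : σ 1 1 = lo
  hi : σ 1 2 = hi
  mode : σ 1 3 = m

theorem Ctx.of_simRel {X : ℕ} {inp cnt : ℕ → ℕ} {rep lo hi m : ℕ} {σ σ' s : Memory}
    (h : Ctx X inp cnt rep lo hi m σ) (hr : SimRel X σ s σ') : Ctx X inp cnt rep lo hi m σ' :=
  ⟨hr.wf, by rw [hr.input, h.input], by rw [hr.counters, h.counters], by rw [hr.regs, h.rep],
    by rw [hr.regs, h.lo], by rw [hr.regs, h.hi], by rw [hr.regs, h.mode]⟩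

theorem set_reg_apply (σ : Memory) (k v b i : ℕ) (hb : b ≠ 1) : (σ.set 1 k v) b i = σ b i := by
  rw [Memory.set_of_ne _ _ _ hb]

theorem set_reg_ne (σ : Memory) {k v i : ℕ} (hi : i ≠ k) : (σ.set 1 k v) 1 i = σ 1 i := by
  rw [Memory.set_apply, if_neg (by simp [hi])]

theorem set_reg_self (σ : Memory) (k v : ℕ) : (σ.set 1 k v) 1 k = v := by
  simp [Memory.set_apply]

/-- Registers 0 to 3 hold the repetition number, the stamps and the mode; from 4 on they are free
for the program. -/
theorem simMem_setReg (σ : Memory) {k : ℕ} (v : ℕ) (hk : 4 ≤ k) :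
    simMem (σ.set 1 k v) = simMem σ := by
  funext a i
  simp only [simMem, set_reg_apply σ k v _ _ (show 2 * a + 5 ≠ 1 by omega),
    set_reg_apply σ k v _ _ (show 2 * a + 4 ≠ 1 by omega), set_reg_ne σ (show 2 ≠ k by omega),
    set_reg_ne σ (show 1 ≠ k by omega)]

theorem simBase_setReg (σ : Memory) {k : ℕ} (v : ℕ) (hk : k ≠ 1) :
    simBase (σ.set 1 k v) = simBase σ := by
  funext a i
  simp only [simBase, set_reg_apply σ k v _ _ (show 2 * a + 5 ≠ 1 by omega),
    set_reg_apply σ k v _ _ (show 2 * a + 4 ≠ 1 by omega), set_reg_ne σ hk.symm]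

theorem bdd_set {X : ℕ} {σ : Memory} (h : ∀ a i, σ a i ≤ X) (b k : ℕ) {v : ℕ} (hv : v ≤ X) :
    ∀ a i, (σ.set b k v) a i ≤ X := fun a i => by
  rw [Memory.set_apply]; split_ifs
  · exact hv
  · exact h a i

theorem Ctx.setReg {X : ℕ} {inp cnt : ℕ → ℕ} {rep lo hi m : ℕ} {σ : Memory}
    (h : Ctx X inp cnt rep lo hi m σ) {k v : ℕ} (hk : 4 ≤ k) (hv : v ≤ X) :
    Ctx X inp cnt rep lo hi m (σ.set 1 k v) := by
  have h0 : ∀ b, b ≠ 1 → (σ.set 1 k v) b = σ b := fun b hb => Memory.set_of_ne _ _ _ hb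
  have h1 : ∀ i, i < 4 → (σ.set 1 k v) 1 i = σ 1 i := fun i hi => set_reg_ne σ (by omega)
  refine ⟨⟨bdd_set h.wf.bdd 1 k hv, ?_, fun a i => ?_, fun a i => ?_, ?_⟩, ?_, ?_, ?_, ?_, ?_, ?_⟩
  · rw [h1 3 (by omega)]; exact h.wf.mode
  · rw [h1 1 (by omega), h0 _ (by omega)]; exact h.wf.lower a i
  · rw [h1 2 (by omega), h0 _ (by omega)]; exact h.wf.upper a i
  · rw [h1 3 (by omega), h1 2 (by omega)]
    intro hm a i
    rw [h0 _ (by omega)]; exact h.wf.clean hm a i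
  · rw [h0 0 (by omega), h.input]
  · rw [h0 3 (by omega), h.counters]
  · rw [h1 0 (by omega), h.rep]
  · rw [h1 1 (by omega), h.lo]
  · rw [h1 2 (by omega), h.hi]
  · rw [h1 3 (by omega), h.mode]

theorem simMem_eq_simBase {σ : Memory} (h : ∀ a i, σ (2 * a + 5) (2 * i + 1) < σ 1 2) :
    simMem σ = simBase σ := by
  funext a i
  rw [simMem, if_neg (h a i).ne]
  rfl

end WordRAM

namespace WordRAM

/-! ### Expressions for the input of the dynamic algorithm -/

instance (k : ℕ) : OfNat Expr k := ⟨.const k⟩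

namespace Expr

theorem tame_ofNat (k : ℕ) : (OfNat.ofNat k : Expr).Tame := trivial
theorem tame_const (k : ℕ) : (Expr.const k).Tame := trivial
theorem Tame.read {e : Expr} (he : e.Tame) (a : ℕ) : (Expr.read a e).Tame := he

end Expr

end WordRAM

namespace HittingGraph

open WordRAM Expr

abbrev nE : Expr := .read 0 0
abbrev qE : Expr := .read 0 1
abbrev rE : Expr := .read 0 2
abbrev dE : Expr := .read 0 3

/-- The expressions from here to `inputE` copy `portNum`, `endNum`, `ptNum`, `edgeNum`, `numEdges`
and `inputNum` symbol by symbol, with n, q, d read from the input. Their values then agree almost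
definitionally. -/
def portE (i s c : Expr) : Expr :=
  nE + (2 * qE + (2 * (nE + qE + 1) + ((c + (dE + 1) * s) + 2 * (dE + 1) * i)))

def endE (i z c b : Expr) : Expr :=
  iteE (ltE z (nE + qE))
    (iteE (eqE c (dE + 1)) (iteE (ltE z nE) z (nE + ((z - nE) + qE * i)))
      (portE i (iteE (ltE z nE) 0 1) (iteE (ltE c dE) (iteE (eqE b 1) c dE) dE)))
    (portE i (z - (nE + qE)) (iteE (ltE c dE) c dE))

abbrev slotsE : Expr := (nE + qE + 2) * (dE + 2)

def numNodesE : Expr := nE + (2 * qE + (2 * (nE + qE + 1) + 2 * (2 * (dE + 1))))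

def ptE (g : ℕ) (s k : Expr) : Expr :=
  let i := s / slotsE
  let z := s % slotsE / (dE + 2)
  let c := s % slotsE % (dE + 2)
  iteE (eqE k 0) (nE + (2 * qE + (iteE (ltE z (nE + qE)) z (nE + qE) + (nE + qE + 1) * i)))
    (iteE (ltE (k - 1) (.const g)) (numNodesE + ((k - 1) + .const g * s))
      (endE i z c (.read 0 (4 + z * dE + c))))

def edgeE (g : ℕ) (e side : Expr) : Expr :=
  iteE (ltE e (2 * slotsE * .const (g + 1)))
    (ptE g (e / .const (g + 1)) (e % .const (g + 1) + side))
    (portE ((e - 2 * slotsE * .const (g + 1)) / dE) side ((e - 2 * slotsE * .const (g + 1)) % dE))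

def numEdgesE (g : ℕ) (init : Bool) : Expr :=
  2 * slotsE * .const (g + 1) + (if init then 2 * dE else 0)

def inputE (g : ℕ) (init : Bool) (j : Expr) : Expr :=
  iteE (eqE j 0) (numNodesE + 2 * slotsE * .const g)
    (iteE (eqE j 1) (numEdgesE g init) (edgeE g ((j - 2) / 2) ((j - 2) % 2)))

variable (σ : Memory)

theorem val_portE (i s c : Expr) : (portE i s c).val σ =
    portNum (σ 0 0) (σ 0 1) (σ 0 3) (i.val σ) (s.val σ) (c.val σ) := rfl

theorem val_endE (i z c b : Expr) : (endE i z c b).val σ =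
    endNum (σ 0 0) (σ 0 1) (σ 0 3) (i.val σ) (z.val σ) (c.val σ) (b.val σ) := by
  simp only [endE, val_iteE_lt, val_iteE_eq, val_portE]
  rfl

theorem val_ptE (g : ℕ) (s k : Expr) : (ptE g s k).val σ =
    ptNum (σ 0 0) (σ 0 1) (σ 0 3) g (σ 0) (s.val σ) (k.val σ) := by
  simp only [ptE, val_iteE_lt, val_iteE_eq, val_endE]
  simp only [val_add, val_mul, val_iteE_lt]
  rfl

theorem val_edgeE (g : ℕ) (e side : Expr) : (edgeE g e side).val σ =
    edgeNum (σ 0 0) (σ 0 1) (σ 0 3) g (σ 0) (e.val σ) (side.val σ) := by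
  simp only [edgeE, val_iteE_lt, val_ptE, val_portE]
  rfl

theorem val_numEdgesE (g : ℕ) (init : Bool) : (numEdgesE g init).val σ =
    numEdges (σ 0 0) (σ 0 1) (σ 0 3) g init := by
  cases init <;> rfl

theorem val_inputE (g : ℕ) (init : Bool) (j : Expr) : (inputE g init j).val σ =
    inputNum (σ 0 0) (σ 0 1) (σ 0 3) g init (σ 0) (j.val σ) := by
  simp only [inputE, val_iteE_eq, val_edgeE, val_numEdgesE]
  rfl

theorem tame_cell (k : ℕ) : (Expr.read 0 (OfNat.ofNat k)).Tame := trivial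

theorem tame_portE {i s c : Expr} (hi : i.Tame) (hs : s.Tame) (hc : c.Tame) :
    (portE i s c).Tame := by
  have h : ∀ k, (Expr.read 0 (OfNat.ofNat k)).Tame := tame_cell
  have h' := tame_ofNat
  exact (h 0).add (((h' 2).mul (h 1)).add (((h' 2).mul (((h 0).add (h 1)).add (h' 1))).add
    ((hc.add (((h 3).add (h' 1)).mul hs)).add (((h' 2).mul ((h 3).add (h' 1))).mul hi))))

theorem tame_endE {i z c b : Expr} (hi : i.Tame) (hz : z.Tame) (hc : c.Tame) (hb : b.Tame) :
    (endE i z c b).Tame := by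
  have h : ∀ k, (Expr.read 0 (OfNat.ofNat k)).Tame := tame_cell
  have h' := tame_ofNat
  refine .ite (hz.lt ((h 0).add (h 1))) (.ite (hc.eq ((h 3).add (h' 1)))
    (.ite (hz.lt (h 0)) hz ((h 0).add ((hz.sub (h 0)).add ((h 1).mul hi))))
    (tame_portE hi (.ite (hz.lt (h 0)) (h' 0) (h' 1)) ?_)) (tame_portE hi
      (hz.sub ((h 0).add (h 1))) (.ite (hc.lt (h 3)) hc (h 3)))
  exact .ite (hc.lt (h 3)) (.ite (hb.eq (h' 1)) hc (h 3)) (h 3)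

theorem tame_slotsE : slotsE.Tame :=
  (((tame_cell 0).add (tame_cell 1)).add (tame_ofNat 2)).mul ((tame_cell 3).add (tame_ofNat 2))

theorem tame_numNodesE : numNodesE.Tame := by
  have h : ∀ k, (Expr.read 0 (OfNat.ofNat k)).Tame := tame_cell
  have h' := tame_ofNat
  exact (h 0).add (((h' 2).mul (h 1)).add (((h' 2).mul (((h 0).add (h 1)).add (h' 1))).add
    ((h' 2).mul ((h' 2).mul ((h 3).add (h' 1))))))

theorem tame_ptE (g : ℕ) {s k : Expr} (hs : s.Tame) (hk : k.Tame) : (ptE g s k).Tame := by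
  have h : ∀ k, (Expr.read 0 (OfNat.ofNat k)).Tame := tame_cell
  have h' := tame_ofNat
  have hi := hs.div tame_slotsE
  have hz := (hs.mod tame_slotsE).div ((h 3).add (h' 2))
  have hc := (hs.mod tame_slotsE).mod ((h 3).add (h' 2))
  have hnq := (h 0).add (h 1)
  exact .ite (hk.eq (h' 0)) ((h 0).add (((h' 2).mul (h 1)).add ((Tame.ite (hz.lt hnq) hz hnq).add
    ((hnq.add (h' 1)).mul hi)))) (.ite ((hk.sub (h' 1)).lt (tame_const g))
      (tame_numNodesE.add ((hk.sub (h' 1)).add ((tame_const g).mul hs)))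
      (tame_endE hi hz hc (((((h' 4).add (hz.mul (h 3))).add hc).read 0))))

theorem tame_edgeE (g : ℕ) {e side : Expr} (he : e.Tame) (hs : side.Tame) :
    (edgeE g e side).Tame := by
  have hc := tame_const (g + 1)
  have hp := ((tame_ofNat 2).mul tame_slotsE).mul hc
  exact .ite (he.lt hp) (tame_ptE g (he.div hc) ((he.mod hc).add hs))
    (tame_portE ((he.sub hp).div (tame_cell 3)) hs ((he.sub hp).mod (tame_cell 3)))

theorem tame_numEdgesE (g : ℕ) (init : Bool) : (numEdgesE g init).Tame := by
  refine (((tame_ofNat 2).mul tame_slotsE).mul (tame_const (g + 1))).add ?_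
  cases init
  · exact tame_ofNat 0
  · exact (tame_ofNat 2).mul (tame_cell 3)

theorem tame_inputE (g : ℕ) (init : Bool) {j : Expr} (hj : j.Tame) : (inputE g init j).Tame := by
  have h' := tame_ofNat
  exact .ite (hj.eq (h' 0)) (tame_numNodesE.add (((h' 2).mul tame_slotsE).mul (tame_const g)))
    (.ite (hj.eq (h' 1)) (tame_numEdgesE g init) (tame_edgeE g ((hj.sub (h' 2)).div (h' 2))
      ((hj.sub (h' 2)).mod (h' 2))))

/-! ### The program -/

/-- Write the initial graph into the simulated memory. -/
def inputLoop (g : ℕ) (init : Bool) : Program :=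
  forLoop 4 (2 + 2 * numEdgesE g init) (simStore 0 (reg 4) (inputE g init (reg 4)))

/-- The entry of the current vector for the current switchable edge. -/
def bitE : Expr := .read 0 (4 + (nE + qE + reg 5) * dE + reg 6 % dE)

/-- Treat one switchable edge. -/
def opStep (A : DynamicAlgorithm) (init : Bool) : Program :=
  .ite (eqE bitE (.const init.toNat)) .skip
    (.seq (simStore 0 0 (portE (reg 6 / dE) 0 (reg 6 % dE)))
      (.seq (simStore 0 1 (portE (reg 6 / dE) 1 (reg 6 % dE)))
        (if init then A.delete else A.insert).sim))

/-- The new value of a vote counter. -/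
def voteE (g : ℕ) : Expr := .read 3 (reg 5) + ltE (simRead 0 0) (.const (6 * (g + 1)))

/-- Let the dynamic algorithm vote on one vector. -/
def vectorBody (A : DynamicAlgorithm) (g : ℕ) (init : Bool) : Program :=
  .seq (incReg 2) (.seq (.store 1 (.const 6) (.const 0))
    (.seq (.seq (whileLt 6 (2 * dE) (opStep A init)) A.query.sim)
      (.store 3 (reg 5) (voteE g))))

/-- One repetition: preprocess, then let the algorithm vote on all vectors. -/
def repetition (A : DynamicAlgorithm) (g : ℕ) (init : Bool) : Program :=
  .seq (incReg 1) (.seq (incReg 2) (.seq (.store 1 (.const 3) (.const 0))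
    (.seq (inputLoop g init) (.seq A.preprocess.sim (.seq (.store 1 (.const 3) (.const 1))
      (forLoop 5 rE (vectorBody A g init)))))))

/-- The number of repetitions is linear in d because the error of a single vector has to survive a
union bound over up to 2^d vectors. -/
abbrev repsE : Expr := 12 * (dE + 2)

/-- Accept if some vector has a majority. -/
def majority : Program :=
  .seq (.store 1 (.const 7) (.const 0)) (.seq
    (forLoop 5 rE (.ite (ltE repsE (2 * .read 3 (reg 5))) (.store 1 (.const 7) (.const 1)) .skip))
    (.store 0 (.const 0) (reg 7)))

def mainProgram (A : DynamicAlgorithm) (g : ℕ) (init : Bool) : Program :=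
  .seq (.store 1 (.const 3) (.const 1))
    (.seq (forLoop 0 repsE (repetition A g init)) majority)

end HittingGraph

/-! ### Time stamps: rollback, freezing, restart -/

namespace WordRAM

theorem simMem_congr {σ σ' : Memory} (h1 : σ' 1 1 = σ 1 1) (h2 : σ' 1 2 = σ 1 2)
    (h : ∀ b, 4 ≤ b → σ' b = σ b) : simMem σ' = simMem σ := by
  funext a i
  simp only [simMem, h1, h2, h (2 * a + 4) (by omega), h (2 * a + 5) (by omega)]

theorem simBase_congr {σ σ' : Memory} (h1 : σ' 1 1 = σ 1 1)
    (h : ∀ b, 4 ≤ b → σ' b = σ b) : simBase σ' = simBase σ := by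
  funext a i
  simp only [simBase, h1, h (2 * a + 4) (by omega), h (2 * a + 5) (by omega)]

variable {X : ℕ} {inp cnt : ℕ → ℕ} {rep lo hi m : ℕ} {σ : Memory}

/-- The rollback. No stamp of the upper level exceeds `hi`, so after the increment all upper
versions are void and the lower level, the state after the preprocessing, is visible again. -/
theorem Ctx.incHi (h : Ctx X inp cnt rep lo hi 1 σ) (hX : hi + 1 ≤ X) :
    Ctx X inp cnt rep lo (hi + 1) 1 (σ.set 1 2 (hi + 1)) ∧
      simMem (σ.set 1 2 (hi + 1)) = simBase σ ∧ simBase (σ.set 1 2 (hi + 1)) = simBase σ := by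
  have h0 : ∀ b, b ≠ 1 → (σ.set 1 2 (hi + 1)) b = σ b := fun b hb => Memory.set_of_ne _ _ _ hb
  have h1 : ∀ i, i ≠ 2 → (σ.set 1 2 (hi + 1)) 1 i = σ 1 i := fun i hi => set_reg_ne σ hi
  have h2 := set_reg_self σ 2 (hi + 1)
  have hst : ∀ a i, σ (2 * a + 5) (2 * i + 1) < hi + 1 := fun a i => by
    have := h.wf.upper a i; rw [h.hi] at this; omega
  have hb : simBase (σ.set 1 2 (hi + 1)) = simBase σ :=
    simBase_congr (h1 1 (by omega)) fun b hb => h0 b (by omega)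
  refine ⟨⟨⟨bdd_set h.wf.bdd 1 2 hX, ?_, fun a i => ?_, fun a i => ?_, fun hm a i => ?_⟩,
    ?_, ?_, ?_, ?_, h2, ?_⟩, ?_, hb⟩
  · rw [h1 3 (by omega)]; exact h.wf.mode
  · rw [h1 1 (by omega), h0 _ (by omega)]; exact h.wf.lower a i
  · rw [h2, h0 _ (by omega)]; exact (hst a i).le
  · rw [h2, h0 _ (by omega)]; exact hst a i
  · rw [h0 0 (by omega), h.input]
  · rw [h0 3 (by omega), h.counters]
  · rw [h1 0 (by omega), h.rep]
  · rw [h1 1 (by omega), h.lo]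
  · rw [h1 3 (by omega), h.mode]
  · rw [simMem_eq_simBase, hb]
    intro a i
    rw [h2, h0 _ (by omega)]; exact hst a i

/-- The same mechanism one level down: it forgets the previous preprocessing, as is needed for a
fresh repetition. -/
theorem Ctx.incLo (h : Ctx X inp cnt rep lo hi 1 σ) (hX : lo + 1 ≤ X) :
    Ctx X inp cnt rep (lo + 1) hi 1 (σ.set 1 1 (lo + 1)) ∧
      simBase (σ.set 1 1 (lo + 1)) = fun _ _ => 0 := by
  have h0 : ∀ b, b ≠ 1 → (σ.set 1 1 (lo + 1)) b = σ b := fun b hb => Memory.set_of_ne _ _ _ hb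
  have h1 : ∀ i, i ≠ 1 → (σ.set 1 1 (lo + 1)) 1 i = σ 1 i := fun i hi => set_reg_ne σ hi
  have h2 := set_reg_self σ 1 (lo + 1)
  have hst : ∀ a i, σ (2 * a + 5) (2 * i) < lo + 1 := fun a i => by
    have := h.wf.lower a i; rw [h.lo] at this; omega
  refine ⟨⟨⟨bdd_set h.wf.bdd 1 1 hX, ?_, fun a i => ?_, fun a i => ?_, fun hm => ?_⟩,
    ?_, ?_, ?_, h2, ?_, ?_⟩, ?_⟩
  · rw [h1 3 (by omega)]; exact h.wf.mode
  · rw [h2, h0 _ (by omega)]; exact (hst a i).le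
  · rw [h1 2 (by omega), h0 _ (by omega)]; exact h.wf.upper a i
  · rw [h1 3 (by omega), h.mode] at hm; omega
  · rw [h0 0 (by omega), h.input]
  · rw [h0 3 (by omega), h.counters]
  · rw [h1 0 (by omega), h.rep]
  · rw [h1 2 (by omega), h.hi]
  · rw [h1 3 (by omega), h.mode]
  · funext a i
    rw [simBase, h2, h0 _ (by omega), if_neg (hst a i).ne]

/-- Writing to the lower level is allowed only while the upper one is void, since otherwise upper
versions could hide what is written. -/
theorem Ctx.setMode {m' : ℕ} (h : Ctx X inp cnt rep lo hi m σ) (hX : 1 ≤ X)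
    (hm : m' = 0 ∧ (∀ a i, σ (2 * a + 5) (2 * i + 1) < hi) ∨ m' = 1) :
    Ctx X inp cnt rep lo hi m' (σ.set 1 3 m') := by
  have h0 : ∀ b, b ≠ 1 → (σ.set 1 3 m') b = σ b := fun b hb => Memory.set_of_ne _ _ _ hb
  have h1 : ∀ i, i ≠ 3 → (σ.set 1 3 m') 1 i = σ 1 i := fun i hi => set_reg_ne σ hi
  have h2 := set_reg_self σ 3 m'
  refine ⟨⟨bdd_set h.wf.bdd 1 3 (by omega), ?_, fun a i => ?_, fun a i => ?_, fun hm' a i => ?_⟩,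
    ?_, ?_, ?_, ?_, ?_, h2⟩
  · rw [h2]; omega
  · rw [h1 1 (by omega), h0 _ (by omega)]; exact h.wf.lower a i
  · rw [h1 2 (by omega), h0 _ (by omega)]; exact h.wf.upper a i
  · rw [h2] at hm'
    rw [h1 2 (by omega), h0 _ (by omega), h.hi]
    exact (hm.resolve_right (by omega)).2 a i
  · rw [h0 0 (by omega), h.input]
  · rw [h0 3 (by omega), h.counters]
  · rw [h1 0 (by omega), h.rep]
  · rw [h1 1 (by omega), h.lo]
  · rw [h1 2 (by omega), h.hi]

theorem simMem_setMode (v : ℕ) : simMem (σ.set 1 3 v) = simMem σ :=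
  simMem_congr (set_reg_ne σ (by omega)) (set_reg_ne σ (by omega))
    fun _ _ => Memory.set_of_ne _ _ _ (by omega)

/-- The preprocessing has been carried out on the lower level. From now on writes go to the upper
level, and the present memory becomes the base to which rollbacks return. -/
theorem Ctx.freeze (h : Ctx X inp cnt rep lo hi 0 σ) (hX : 1 ≤ X) :
    Ctx X inp cnt rep lo hi 1 (σ.set 1 3 1) ∧ simBase (σ.set 1 3 1) = simMem σ := by
  refine ⟨h.setMode hX (Or.inr rfl), ?_⟩
  rw [simMem_eq_simBase (h.wf.clean h.mode)]
  exact simBase_congr (set_reg_ne σ (by omega)) fun _ _ => Memory.set_of_ne _ _ _ (by omega)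

/-- Preparing a new repetition empties the simulated memory. -/
theorem Ctx.restart (h : Ctx X inp cnt rep lo hi 1 σ) (hlo : lo + 1 ≤ X) (hhi : hi + 1 ≤ X) :
    Ctx X inp cnt rep (lo + 1) (hi + 1) 0
        (((σ.set 1 1 (lo + 1)).set 1 2 (hi + 1)).set 1 3 0) ∧
      simMem (((σ.set 1 1 (lo + 1)).set 1 2 (hi + 1)).set 1 3 0) = fun _ _ => 0 := by
  obtain ⟨h1, hb1⟩ := h.incLo hlo
  obtain ⟨h2, hm2, -⟩ := h1.incHi hhi
  refine ⟨h2.setMode (by omega) (Or.inl ⟨rfl, fun a i => ?_⟩), ?_⟩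
  · have := h1.wf.upper a i
    rw [h1.hi] at this
    rw [Memory.set_of_ne _ _ _ (by omega)]
    omega
  · rw [simMem_setMode, hm2, hb1]

theorem Ctx.setCounter (h : Ctx X inp cnt rep lo hi m σ) (w : ℕ) {v : ℕ} (hv : v ≤ X) :
    Ctx X inp (Function.update cnt w v) rep lo hi m (σ.set 3 w v) ∧
      simBase (σ.set 3 w v) = simBase σ := by
  have h0 : ∀ b, b ≠ 3 → (σ.set 3 w v) b = σ b := fun b hb => Memory.set_of_ne _ _ _ hb
  have h1 := h0 1 (by omega)
  refine ⟨⟨⟨bdd_set h.wf.bdd 3 w hv, ?_, fun a i => ?_, fun a i => ?_, fun hm a i => ?_⟩,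
    ?_, ?_, ?_, ?_, ?_, ?_⟩, ?_⟩
  · rw [h1]; exact h.wf.mode
  · rw [h1, h0 _ (by omega)]; exact h.wf.lower a i
  · rw [h1, h0 _ (by omega)]; exact h.wf.upper a i
  · rw [h1] at hm ⊢; rw [h0 _ (by omega)]; exact h.wf.clean hm a i
  · rw [h0 0 (by omega), h.input]
  · rw [← h.counters]; simp [Memory.set]
  · rw [h1, h.rep]
  · rw [h1, h.lo]
  · rw [h1, h.hi]
  · rw [h1, h.mode]
  · exact simBase_congr (by rw [h1]) fun b hb => h0 b (by omega)

end WordRAM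

/-! ### Word bounds of the program and writing the initial graph -/

namespace HittingGraph

open WordRAM Expr

/-- The expressions that the program evaluates. -/
def exprs (g : ℕ) (init : Bool) : List Expr :=
  [2 + 2 * numEdgesE g init, inputE g init (reg 4), eqE bitE (.const init.toNat),
    portE (reg 6 / dE) 0 (reg 6 % dE), portE (reg 6 / dE) 1 (reg 6 % dE), 2 * dE, repsE, rE,
    ltE repsE (2 * .read 3 (reg 5)), .const (6 * (g + 1))]

/-- The word bound `B'` suffices if the contents of the memory are at most `X`. -/
structure Fits (X B' g : ℕ) (init : Bool) : Prop where
  two_le : 2 ≤ X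
  le_bound : 2 * X + 4 ≤ B'
  pow_lt : ∀ e ∈ exprs g init, X ^ e.deg < B'

theorem tame_exprs (g : ℕ) (init : Bool) : ∀ e ∈ exprs g init, e.Tame := by
  have hr : ∀ k, (reg k).Tame := fun k => trivial
  have h : ∀ k, (Expr.read 0 (OfNat.ofNat k)).Tame := tame_cell
  have h' := tame_ofNat
  have hL : repsE.Tame := (h' 12).mul ((h 3).add (h' 2))
  intro e he
  simp only [exprs, List.mem_cons, List.not_mem_nil, or_false] at he
  rcases he with rfl | rfl | rfl | rfl | rfl | rfl | rfl | rfl | rfl | rfl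
  · exact (h' 2).add ((h' 2).mul (tame_numEdgesE g init))
  · exact tame_inputE g init (hr 4)
  · exact Tame.eq ((((h' 4).add ((((h 0).add (h 1)).add (hr 5)).mul (h 3))).add
      ((hr 6).mod (h 3))).read 0) (tame_const _)
  · exact tame_portE ((hr 6).div (h 3)) (h' 0) ((hr 6).mod (h 3))
  · exact tame_portE ((hr 6).div (h 3)) (h' 1) ((hr 6).mod (h 3))
  · exact (h' 2).mul (h 3)
  · exact hL
  · exact h 2
  · exact hL.lt ((h' 2).mul ((hr 5).read 3))
  · exact tame_const _

variable {X B' g : ℕ} {init : Bool}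

theorem Fits.eval (hf : Fits X B' g init) {e : Expr} (he : e ∈ exprs g init) {σ : Memory}
    (hσ : ∀ a i, σ a i ≤ X) : e.eval B' σ = some (e.val σ) :=
  (tame_exprs g init e he).eval_eq hf.two_le hσ (hf.pow_lt e he)

theorem le_of_mem_graphInput {N : ℕ} {l : List (Fin N × Fin N)} {x : ℕ} (h : x ∈ graphInput N l) :
    x ≤ N + l.length := by
  simp only [graphInput, List.cons_append, List.nil_append, List.mem_cons, List.mem_flatMap,
    List.not_mem_nil, or_false] at h
  rcases h with rfl | rfl | ⟨e, _, rfl | rfl⟩ <;> omega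

variable {n q d : ℕ} {U : Fin n → Fin d → Bool} {V : Fin q → Fin d → Bool}
variable {inp cnt : ℕ → ℕ} {rep lo hi : ℕ} {σ : Memory}

theorem initial_graphInput (hin : Holds U V inp) :
    initial (graphInput (numVertices n q d g) (edgeList g U V init)) = fun a i =>
      if a = 0 ∧ i < 2 + 2 * numEdges n q d g init then inputNum n q d g init inp i else 0 := by
  funext a i
  simp only [initial, Memory.input]
  by_cases ha : a = 0
  · by_cases hi : i < 2 + 2 * numEdges n q d g init
    · rw [getElem?_graphInput hin init hi, if_pos ha, if_pos ⟨ha, hi⟩, Option.getD_some]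
    · rw [if_pos ha, if_neg (by omega), List.getElem?_eq_none, Option.getD_none]
      rw [length_graphInput, length_edgeList]; omega
  · rw [if_neg ha, if_neg (by omega)]

/-- The time for writing one number of the input of the dynamic algorithm. -/
def inputCost (g : ℕ) (init : Bool) : ℕ :=
  (reg 4).cost + (inputE g init (reg 4)).cost + 37 + (2 + 2 * numEdgesE g init).cost

theorem det_inputLoop (hf : Fits X B' g init) (hin : Holds U V inp) (h0 : inp 0 = n)
    (h1 : inp 1 = q) (h3 : inp 3 = d) (hX : numVertices n q d g + (2 + 2 * numEdges n q d g init) ≤ X)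
    (h : Ctx X inp cnt rep lo hi 0 σ) (hz : simMem σ = fun _ _ => 0) :
    Det B' (inputLoop g init) σ ((3 + 2 * numEdges n q d g init) * inputCost g init) (fun σ' =>
      Ctx X inp cnt rep lo hi 0 σ' ∧
      simMem σ' = initial (graphInput (numVertices n q d g) (edgeList g U V init))) := by
  have hB := hf.le_bound
  rw [initial_graphInput hin]
  set len := 2 + 2 * numEdges n q d g init with hlen
  refine Det.mono (det_forLoop (k := 4) (n := len)
    (D := (reg 4).cost + (inputE g init (reg 4)).cost + 27)
    (I := fun j τ => Ctx X inp cnt rep lo hi 0 τ ∧ τ 1 4 = j ∧ simMem τ = fun a i =>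
      if a = 0 ∧ i < j then inputNum n q d g init inp i else 0)
    (by omega) (by omega) (by omega) ?_ ?_ ?_) ?_ ?_
  · intro j hj τ hτ
    refine ⟨hτ.2.1, ?_⟩
    rw [hf.eval (by simp [exprs]) hτ.1.wf.bdd]
    change some (2 + 2 * (numEdgesE g init).val τ) = _
    rw [val_numEdgesE, hτ.1.input, h0, h1, h3]
  · rintro j hj τ ⟨hc, hj4, hm⟩
    have hb : ∀ a i, (τ.set 2 0 j) a i ≤ X := bdd_set hc.wf.bdd 2 0 (by omega)
    -- The number is evaluated after the target index has been put into scratch cell 0 of array 2,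
    -- on which `inputE` does not depend.
    have hval : (inputE g init (reg 4)).val (τ.set 2 0 j) = inputNum n q d g init inp j := by
      rw [val_inputE, Memory.set_of_ne _ _ _ (by omega), hc.input, h0, h1, h3]
      congr 1
    have hy : inputNum n q d g init inp j ≤ X := by
      have := List.mem_of_getElem? (getElem?_graphInput (g := g) hin init (hlen ▸ hj))
      have := le_of_mem_graphInput this
      rw [length_edgeList] at this
      omega
    refine (det_simStore hB (SimRel.refl hc.wf) 0 (eval_reg_of_lt hj4 (by omega) (by omega))
      (by omega) ((hf.eval (by simp [exprs]) hb).trans (congrArg some hval)) hy).mono le_rfl ?_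
    intro τ' hr
    refine ⟨by rw [hr.regs, hj4], (hc.of_simRel hr).setReg (by omega) (by omega),
      set_reg_self _ _ _, ?_⟩
    rw [simMem_setReg _ _ (by omega), hr.mem, hm]
    funext a i
    rw [Memory.set_apply]
    split_ifs with h' <;> first | rfl | omega | rw [h'.2]
  · refine ⟨h.setReg (by omega) (by omega), set_reg_self _ _ _, ?_⟩
    rw [simMem_setReg _ _ (by omega), hz]
    funext a i
    rw [if_neg (by omega)]
  · have e : (reg 4).cost + (inputE g init (reg 4)).cost + 27 + 6 +
      ((2 + 2 * numEdgesE g init).cost + 4) = inputCost g init := by unfold inputCost; omega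
    have e' : 3 + ((2 + 2 * numEdgesE g init).cost + 4) ≤ inputCost g init := by
      unfold inputCost; omega
    rw [e, show 3 + 2 * numEdges n q d g init = len + 1 from by omega, Nat.add_one_mul len]
    omega
  · rintro τ ⟨hc, -, hm⟩
    exact ⟨hc, hm⟩

end HittingGraph

/-! ### Simulating the operations that belong to one vector -/

namespace WordRAM

theorem wp_skip {B T : ℕ} {s : Memory} {F : Post} (hT : 1 ≤ T) :
    wp B .skip F (T, s) = F (T - 1, s) := by
  rw [wp, Program.exec, pay, if_pos hT, PMF.ev_pure, liftTop_some]

theorem input_pair (s : Memory) (u v : ℕ) : s.input [u, v] = (s.set 0 0 u).set 0 1 v := by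
  funext a i
  simp only [Memory.input, Memory.set_apply]
  rcases i with _ | _ | i <;> by_cases ha : a = 0 <;> simp [ha]

theorem input_nil (s : Memory) : s.input [] = s := by
  funext a i
  by_cases ha : a = 0 <;> simp [Memory.input, ha]

end WordRAM

namespace HittingGraph

open WordRAM Expr

/-- The time for simulating `k` operations with budget `T`, where `K` bounds the overhead. -/
def simTime (M : TimeMeasure) (K T k : ℕ) : ℕ :=
  match M with
  | .amortized => K * T
  | .worstCase => K * T * k

/-- With amortized time the unused budget is handed on by the simulation itself. With worst-case
time the budgets of the later operations are set aside in the slack of `wp_sim`. -/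
theorem wp_simOp {A : DynamicAlgorithm} {M : TimeMeasure} {X B B' K : ℕ} (hB' : 2 * X + 4 ≤ B')
    (hB : B ≤ X) (hX : 1 ≤ X) {N : ℕ} {o : GraphOp N} {os : List (GraphOp N)}
    (hK : (A.program o).overhead ≤ K) {σ₀ s σ : Memory} {T T' E : ℕ} {F : Post}
    {G : Memory → ℝ≥0∞} (h : SimRel X σ₀ (s.input o.args) σ)
    (hT : simTime M K T (os.length + 1) + E ≤ T')
    (hF : ∀ T₁ s₁ T₁' σ₁, SimRel X σ₀ s₁ σ₁ → simTime M K T₁ os.length + E ≤ T₁' →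
      F (T₁', σ₁) ≤ (A.runOps M B os T₁ s₁).ev (liftTop G)) :
    wp B' (A.program o).sim F (T', σ) ≤ (A.runOps M B (o :: os) T s).ev (liftTop G) := by
  rw [DynamicAlgorithm.runOps, ev_andThen]
  cases M with
  | amortized =>
    refine wp_sim hB' hB hX _ σ₀ E hK T T' _ σ F (fun x => (A.runOps .amortized B os x.1 x.2).ev
      (liftTop G)) h hT fun T₁ s₁ T₁' σ₁ h₁ hT₁ => hF T₁ s₁ T₁' σ₁ h₁ hT₁
  | worstCase =>
    refine wp_sim hB' hB hX _ σ₀ (K * T * os.length + E) hK T T' _ σ F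
      (fun x => (A.runOps .worstCase B os T x.2).ev (liftTop G)) h ?_
      fun T₁ s₁ T₁' σ₁ h₁ hT₁ => hF T s₁ T₁' σ₁ h₁ ?_
    · simp only [simTime, Nat.mul_add] at hT
      omega
    · simp only [simTime]
      omega

/-- The state while the vector number `w` is treated: `b` is the memory of the dynamic algorithm
after the preprocessing and `s` its current one. -/
structure Treating (X : ℕ) (inp cnt : ℕ → ℕ) (rep lo hi w : ℕ) (b s σ : Memory) : Prop where
  ctx : Ctx X inp cnt rep lo hi 1 σ
  base : simBase σ = b
  mem : simMem σ = s
  vec : σ 1 5 = w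

variable {X : ℕ} {inp cnt : ℕ → ℕ} {rep lo hi w : ℕ} {b s σ : Memory}

theorem Treating.simRel (h : Treating X inp cnt rep lo hi w b s σ) : SimRel X σ s σ :=
  h.mem ▸ SimRel.refl h.ctx.wf

theorem Treating.of_simRel (h : Treating X inp cnt rep lo hi w b s σ) {s' σ' : Memory}
    (hr : SimRel X σ s' σ') : Treating X inp cnt rep lo hi w b s' σ' :=
  ⟨h.ctx.of_simRel hr, (hr.base (by rw [hr.regs, h.ctx.mode])).trans h.base, hr.mem,
    by rw [hr.regs, h.vec]⟩

theorem Treating.setReg (h : Treating X inp cnt rep lo hi w b s σ) {j : ℕ} (hj : j ≤ X) :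
    Treating X inp cnt rep lo hi w b s (σ.set 1 6 j) :=
  ⟨h.ctx.setReg (by omega) hj, (simBase_setReg σ j (by omega)).trans h.base,
    (simMem_setReg σ j (by omega)).trans h.mem, (set_reg_ne σ (by omega)).trans h.vec⟩

/-- The time for treating a switchable edge, without the operation of the dynamic algorithm. -/
def switchCost (init : Bool) : ℕ :=
  (2 * dE : Expr).cost + 12 + (eqE bitE (.const init.toNat)).cost +
    ((0 : Expr).cost + (portE (reg 6 / dE) 0 (reg 6 % dE)).cost + 27) +
    ((1 : Expr).cost + (portE (reg 6 / dE) 1 (reg 6 % dE)).cost + 27)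

variable {A : DynamicAlgorithm} {M : TimeMeasure} {B B' K : ℕ} {g n q d : ℕ} {init : Bool}
  {U : Fin n → Fin d → Bool} {V : Fin q → Fin d → Bool} {wv : Fin d → Bool}

theorem program_switchOp (t : Fin 2 × Fin d) :
    A.program (switchOp g U V init t) = if init then A.delete else A.insert := by
  cases init <;> rfl

theorem args_switchOp (t : Fin 2 × Fin d) : (switchOp g U V init t).args =
    [portNum n q d t.1 0 t.2, portNum n q d t.1 1 t.2] := by
  cases init <;> simp [switchOp, GraphOp.args, node_port_val]

theorem portNum_lt (g : ℕ) (i s : Fin 2) (c : Fin d) :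
    portNum n q d i s c < numVertices n q d g := by
  have := ((scheme (n := n) (q := q) (d := d) g (fun _ _ => true) (fun _ _ => true)).node
    (port i s c.castSucc)).2
  rwa [node_port_val] at this

/-- The loop of the program over all 2d switchable edges is matched with the shorter list `opsFrom`:
an edge already in the right state costs one test and contributes no operation. The induction is on
the number k of edges left. -/
theorem wp_opsFrom (hf : Fits X B' g init) (hB : B ≤ X)
    (hK : (if init then A.delete else A.insert).overhead ≤ K) (hKq : A.query.overhead ≤ K)
    (h0 : inp 0 = n) (h1 : inp 1 = q) (h3 : inp 3 = d)
    (hw : ∀ c : Fin d, inp (4 + (n + q + w) * d + c) = (wv c).toNat)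
    (hX : numVertices n q d g + 2 * d ≤ X) {E : ℕ} {F : Post} {G : Memory → ℝ≥0∞}
    (hF : ∀ s₁ T₁ σ₁, Treating X inp cnt rep lo hi w b s₁ σ₁ → E ≤ T₁ → F (T₁, σ₁) ≤ G s₁) :
    ∀ k j, j + k = 2 * d → ∀ T T' s σ, Treating X inp cnt rep lo hi w b s σ → σ 1 6 = j →
    simTime M K T (opsFrom g U V init wv j).length + (k * switchCost init + switchCost init + E) ≤ T' →
    wp B' (.seq (whileLt 6 (2 * dE) (opStep A init)) A.query.sim) F (T', σ) ≤
      (A.runOps M B (opsFrom g U V init wv j) T s).ev (liftTop G) := by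
  have hB' := hf.le_bound
  have h2 := hf.two_le
  have hbound : ∀ σ s, Treating X inp cnt rep lo hi w b s σ →
      (2 * dE : Expr).eval B' σ = some (2 * d) := by
    intro σ s h
    rw [hf.eval (by simp [exprs]) h.ctx.wf.bdd]
    change some (2 * σ 0 3) = _
    rw [h.ctx.input, h3]
  intro k
  induction k with
  | zero =>
    intro j hj T T' s σ h hr hT
    obtain rfl : j = 2 * d := by omega
    have hc : (2 * dE : Expr).cost + 4 ≤ switchCost init := by unfold switchCost; omega
    rw [wp_seq, wp_whileLt_end hr (by omega) (by omega) (by omega) (hbound σ s h) (by omega)]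
    rw [opsFrom_last] at hT ⊢
    refine wp_simOp (o := .query) hB' hB (by omega) hKq (σ₀ := σ) (E := E) ?_
      (by simp only [List.length_nil, List.length_singleton, Nat.zero_add] at hT ⊢; omega)
      fun T₁ s₁ T₁' σ₁ h₁ hT₁ => ?_
    · simp only [GraphOp.args, input_nil]; exact h.simRel
    · rw [DynamicAlgorithm.runOps, PMF.ev_pure, liftTop_some]
      exact hF _ _ _ (h.of_simRel h₁) (by omega)
  | succ k ih =>
    intro j hj T T' s σ h hr hT
    have hlt : j < 2 * d := by omega
    have hd : 0 < d := by omega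
    rw [Nat.succ_mul] at hT
    rw [wp_seq, wp_whileLt_step hr (by omega) hlt (by omega) (hbound σ s h) (by
      unfold switchCost at hT; omega)]
    set F' := wp B' (incReg 6) (wp B' (whileLt 6 (2 * dE) (opStep A init)) (wp B' A.query.sim F))
      with hF'
    have hbit : (eqE bitE (.const init.toNat)).eval B' σ =
        some (if wv (switch ⟨j, hlt⟩).2 = init then 1 else 0) := by
      rw [hf.eval (by simp [exprs]) h.ctx.wf.bdd]
      change some (if σ 0 (4 + (σ 0 0 + σ 0 1 + σ 1 5) * σ 0 3 + σ 1 6 % σ 0 3) = init.toNat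
        then 1 else 0) = _
      rw [h.ctx.input, h.vec, hr, h0, h1, h3]
      have := hw (switch ⟨j, hlt⟩).2
      rw [show ((switch ⟨j, hlt⟩).2 : ℕ) = j % d by simp [switch, Fin.modNat]] at this
      rw [this]
      cases wv (switch ⟨j, hlt⟩).2 <;> cases init <;> rfl
    rw [opStep, wp_ite hbit (by unfold switchCost at hT; omega)]
    -- What follows the treatment of edge j is the same in both branches of the test; the 6 pays for
    -- increasing the counter.
    have hnext : ∀ T T' s σ, Treating X inp cnt rep lo hi w b s σ → σ 1 6 = j →
        simTime M K T (opsFrom g U V init wv (j + 1)).length +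
          (k * switchCost init + switchCost init + E + 6) ≤ T' →
        F' (T', σ) ≤ (A.runOps M B (opsFrom g U V init wv (j + 1)) T s).ev (liftTop G) := by
      intro T T' s σ h hr hT
      rw [hF', wp_incReg hr (by omega) (by omega) (by omega), ← wp_seq]
      exact ih (j + 1) (by omega) T _ s _ (h.setReg (by omega)) (set_reg_self _ _ _) (by omega)
    rw [opsFrom_of_lt hlt] at hT ⊢
    by_cases hc : wv (switch ⟨j, hlt⟩).2 = init
    · simp only [hc, if_true, one_ne_zero, if_false, List.nil_append] at hT ⊢
      rw [wp_skip (by unfold switchCost at hT; omega)]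
      exact hnext T _ s σ h hr (by
        have : (2 * dE : Expr).cost + 12 + (eqE bitE (.const init.toNat)).cost ≤ switchCost init := by
          unfold switchCost; omega
        omega)
    · simp only [hc, if_false, if_true, List.cons_append, List.nil_append, List.length_cons] at hT ⊢
      set c₀ := (0 : Expr).cost + (portE (reg 6 / dE) 0 (reg 6 % dE)).cost + 27 with hc₀
      set c₁ := (1 : Expr).cost + (portE (reg 6 / dE) 1 (reg 6 % dE)).cost + 27 with hc₁
      have hcost : switchCost init = (2 * dE : Expr).cost + 12 +
        (eqE bitE (.const init.toNat)).cost + c₀ + c₁ := rfl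
      have hm0 : portE (reg 6 / dE) 0 (reg 6 % dE) ∈ exprs g init := by simp [exprs]
      have hm1 : portE (reg 6 / dE) 1 (reg 6 % dE) ∈ exprs g init := by simp [exprs]
      have hmem : ∀ side : Fin 2,
          portE (reg 6 / dE) (Expr.const side) (reg 6 % dE) ∈ exprs g init := by
        intro side
        fin_cases side
        exacts [hm0, hm1]
      have hport : ∀ (side : Fin 2) (σ' : Memory), (∀ a i, σ' a i ≤ X) → σ' 0 = σ 0 → σ' 1 = σ 1 →
          (portE (reg 6 / dE) (Expr.const side) (reg 6 % dE)).eval B' σ' =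
          some (portNum n q d (switch ⟨j, hlt⟩).1 side (switch ⟨j, hlt⟩).2) := by
        intro side σ' hb e0 e1
        rw [hf.eval (hmem side) hb, val_portE, e0, h.ctx.input, h0, h1, h3]
        change some (portNum n q d (σ' 1 6 / σ' 0 3) side (σ' 1 6 % σ' 0 3)) = _
        rw [e0, e1, h.ctx.input, h3, hr]
        simp [switch, Fin.divNat, Fin.modNat]
      have hlt0 := portNum_lt (n := n) (q := q) g (switch ⟨j, hlt⟩).1 0 (switch ⟨j, hlt⟩).2
      have hlt1 := portNum_lt (n := n) (q := q) g (switch ⟨j, hlt⟩).1 1 (switch ⟨j, hlt⟩).2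
      have hs₁ : Det B' (simStore 0 0 (portE (reg 6 / dE) 0 (reg 6 % dE))) σ c₀ (SimRel X σ
          (s.set 0 0 (portNum n q d (switch ⟨j, hlt⟩).1 0 (switch ⟨j, hlt⟩).2))) :=
        det_simStore hB' h.simRel 0 (Expr.eval_const (k := 0) (by omega)) (by omega)
          (hport 0 _ (bdd_set h.ctx.wf.bdd 2 0 (by omega)) (Memory.set_of_ne _ _ _ (by omega))
          (Memory.set_of_ne _ _ _ (by omega))) (hlt0.le.trans (by omega))
      rw [wp_seq]
      refine wp_det hs₁ (by omega) fun T₁ σ₁ hT₁ h₁ => ?_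
      have hs₂ : Det B' (simStore 0 1 (portE (reg 6 / dE) 1 (reg 6 % dE))) σ₁ c₁ (SimRel X σ
          ((s.set 0 0 (portNum n q d (switch ⟨j, hlt⟩).1 0 (switch ⟨j, hlt⟩).2)).set 0 1
            (portNum n q d (switch ⟨j, hlt⟩).1 1 (switch ⟨j, hlt⟩).2))) :=
        det_simStore hB' h₁ 0 (Expr.eval_const (k := 1) (by omega)) (by omega)
          (hport 1 _ (bdd_set h₁.wf.bdd 2 0 (by omega))
          ((Memory.set_of_ne _ _ _ (by omega)).trans h₁.input)
          ((Memory.set_of_ne _ _ _ (by omega)).trans h₁.regs)) (hlt1.le.trans (by omega))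
      rw [wp_seq]
      refine wp_det hs₂ (by omega) fun T₂ σ₂ hT₂ h₂ => ?_
      rw [← program_switchOp (g := g) (U := U) (V := V) (switch ⟨j, hlt⟩)]
      refine wp_simOp (K := K) hB' hB (by omega) (by rw [program_switchOp]; exact hK) (σ₀ := σ)
        (E := k * switchCost init + switchCost init + E + 6) ?_ (by omega)
        fun T₃ s₃ T₃' σ₃ h₃ hT₃ => ?_
      · rw [args_switchOp, input_pair]; exact h₂
      · exact hnext T₃ T₃' s₃ σ₃ (h.of_simRel h₃) (by rw [h₃.regs, hr]) hT₃

end HittingGraph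

/-- The factor must not vanish, since 0 · ∞ = 0 would erase the penalty for failure. -/
theorem PMF.ev_liftTop_const_mul {α : Type*} (μ : PMF (Option α)) {c : ℝ≥0∞} (hc : c ≠ 0)
    (f : α → ℝ≥0∞) : μ.ev (liftTop fun a => c * f a) = c * μ.ev (liftTop f) := by
  rw [← PMF.ev_const_mul]
  congr 1
  funext o
  cases o <;> simp [ENNReal.mul_top hc]

namespace WordRAM

theorem Ctx.setRep {X : ℕ} {inp cnt : ℕ → ℕ} {rep lo hi m : ℕ} {σ : Memory}
    (h : Ctx X inp cnt rep lo hi m σ) {v : ℕ} (hv : v ≤ X) :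
    Ctx X inp cnt v lo hi m (σ.set 1 0 v) := by
  have h0 : ∀ b, b ≠ 1 → (σ.set 1 0 v) b = σ b := fun b hb => Memory.set_of_ne _ _ _ hb
  have h1 : ∀ i, i ≠ 0 → (σ.set 1 0 v) 1 i = σ 1 i := fun i hi => set_reg_ne σ hi
  refine ⟨⟨bdd_set h.wf.bdd 1 0 hv, ?_, fun a i => ?_, fun a i => ?_, fun hm a i => ?_⟩,
    ?_, ?_, set_reg_self _ _ _, ?_, ?_, ?_⟩
  · rw [h1 3 (by omega)]; exact h.wf.mode
  · rw [h1 1 (by omega), h0 _ (by omega)]; exact h.wf.lower a i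
  · rw [h1 2 (by omega), h0 _ (by omega)]; exact h.wf.upper a i
  · rw [h1 3 (by omega)] at hm
    rw [h1 2 (by omega), h0 _ (by omega)]; exact h.wf.clean hm a i
  · rw [h0 0 (by omega), h.input]
  · rw [h0 3 (by omega), h.counters]
  · rw [h1 1 (by omega), h.lo]
  · rw [h1 2 (by omega), h.hi]
  · rw [h1 3 (by omega), h.mode]

end WordRAM

/-! ### The vote on one vector -/

namespace HittingGraph

open WordRAM Expr

/-- Everything the program relies on: word and memory bounds, the input, the time `D` for the
operations belonging to one vector. -/
structure Setup (A : DynamicAlgorithm) (M : TimeMeasure) (K X B B' g : ℕ) (init : Bool)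
    {n q r d : ℕ} (U : Fin n → Fin d → Bool) (V : Fin q → Fin d → Bool) (W : Fin r → Fin d → Bool)
    (inp : ℕ → ℕ) (τ : Fin r → ℕ) (D : ℕ) : Prop where
  fits : Fits X B' g init
  bound_le : B ≤ X
  preprocess_le : A.preprocess.overhead ≤ K
  update_le : (if init then A.delete else A.insert).overhead ≤ K
  query_le : A.query.overhead ≤ K
  inp_zero : inp 0 = n
  inp_one : inp 1 = q
  inp_two : inp 2 = r
  inp_three : inp 3 = d
  holds : Holds U V inp
  holds_last : ∀ (w : Fin r) (c : Fin d), inp (4 + (n + q + w) * d + c) = (W w c).toNat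
  size_le : numVertices n q d g + (2 + 2 * numEdges n q d g init) + 2 * d ≤ X
  stamps_le : 12 * (d + 2) * (r + 1) ≤ X
  time_le : ∀ w, simTime M K (τ w) (opsFrom g U V init (W w) 0).length ≤ D

variable {A : DynamicAlgorithm} {M : TimeMeasure} {K X B B' g : ℕ} {init : Bool}
  {n q r d : ℕ} {U : Fin n → Fin d → Bool} {V : Fin q → Fin d → Bool} {W : Fin r → Fin d → Bool}
  {inp : ℕ → ℕ} {τ : Fin r → ℕ} {D : ℕ}

theorem Setup.r_le (S : Setup A M K X B B' g init U V W inp τ D) : r + 1 ≤ X := by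
  have := S.stamps_le
  nlinarith

theorem Setup.reps_le (S : Setup A M K X B B' g init U V W inp τ D) : 12 * (d + 2) ≤ X :=
  (Nat.le_mul_of_pos_right _ (Nat.succ_pos r)).trans S.stamps_le

theorem Setup.eval_rE (S : Setup A M K X B B' g init U V W inp τ D) {σ : Memory}
    (hb : ∀ a i, σ a i ≤ X) (hi : σ 0 = inp) : rE.eval B' σ = some r := by
  rw [S.fits.eval (by simp [exprs]) hb]
  change some (σ 0 2) = _
  rw [hi, S.inp_two]

theorem Setup.eval_repsE (S : Setup A M K X B B' g init U V W inp τ D) {σ : Memory}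
    (hb : ∀ a i, σ a i ≤ X) (hi : σ 0 = inp) : repsE.eval B' σ = some (12 * (d + 2)) := by
  rw [S.fits.eval (by simp [exprs]) hb]
  change some (12 * (σ 0 3 + 2)) = _
  rw [hi, S.inp_three]

/-- The time for one vector, without the operations of the dynamic algorithm. -/
def vectorCost (g d : ℕ) (init : Bool) : ℕ :=
  9 + (2 * d + 1) * switchCost init + ((reg 5).cost + (voteE g).cost + 1)

theorem eval_voteE (hf : Fits X B' g init) {σ : Memory} (hb : ∀ a i, σ a i ≤ X)
    (hv : σ 3 (σ 1 5) + 1 ≤ X) :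
    (voteE g).eval B' σ =
      some (σ 3 (σ 1 5) + if simMem σ 0 0 < 6 * (g + 1) then 1 else 0) := by
  have hB := hf.le_bound
  refine Expr.eval_bin (o := .add) (Expr.eval_read (eval_reg_of_lt rfl (by omega) ?_) (by omega))
    (Expr.eval_bin (o := .lt) (eval_simRead hB hb 0 (Expr.eval_const (k := 0) (by omega)) (by omega))
      (hf.eval (e := .const (6 * (g + 1))) (by simp [exprs]) hb) ?_) ?_
  · have := hb 1 5; omega
  · simp only [BinOp.eval]; split_ifs <;> omega
  · simp only [BinOp.eval]; split_ifs <;> omega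

/-- The initial rollback makes the run start from the frozen memory b, so its distribution is that
of the dynamic algorithm run directly after the preprocessing, no matter which vectors came before.
-/
theorem wp_vectorBody (S : Setup A M K X B B' g init U V W inp τ D) {cnt : ℕ → ℕ}
    {rep lo hi : ℕ} {b σ : Memory} (w : Fin r) {T' E : ℕ} {F : Post} {G : Memory → ℝ≥0∞}
    (h : Ctx X inp cnt rep lo hi 1 σ) (hb : simBase σ = b) (hv : σ 1 5 = w) (hhi : hi + 1 ≤ X)
    (hcnt : cnt w + 1 ≤ X) (hT : D + vectorCost g d init + E ≤ T')
    (hF : ∀ s₁ T₁ σ₁, Ctx X inp (Function.update cnt w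
        (cnt w + if s₁ 0 0 < 6 * (g + 1) then 1 else 0)) rep lo (hi + 1) 1 σ₁ →
      simBase σ₁ = b → σ₁ 1 5 = w → E ≤ T₁ → F (T₁, σ₁) ≤ G s₁) :
    wp B' (vectorBody A g init) F (T', σ) ≤
      (A.runOps M B (opsFrom g U V init (W w) 0) (τ w) b).ev (liftTop G) := by
  have hB := S.fits.le_bound
  have hX2 := S.fits.two_le
  have hw := w.2
  have hrX := S.r_le
  unfold vectorCost at hT
  obtain ⟨h₁, hm₁, hb₁⟩ := h.incHi hhi
  rw [vectorBody, wp_seq, wp_incReg h.hi (by omega) (by omega) (by omega), wp_seq,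
    wp_store (Expr.eval_const (by omega)) (Expr.eval_const (by omega)) (by simp only [Expr.cost]; omega),
    wp_seq]
  have hst : Treating X inp cnt rep lo (hi + 1) w b b ((σ.set 1 2 (hi + 1)).set 1 6 0) :=
    Treating.setReg ⟨h₁, hb₁.trans hb, hm₁.trans hb, (set_reg_ne σ (by omega)).trans hv⟩ (by omega)
  have ht := S.time_le w
  refine wp_opsFrom S.fits S.bound_le S.update_le S.query_le S.inp_zero S.inp_one S.inp_three
    (S.holds_last w) (by have := S.size_le; omega)
    (E := (reg 5).cost + (voteE g).cost + 1 + E) ?_ (2 * d) 0 (by omega) (τ w) _ b _ hst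
    (set_reg_self _ _ _) (by
      rw [Nat.add_mul, Nat.one_mul] at hT; simp only [Expr.cost] at hT ⊢; omega)
  intro s₁ T₁ σ₁ hs₁ hT₁
  have hw3 : σ₁ 3 (σ₁ 1 5) = cnt w := by rw [hs₁.ctx.counters, hs₁.vec]
  rw [wp_store (eval_reg_of_lt hs₁.vec (by omega) (by omega))
    (eval_voteE S.fits hs₁.ctx.wf.bdd (by rw [hw3]; exact hcnt)) (by omega), hw3, hs₁.mem]
  obtain ⟨hc, hbc⟩ := hs₁.ctx.setCounter (w : ℕ)
    (v := cnt w + if s₁ 0 0 < 6 * (g + 1) then 1 else 0) (by split_ifs <;> omega)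
  exact hF s₁ _ _ hc (hbc.trans hs₁.base)
    (by rw [Memory.set_of_ne _ _ _ (by omega), hs₁.vec]) (by omega)

/-! ### Counting wrong votes -/

open Classical in
/-- The weight of a state with `c` votes in `ρ` repetitions; every wrong vote counts twice. -/
noncomputable def voteWeight (y : Prop) (ρ c : ℕ) : ℝ≥0∞ := if y then 2 ^ (ρ - c) else 2 ^ c

open Classical in
/-- The weight of an answer of the dynamic algorithm. -/
noncomputable def answerWeight (g : ℕ) (y : Prop) (s : Memory) : ℝ≥0∞ :=
  if s 0 0 < 6 * (g + 1) ↔ y then 1 else 2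

theorem voteWeight_ne_zero (y : Prop) (ρ c : ℕ) : voteWeight y ρ c ≠ 0 := by
  unfold voteWeight; split_ifs <;> simp

/-- A correct vote keeps the number of wrong votes and an incorrect one raises it by one. This is an
inequality only because of truncated subtraction. -/
theorem voteWeight_succ_le (y : Prop) (ρ c : ℕ) (s : Memory) :
    voteWeight y (ρ + 1) (c + if s 0 0 < 6 * (g + 1) then 1 else 0) ≤
      voteWeight y ρ c * answerWeight g y s := by
  unfold voteWeight answerWeight
  by_cases hy : y <;> by_cases hs : s 0 0 < 6 * (g + 1) <;> simp only [hy, hs, if_true, if_false,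
    iff_true, iff_false, not_true, mul_one, add_zero]
  · rw [Nat.add_sub_add_right]
  · rw [← pow_succ]
    exact pow_le_pow_right₀ (by norm_num) (by omega)
  · rw [pow_succ]
  · exact le_rfl

/-- The bound for the expected weight after the votes on the remaining vectors. -/
noncomputable def tailWeight (y : Prop) (Q : ℝ≥0∞) (w w₀ rep c : ℕ) : ℝ≥0∞ :=
  if w ≤ w₀ then voteWeight y rep c * Q else voteWeight y (rep + 1) c

/-- Only the weight of the fixed vector `w₀` is followed. The other votes leave its counter alone,
so they contribute a constant, and by `hgood` they cannot fail. The vote on `w₀` contributes the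
factor Q. The stamp `hi` grows by one per vector and also bounds all counters, which excludes
overflow. -/
theorem wp_vectorLoop (S : Setup A M K X B B' g init U V W inp τ D) {rep lo H E : ℕ} {b : Memory}
    (hgood : ∀ w, none ∉ (A.runOps M B (opsFrom g U V init (W w) 0) (τ w) b).support)
    (w₀ : Fin r) (y : Prop) (hH : H ≤ X) {F : Post}
    (hF : ∀ cnt hi T₁ σ₁, Ctx X inp cnt rep lo hi 1 σ₁ → (∀ v, cnt v ≤ hi) → hi ≤ H → E ≤ T₁ →
      F (T₁, σ₁) ≤ voteWeight y (rep + 1) (cnt w₀)) :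
    ∀ k w, w + k = r → ∀ cnt hi T' σ, Ctx X inp cnt rep lo hi 1 σ → simBase σ = b → σ 1 5 = w →
    (∀ v, cnt v ≤ hi) → hi + k ≤ H →
    k * (D + vectorCost g d init + rE.cost + 10) + (rE.cost + 4) + E ≤ T' →
    wp B' (whileLt 5 rE (vectorBody A g init)) F (T', σ) ≤ tailWeight y
      ((A.runOps M B (opsFrom g U V init (W w₀) 0) (τ w₀) b).ev (liftTop (answerWeight g y)))
      w w₀ rep (cnt w₀) := by
  have hB := S.fits.le_bound
  have hX2 := S.fits.two_le
  have hrX := S.r_le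
  have hw₀ := w₀.2
  set Q := (A.runOps M B (opsFrom g U V init (W w₀) 0) (τ w₀) b).ev (liftTop (answerWeight g y))
    with hQ
  intro k
  induction k with
  | zero =>
    intro w hw cnt hi T' σ h hb hv hcnt hhi hT
    obtain rfl : w = r := by omega
    rw [wp_whileLt_end hv (by omega) (by omega) (by omega) (S.eval_rE h.wf.bdd h.input) (by omega),
      tailWeight, if_neg (by omega)]
    exact hF cnt hi _ σ h hcnt (by omega) (by omega)
  | succ k ih =>
    intro w hw cnt hi T' σ h hb hv hcnt hhi hT
    have hwr : w < r := by omega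
    rw [Nat.succ_mul] at hT
    rw [wp_whileLt_step hv (by omega) hwr (by omega) (S.eval_rE h.wf.bdd h.input) (by omega)]
    have hcw := hcnt w
    have hstep : ∀ (s₁ : Memory) T₁ σ₁, Ctx X inp (Function.update cnt w
          (cnt w + if s₁ 0 0 < 6 * (g + 1) then 1 else 0)) rep lo (hi + 1) 1 σ₁ →
        simBase σ₁ = b → σ₁ 1 5 = w →
        k * (D + vectorCost g d init + rE.cost + 10) + (rE.cost + 4) + E + 6 ≤ T₁ →
        wp B' (incReg 5) (wp B' (whileLt 5 rE (vectorBody A g init)) F) (T₁, σ₁) ≤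
          tailWeight y Q (w + 1) w₀ rep (Function.update cnt w
          (cnt w + if s₁ 0 0 < 6 * (g + 1) then 1 else 0) w₀) := by
      intro s₁ T₁ σ₁ h₁ hb₁ hv₁ hT₁
      rw [wp_incReg hv₁ (by omega) (by omega) (by omega)]
      refine ih (w + 1) (by omega) _ (hi + 1) _ _ (h₁.setReg (by omega) (by omega))
        ((simBase_setReg _ _ (by omega)).trans hb₁) (set_reg_self _ _ _) (fun v => ?_) (by omega)
        (by omega)
      rw [Function.update_apply]
      have := hcnt v
      split_ifs <;> omega
    by_cases hww : w = w₀
    · subst hww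
      refine (wp_vectorBody S w₀ (G := fun s => voteWeight y rep (cnt w₀) * answerWeight g y s)
        (E := k * (D + vectorCost g d init + rE.cost + 10) + (rE.cost + 4) + E + 6) h hb hv
        (by omega) (by omega) (by omega) fun s₁ T₁ σ₁ h₁ hb₁ hv₁ hT₁ => ?_).trans ?_
      · refine (hstep s₁ T₁ σ₁ h₁ hb₁ hv₁ hT₁).trans ?_
        rw [tailWeight, if_neg (by omega), Function.update_self]
        exact voteWeight_succ_le y rep _ s₁
      · rw [PMF.ev_liftTop_const_mul _ (voteWeight_ne_zero _ _ _), tailWeight, if_pos le_rfl]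
    · refine (wp_vectorBody S ⟨w, hwr⟩ (G := fun _ => tailWeight y Q w w₀ rep (cnt w₀))
        (E := k * (D + vectorCost g d init + rE.cost + 10) + (rE.cost + 4) + E + 6) h hb hv
        (by omega) (by simp only; omega) (by omega) fun s₁ T₁ σ₁ h₁ hb₁ hv₁ hT₁ => ?_).trans ?_
      · refine (hstep s₁ T₁ σ₁ h₁ hb₁ hv₁ hT₁).trans ?_
        rw [Function.update_of_ne (Ne.symm hww), tailWeight, tailWeight]
        by_cases hle : w ≤ w₀
        · rw [if_pos hle, if_pos (by omega)]
        · rw [if_neg hle, if_neg (by omega)]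
      · rw [PMF.ev_liftTop_const (hgood _)]

/-! ### Repetitions -/

/-- The time for one repetition with budget `T₀` for the preprocessing. -/
def repCost (K D T₀ g n q r d : ℕ) (init : Bool) : ℕ :=
  21 + (3 + 2 * numEdges n q d g init) * inputCost g init + K * T₀ +
    (r * (D + vectorCost g d init + rE.cost + 10) + (rE.cost + 4))

/-- That whole runs never fail implies the same for the runs continued from any memory that the
preprocessing can reach, which is the form used after a rollback. -/
theorem none_not_mem_runOps {l : List (Fin (numVertices n q d g) × Fin (numVertices n q d g))}
    {ops : List (GraphOp (numVertices n q d g))} {T₀ T T₁ : ℕ} {s : Memory}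
    (h : none ∉ (A.run M B l T₀ ops T).support)
    (hs : some (T₁, s) ∈ (A.preprocess.exec B T₀ (initial (graphInput _ l))).support) :
    none ∉ (A.runOps M B ops T s).support := by
  intro hn
  apply h
  rw [DynamicAlgorithm.run, andThen, PMF.mem_support_bind_iff]
  exact ⟨_, hs, hn⟩

/-- Averaging over the preprocessing recombines it with the operations for `w₀` into one run of the
dynamic algorithm. The dependence on the other vectors never matters, as only `w₀` is weighed. -/
theorem wp_repetition (S : Setup A M K X B B' g init U V W inp τ D) {T₀ : ℕ}
    (hrun : ∀ w, none ∉ (A.run M B (edgeList g U V init) T₀ (opsFrom g U V init (W w) 0)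
      (τ w)).support) (w₀ : Fin r) (y : Prop)
    (hev : (A.run M B (edgeList g U V init) T₀ (opsFrom g U V init (W w₀) 0) (τ w₀)).ev
      (liftTop (answerWeight g y)) ≤ 4 / 3)
    {cnt : ℕ → ℕ} {rep lo hi T' E : ℕ} {σ : Memory} {F : Post}
    (h : Ctx X inp cnt rep lo hi 1 σ) (hcnt : ∀ v, cnt v ≤ hi) (hhi : hi + (r + 1) ≤ X)
    (hlo : lo + 1 ≤ X) (hT : repCost K D T₀ g n q r d init + E ≤ T')
    (hF : ∀ cnt hi' T₁ σ₁, Ctx X inp cnt rep (lo + 1) hi' 1 σ₁ → (∀ v, cnt v ≤ hi') →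
      hi' ≤ hi + (r + 1) → E ≤ T₁ → F (T₁, σ₁) ≤ voteWeight y (rep + 1) (cnt w₀)) :
    wp B' (repetition A g init) F (T', σ) ≤ 4 / 3 * voteWeight y rep (cnt w₀) := by
  classical
  have hB := S.fits.le_bound
  have hX2 := S.fits.two_le
  unfold repCost at hT
  obtain ⟨h₁, hz⟩ := h.restart hlo (by omega)
  rw [repetition, wp_seq, wp_incReg h.lo (by omega) (by omega) (by omega), wp_seq,
    wp_incReg ((set_reg_ne σ (by omega)).trans h.hi) (by omega) (by omega) (by omega), wp_seq,
    wp_store (Expr.eval_const (by omega)) (Expr.eval_const (by omega)) (by simp only [Expr.cost]; omega),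
    wp_seq]
  simp only [Expr.cost]
  refine wp_det (det_inputLoop S.fits S.holds S.inp_zero S.inp_one S.inp_three
    (by have := S.size_le; omega) h₁ hz) (by omega) fun T₂ σ₂ hT₂ hσ₂ => ?_
  obtain ⟨h₂, hm₂⟩ := hσ₂
  rw [wp_seq]
  set Q : Memory → ℝ≥0∞ := fun s => (A.runOps M B (opsFrom g U V init (W w₀) 0) (τ w₀) s).ev
    (liftTop (answerWeight g y)) with hQ
  set Φ := voteWeight y rep (cnt w₀) with hΦ
  -- Memories from which some run could fail receive the value ∞. They have probability zero after
  -- the preprocessing, so `hsupp` below removes this case again.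
  refine (wp_sim hB S.bound_le (by omega) A.preprocess σ₂
    (6 + (r * (D + vectorCost g d init + rE.cost + 10) + (rE.cost + 4)) + E) S.preprocess_le T₀ T₂ _
    σ₂ _ (fun x => if ∀ w, none ∉ (A.runOps M B (opsFrom g U V init (W w) 0) (τ w) x.2).support
      then Φ * Q x.2 else ⊤) (hm₂ ▸ SimRel.refl h₂.wf) (by omega) ?_).trans ?_
  · intro T₃ s₃ T₃' σ₃ h₃ hT₃
    split_ifs with hgood
    swap
    · exact le_top
    have hc₃ := h₂.of_simRel h₃
    obtain ⟨h₄, hb₄⟩ := hc₃.freeze (by omega)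
    rw [h₃.mem] at hb₄
    rw [wp_seq, wp_store (Expr.eval_const (by omega)) (Expr.eval_const (by omega))
      (by simp only [Expr.cost]; omega), forLoop, wp_seq,
      wp_store (Expr.eval_const (by omega)) (Expr.eval_const (by omega))
      (by simp only [Expr.cost]; omega)]
    simp only [Expr.cost]
    refine (wp_vectorLoop S hgood w₀ y (H := hi + (r + 1)) (E := E) hhi hF r 0 (by omega) cnt (hi + 1)
      _ _ (h₄.setReg (k := 5) (v := 0) (by omega) (by omega))
      ((simBase_setReg _ _ (by omega)).trans hb₄) (set_reg_self _ _ _)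
      (fun v => (hcnt v).trans (by omega)) (by omega) (by simp only [Expr.cost] at hT₃ ⊢; omega)).trans ?_
    rw [tailWeight, if_pos (by omega)]
  · have hsupp : wp B A.preprocess (fun x => if ∀ w, none ∉ (A.runOps M B
        (opsFrom g U V init (W w) 0) (τ w) x.2).support then Φ * Q x.2 else ⊤)
        (T₀, initial (graphInput _ (edgeList g U V init))) ≤
        (A.preprocess.exec B T₀ (initial (graphInput _ (edgeList g U V init)))).ev
          (liftTop fun x => Φ * Q x.2) := by
      refine PMF.ev_mono_support fun o ho => ?_
      rcases o with _ | ⟨T₁, s₁⟩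
      · simp
      · simp only [liftTop_some]
        rw [if_pos fun w => none_not_mem_runOps (hrun w) ho]
    refine hsupp.trans ?_
    rw [PMF.ev_liftTop_const_mul _ (voteWeight_ne_zero _ _ _), mul_comm]
    refine mul_le_mul_left ?_ _
    rwa [DynamicAlgorithm.run, ev_andThen] at hev

theorem wp_repetitions (S : Setup A M K X B B' g init U V W inp τ D) {T₀ : ℕ}
    (hrun : ∀ w, none ∉ (A.run M B (edgeList g U V init) T₀ (opsFrom g U V init (W w) 0)
      (τ w)).support) (w₀ : Fin r) (y : Prop)
    (hev : (A.run M B (edgeList g U V init) T₀ (opsFrom g U V init (W w₀) 0) (τ w₀)).ev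
      (liftTop (answerWeight g y)) ≤ 4 / 3) {E : ℕ} {F : Post}
    (hF : ∀ cnt hi T₁ σ₁, Ctx X inp cnt (12 * (d + 2)) (12 * (d + 2)) hi 1 σ₁ → E ≤ T₁ →
      F (T₁, σ₁) ≤ voteWeight y (12 * (d + 2)) (cnt w₀)) :
    ∀ k ρ, ρ + k = 12 * (d + 2) → ∀ cnt hi T' σ, Ctx X inp cnt ρ ρ hi 1 σ → (∀ v, cnt v ≤ hi) →
    hi + k * (r + 1) ≤ X →
    k * (repCost K D T₀ g n q r d init + repsE.cost + 10) + (repsE.cost + 4) + E ≤ T' →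
    wp B' (whileLt 0 repsE (repetition A g init)) F (T', σ) ≤
      (4 / 3) ^ k * voteWeight y ρ (cnt w₀) := by
  have hB := S.fits.le_bound
  have hX2 := S.fits.two_le
  have hL := S.reps_le
  intro k
  induction k with
  | zero =>
    intro ρ hρ cnt hi T' σ h hcnt hhi hT
    obtain rfl : ρ = 12 * (d + 2) := by omega
    rw [wp_whileLt_end h.rep (by omega) (by omega) (by omega) (S.eval_repsE h.wf.bdd h.input)
      (by omega), pow_zero, one_mul]
    exact hF cnt hi _ σ h (by omega)
  | succ k ih =>
    intro ρ hρ cnt hi T' σ h hcnt hhi hT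
    rw [Nat.succ_mul] at hT hhi
    rw [wp_whileLt_step h.rep (by omega) (by omega) (by omega) (S.eval_repsE h.wf.bdd h.input)
      (by omega), pow_succ, mul_assoc]
    have hpos : ((4 : ℝ≥0∞) / 3) ^ k ≠ 0 := pow_ne_zero _ (by simp)
    have hfin : ((4 : ℝ≥0∞) / 3) ^ k ≠ ⊤ := by
      refine ENNReal.pow_ne_top (ENNReal.div_ne_top ?_ ?_) <;> simp
    -- The postexpectation is divided by (4/3)^k, the factor owed to the later repetitions, to bring
    -- the induction hypothesis into the normalized form that `wp_repetition` expects.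
    have := wp_repetition S hrun w₀ y hev h hcnt (by omega) (by omega) (T' := T' - (repsE.cost + 4))
      (E := k * (repCost K D T₀ g n q r d init + repsE.cost + 10) + (repsE.cost + 4) + E + 6)
      (F := fun x => (((4 : ℝ≥0∞) / 3) ^ k)⁻¹ * wp B' (incReg 0)
        (wp B' (whileLt 0 repsE (repetition A g init)) F) x) (by omega) ?_
    · calc wp B' (repetition A g init) (wp B' (incReg 0)
            (wp B' (whileLt 0 repsE (repetition A g init)) F)) (T' - (repsE.cost + 4), σ)
          = (4 / 3) ^ k * wp B' (repetition A g init) (fun x => (((4 : ℝ≥0∞) / 3) ^ k)⁻¹ *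
            wp B' (incReg 0) (wp B' (whileLt 0 repsE (repetition A g init)) F) x)
            (T' - (repsE.cost + 4), σ) := by
            rw [wp, wp, PMF.ev_liftTop_const_mul _ (ENNReal.inv_ne_zero.2 hfin), ← mul_assoc,
              ENNReal.mul_inv_cancel hpos hfin, one_mul]
        _ ≤ _ := mul_le_mul_right this _
    · intro cnt' hi' T₁ σ₁ h₁ hcnt' hhi' hT₁
      rw [ENNReal.inv_mul_le_iff hpos hfin]
      rw [wp_incReg h₁.rep (by omega) (by omega) (by omega)]
      exact ih (ρ + 1) (by omega) cnt' hi' _ _ (h₁.setRep (by omega)) hcnt' (by omega) (by omega)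

end HittingGraph

/-! ### The majority decision and the error probability -/

namespace WordRAM

/-- Nonemptiness matters only for failure: the left side is then ∞, while an empty sum would be 0.
-/
theorem wp_sum_le {B : ℕ} {P : Program} {ι : Type*} (I : Finset ι) (hI : I.Nonempty)
    (F : ι → Post) (x : ℕ × Memory) :
    wp B P (fun x => ∑ i ∈ I, F i x) x ≤ ∑ i ∈ I, wp B P (F i) x := by
  simp only [wp]
  rw [← PMF.ev_sum]
  refine PMF.ev_mono fun o => ?_
  cases o with
  | none =>
    obtain ⟨i, hi⟩ := hI
    exact (le_top.trans_eq (liftTop_none (F i)).symm).trans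
      (Finset.single_le_sum (f := fun i => liftTop (F i) none) (fun _ _ => zero_le) hi)
  | some a => exact le_rfl

end WordRAM

namespace HittingGraph

open WordRAM Expr

variable {A : DynamicAlgorithm} {M : TimeMeasure} {K X B B' g : ℕ} {init : Bool}
  {n q r d : ℕ} {U : Fin n → Fin d → Bool} {V : Fin q → Fin d → Bool} {W : Fin r → Fin d → Bool}
  {inp : ℕ → ℕ} {τ : Fin r → ℕ} {D : ℕ}

def majorityCost (r : ℕ) : ℕ :=
  14 + (r * ((ltE repsE (2 * .read 3 (reg 5))).cost + rE.cost + 14) + rE.cost)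

theorem det_majority (S : Setup A M K X B B' g init U V W inp τ D) {cnt : ℕ → ℕ} {σ : Memory}
    (hb : ∀ a i, σ a i ≤ X) (hi : σ 0 = inp) (hc : σ 3 = cnt) :
    Det B' majority σ (majorityCost r)
      fun σ' => (σ' 0 0 ≠ 0 ↔ ∃ w < r, 12 * (d + 2) < 2 * cnt w) := by
  classical
  have hB := S.fits.le_bound
  have hX2 := S.fits.two_le
  have hrX := S.r_le
  refine Det.mono (Det.seq (D := 3) (Det.store (Expr.eval_const (by omega))
    (Expr.eval_const (by omega)) rfl) ?_)
    (D := 3 + ((3 + (r * ((ltE repsE (2 * .read 3 (reg 5))).cost + 1 + 3 + 6 + (rE.cost + 4)) +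
      (rE.cost + 4))) + 4)) ?_ fun _ h => h
  swap
  · rw [majorityCost, show (ltE repsE (2 * .read 3 (reg 5))).cost + 1 + 3 + 6 + (rE.cost + 4) =
      (ltE repsE (2 * .read 3 (reg 5))).cost + rE.cost + 14 from by omega]
    omega
  rintro _ rfl
  refine Det.seq (det_forLoop (k := 5) (n := r) (I := fun j τ => (∀ a i, τ a i ≤ X) ∧ τ 0 = inp ∧
    τ 3 = cnt ∧ τ 1 5 = j ∧ τ 1 7 = if ∃ w < j, 12 * (d + 2) < 2 * cnt w then 1 else 0)
    (by omega) (by omega) (by omega) ?_ ?_ ?_) ?_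
  · rintro j hj τ ⟨hb, hi, -, h5, -⟩
    exact ⟨h5, S.eval_rE hb hi⟩
  · rintro j hj τ ⟨hb, hi, hc, h5, h7⟩
    have htest : (ltE repsE (2 * .read 3 (reg 5))).eval B' τ =
        some (if 12 * (d + 2) < 2 * cnt j then 1 else 0) := by
      rw [S.fits.eval (by simp [exprs]) hb]
      change some (if 12 * (τ 0 3 + 2) < 2 * τ 3 (τ 1 5) then 1 else 0) = _
      rw [hi, hc, h5, S.inp_three]
    have hex : (∃ w < j + 1, 12 * (d + 2) < 2 * cnt w) ↔
        (∃ w < j, 12 * (d + 2) < 2 * cnt w) ∨ 12 * (d + 2) < 2 * cnt j := by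
      constructor
      · rintro ⟨w, hw, h⟩
        rcases Nat.lt_succ_iff_lt_or_eq.1 hw with hw | rfl
        · exact Or.inl ⟨w, hw, h⟩
        · exact Or.inr h
      · rintro (⟨w, hw, h⟩ | h)
        · exact ⟨w, by omega, h⟩
        · exact ⟨j, by omega, h⟩
    refine Det.ite (D := 3) htest (fun hv => ?_) fun hv => ?_
    · have hn : ¬ 12 * (d + 2) < 2 * cnt j := by
        intro h; rw [if_pos h] at hv; omega
      refine (Det.skip ⟨h5, bdd_set hb 1 5 (by omega), ?_, ?_, set_reg_self _ _ _, ?_⟩).mono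
        (by omega) fun _ h => h
      · rw [Memory.set_of_ne _ _ _ (by omega), hi]
      · rw [Memory.set_of_ne _ _ _ (by omega), hc]
      · rw [set_reg_ne _ (by omega), h7]
        simp only [hex, hn, or_false]
    · have hn : 12 * (d + 2) < 2 * cnt j := by
        by_contra h; rw [if_neg h] at hv; exact hv rfl
      refine Det.store (Expr.eval_const (by omega)) (Expr.eval_const (by omega))
        ⟨by rw [set_reg_ne _ (by omega), h5], bdd_set (bdd_set hb 1 7 (by omega)) 1 5 (by omega),
          ?_, ?_, set_reg_self _ _ _, ?_⟩
      · rw [Memory.set_of_ne _ _ _ (by omega), Memory.set_of_ne _ _ _ (by omega), hi]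
      · rw [Memory.set_of_ne _ _ _ (by omega), Memory.set_of_ne _ _ _ (by omega), hc]
      · rw [set_reg_ne _ (by omega), set_reg_self]
        simp only [hex, hn, or_true, if_true]
  · refine ⟨bdd_set (bdd_set hb 1 7 (by omega)) 1 5 (by omega), ?_, ?_, set_reg_self _ _ _, ?_⟩
    · rw [Memory.set_of_ne _ _ _ (by omega), Memory.set_of_ne _ _ _ (by omega), hi]
    · rw [Memory.set_of_ne _ _ _ (by omega), Memory.set_of_ne _ _ _ (by omega), hc]
    · rw [set_reg_ne _ (by omega), set_reg_self]
      simp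
  · rintro σ' ⟨hb', -, -, -, h7⟩
    refine Det.store (Expr.eval_const (k := 0) (by omega)) (eval_reg_of_lt h7 (by omega) ?_) ?_
    · split_ifs <;> omega
    · rw [Memory.set_apply, if_pos ⟨rfl, rfl⟩]
      simp

/-- A wrong decision has a vector with many wrong votes. -/
theorem exists_le_voteWeight {y : Fin r → Prop} {cnt : ℕ → ℕ} {m : ℕ}
    (h : ¬ ((∃ w < r, 2 * m < 2 * cnt w) ↔ ∃ w, y w)) :
    ∃ w : Fin r, 2 ^ m ≤ voteWeight (y w) (2 * m) (cnt w) := by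
  unfold voteWeight
  have h2 : (1 : ℝ≥0∞) ≤ 2 := by norm_num
  by_cases hy : ∃ w, y w
  · have h1 : ¬ ∃ w < r, 2 * m < 2 * cnt w := fun h1 => h (iff_of_true h1 hy)
    obtain ⟨w, hw⟩ := hy
    refine ⟨w, ?_⟩
    rw [if_pos hw]
    refine pow_le_pow_right₀ h2 ?_
    by_contra hc
    exact h1 ⟨w, w.2, by omega⟩
  · have h1 : ∃ w < r, 2 * m < 2 * cnt w := by
      by_contra h1; exact h (iff_of_false h1 hy)
    obtain ⟨w, hw, hm⟩ := h1
    refine ⟨⟨w, hw⟩, ?_⟩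
    rw [if_neg fun hw' => hy ⟨_, hw'⟩]
    exact pow_le_pow_right₀ h2 (by simp only; omega)

/-- The number of repetitions works because 2^(-6) (4/3)^12 ≤ 1/2. Each vector then errs with
probability at most 2^(-(d+2)), and there are at most 2^d vectors. -/
theorem failure_bound {r d : ℕ} (h : r ≤ 2 ^ d) :
    (r : ℝ≥0∞) * ((2 ^ (6 * (d + 2)))⁻¹ * (4 / 3) ^ (12 * (d + 2))) ≤ 1 / 4 := by
  have h1 : ((2 : ℝ≥0∞) ^ (6 * (d + 2)))⁻¹ * (4 / 3) ^ (12 * (d + 2)) ≤ (2⁻¹) ^ (d + 2) := by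
    have e : ((2 : ℝ≥0∞) ^ (6 * (d + 2)))⁻¹ * (4 / 3) ^ (12 * (d + 2)) =
        ((2⁻¹) ^ 6 * (4 / 3) ^ 12) ^ (d + 2) := by
      rw [mul_pow, ← pow_mul, ← pow_mul, ENNReal.inv_pow]
    rw [e]
    refine pow_le_pow_left₀ zero_le ?_ _
    have e2 : (2 : ℝ≥0∞)⁻¹ = ENNReal.ofReal (1 / 2) := by
      rw [one_div, ENNReal.ofReal_inv_of_pos (by norm_num)]; simp
    have e3 : (4 / 3 : ℝ≥0∞) = ENNReal.ofReal (4 / 3) := by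
      rw [ENNReal.ofReal_div_of_pos (by norm_num)]; simp
    rw [e2, e3, ← ENNReal.ofReal_pow (by norm_num), ← ENNReal.ofReal_pow (by norm_num),
      ← ENNReal.ofReal_mul (by norm_num)]
    exact ENNReal.ofReal_le_ofReal (by norm_num)
  calc (r : ℝ≥0∞) * ((2 ^ (6 * (d + 2)))⁻¹ * (4 / 3) ^ (12 * (d + 2)))
      ≤ 2 ^ d * (2⁻¹) ^ (d + 2) := by
        refine mul_le_mul' ?_ h1
        exact_mod_cast h
    _ = (2 * 2⁻¹) ^ d * (2⁻¹) ^ 2 := by rw [pow_add, mul_pow, mul_assoc]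
    _ = 1 / 4 := by
      rw [ENNReal.mul_inv_cancel (by norm_num) (by norm_num), one_pow, one_mul, ← ENNReal.inv_pow,
        one_div]
      norm_num

/-- The time of the program with budget `T₀` for the preprocessing. -/
def mainCost (K D T₀ g n q r d : ℕ) (init : Bool) : ℕ :=
  6 + (12 * (d + 2) * (repCost K D T₀ g n q r d init + repsE.cost + 10) + (repsE.cost + 4)) +
    majorityCost r

-- Markov's inequality and the union bound in one: a wrong decision forces weight at least
-- 2^(6(d+2)) for some vector, so the error indicator is dominated by the sum of all weights divided
-- by this number.
open Classical in
theorem wp_mainProgram (S : Setup A M K X B B' g init U V W inp τ D) {T₀ T' : ℕ}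
    (hr : 0 < r) (hrd : r ≤ 2 ^ d)
    (hrun : ∀ w, none ∉ (A.run M B (edgeList g U V init) T₀ (opsFrom g U V init (W w) 0)
      (τ w)).support) (y : Fin r → Prop)
    (hev : ∀ w, (A.run M B (edgeList g U V init) T₀ (opsFrom g U V init (W w) 0) (τ w)).ev
      (liftTop (answerWeight g (y w))) ≤ 4 / 3)
    {σ : Memory} (hσ0 : σ 0 = inp) (hσ : ∀ a, a ≠ 0 → σ a = 0) (hinp : ∀ i, inp i ≤ X)
    (hT : mainCost K D T₀ g n q r d init ≤ T') :
    wp B' (mainProgram A g init) (fun x => if (x.2 0 0 ≠ 0 ↔ ∃ w, y w) then 0 else 1) (T', σ) ≤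
      1 / 4 := by
  have hB := S.fits.le_bound
  have hX2 := S.fits.two_le
  have hzero : ∀ a i, a ≠ 0 → σ a i = 0 := fun a i ha => by rw [hσ a ha]; rfl
  have h1 : Ctx X inp 0 0 0 0 1 (σ.set 1 3 1) := by
    have h0 : ∀ b, b ≠ 1 → (σ.set 1 3 1) b = σ b := fun b hb => Memory.set_of_ne _ _ _ hb
    have h1 : ∀ i, i ≠ 3 → (σ.set 1 3 1) 1 i = 0 := fun i hi => by
      rw [set_reg_ne σ hi, hzero 1 i (by omega)]
    have h3 := set_reg_self σ 3 1
    refine ⟨⟨bdd_set (fun a i => ?_) 1 3 (by omega), Or.inr h3, fun a i => ?_, fun a i => ?_,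
      fun hm => ?_⟩, ?_, ?_, h1 0 (by omega), h1 1 (by omega), h1 2 (by omega), h3⟩
    · by_cases ha : a = 0
      · rw [ha, hσ0]; exact hinp i
      · rw [hzero a i ha]; omega
    · rw [h0 _ (by omega), hzero _ _ (by omega)]; omega
    · rw [h0 _ (by omega), hzero _ _ (by omega)]; omega
    · rw [h3] at hm; omega
    · rw [h0 _ (by omega), hσ0]
    · rw [h0 _ (by omega), hσ _ (by omega)]
  have h2 : Ctx X inp 0 0 0 0 1 ((σ.set 1 3 1).set 1 0 0) := h1.setRep (by omega)
  unfold mainCost at hT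
  rw [mainProgram, wp_seq, wp_store (Expr.eval_const (by omega)) (Expr.eval_const (by omega))
    (by simp only [Expr.cost]; omega), wp_seq, forLoop, wp_seq, wp_store
    (Expr.eval_const (by omega)) (Expr.eval_const (by omega)) (by simp only [Expr.cost]; omega)]
  set L := 12 * (d + 2) with hL
  -- The weight is set to ∞ on states that the repetitions cannot leave behind, so that the
  -- domination `hpoint` holds for every state and no reachability argument is needed.
  set Fw : Fin r → Post := fun w x => if (∃ hi, Ctx X inp (x.2 3) L L hi 1 x.2) ∧ majorityCost r ≤ x.1
    then voteWeight (y w) L (x.2 3 w) else ⊤ with hFw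
  have hpow : ((2 : ℝ≥0∞) ^ (6 * (d + 2)))⁻¹ ≠ 0 := by
    rw [Ne, ENNReal.inv_eq_zero]; exact ENNReal.pow_ne_top (by simp)
  have hpoint : ∀ x, wp B' majority (fun x => if (x.2 0 0 ≠ 0 ↔ ∃ w, y w) then 0 else 1) x ≤
      ∑ w, (2 ^ (6 * (d + 2)))⁻¹ * Fw w x := by
    rintro ⟨T₁, σ₁⟩
    by_cases hx : (∃ hi, Ctx X inp (σ₁ 3) L L hi 1 σ₁) ∧ majorityCost r ≤ T₁
    · obtain ⟨⟨hi, hctx⟩, hT₁⟩ := id hx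
      refine wp_det (det_majority S hctx.wf.bdd hctx.input rfl) hT₁ fun T₂ σ₂ _ h₂ => ?_
      simp only [h₂]
      split_ifs with hd
      · exact zero_le
      · rw [show 12 * (d + 2) = 2 * (6 * (d + 2)) from by ring] at hd
        obtain ⟨w, hw⟩ := exists_le_voteWeight hd
        refine le_trans ?_ (Finset.single_le_sum (f := fun w => ((2 : ℝ≥0∞) ^ (6 * (d + 2)))⁻¹ *
          Fw w (T₁, σ₁)) (fun _ _ => zero_le) (Finset.mem_univ w))
        simp only [hFw]
        rw [if_pos hx, hL, show 12 * (d + 2) = 2 * (6 * (d + 2)) from by ring]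
        rw [← ENNReal.inv_mul_cancel (a := (2 : ℝ≥0∞) ^ (6 * (d + 2))) (by simp)
          (ENNReal.pow_ne_top (by simp))]
        exact mul_le_mul_right hw _
    · refine le_top.trans (le_trans (le_of_eq ?_) (Finset.single_le_sum (f := fun w =>
        ((2 : ℝ≥0∞) ^ (6 * (d + 2)))⁻¹ * Fw w (T₁, σ₁)) (fun _ _ => zero_le)
        (Finset.mem_univ (⟨0, hr⟩ : Fin r))))
      simp only [hFw]
      rw [if_neg hx, ENNReal.mul_top hpow]
  refine (wp_mono hpoint _).trans ((wp_sum_le _ ⟨⟨0, hr⟩, Finset.mem_univ _⟩ _ _).trans ?_)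
  refine le_trans (Finset.sum_le_card_nsmul _ _ ((2 ^ (6 * (d + 2)))⁻¹ * (4 / 3) ^ L)
    fun w _ => ?_) ?_
  · rw [wp, PMF.ev_liftTop_const_mul _ hpow]
    refine mul_le_mul_right ?_ _
    refine (wp_repetitions S hrun w (y w) (hev w) (E := majorityCost r) (F := Fw w) ?_ L 0 (by omega)
      0 0 _ _ h2 (fun v => le_rfl) ?_ ?_).trans_eq ?_
    · intro cnt hi T₁ σ₁ hctx hT₁
      simp only [hFw]
      rw [if_pos ⟨⟨hi, by rw [hctx.counters]; exact hctx⟩, hT₁⟩, hctx.counters]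
    · rw [Nat.zero_add]; exact S.stamps_le
    · simp only [Expr.cost] at hT ⊢; omega
    · simp [voteWeight]
  · rw [Finset.card_univ, Fintype.card_fin, nsmul_eq_mul]
    exact failure_bound hrd

open Classical in
/-- The program decides correctly with sufficient probability. -/
theorem mainProgram_spec (S : Setup A M K X B B' g init U V W inp τ D) {T₀ T' : ℕ}
    (hr : 0 < r) (hrd : r ≤ 2 ^ d)
    (hrun : ∀ w, none ∉ (A.run M B (edgeList g U V init) T₀ (opsFrom g U V init (W w) 0)
      (τ w)).support) (y : Fin r → Prop)
    (hev : ∀ w, (A.run M B (edgeList g U V init) T₀ (opsFrom g U V init (W w) 0) (τ w)).ev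
      (liftTop (answerWeight g (y w))) ≤ 4 / 3)
    {σ : Memory} (hσ0 : σ 0 = inp) (hσ : ∀ a, a ≠ 0 → σ a = 0) (hinp : ∀ i, inp i ≤ X)
    (hT : mainCost K D T₀ g n q r d init ≤ T') :
    none ∉ ((mainProgram A g init).exec B' T' σ).support ∧
    2 / 3 ≤ ((mainProgram A g init).exec B' T' σ).toOuterMeasure
      {o | ∃ T s, o = some (T, s) ∧ (s 0 0 ≠ 0 ↔ ∃ w, y w)} := by
  have h := wp_mainProgram S hr hrd hrun y hev hσ0 hσ hinp hT
  set μ := (mainProgram A g init).exec B' T' σ with hμ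
  rw [wp] at h
  constructor
  · rw [PMF.mem_support_iff, not_not]
    refine PMF.apply_eq_zero_of_ev_ne_top (ne_top_of_le_ne_top ?_ h) (liftTop_none _)
    simp
  · set Z : Set Outcome := {o | ∃ T s, o = some (T, s) ∧ (s 0 0 ≠ 0 ↔ ∃ w, y w)} with hZ
    have h1 := μ.ev_indicator_compl Z
    have h2 : μ.ev (Zᶜ.indicator 1) ≤ 1 / 4 := by
      refine le_trans (PMF.ev_mono fun o => ?_) h
      rcases o with _ | ⟨T, s⟩
      · exact le_top
      · rw [liftTop_some]
        by_cases hc : s 0 0 ≠ 0 ↔ ∃ w, y w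
        · rw [Set.indicator_of_notMem]
          · exact zero_le
          · exact fun hn => hn ⟨T, s, rfl, hc⟩
        · simp only [hc, if_false]
          exact Set.indicator_le_self' (fun _ _ => zero_le) _
    -- The computed error bound 1/4 is below the admissible 1/3.
    have h3 : (2 / 3 : ℝ≥0∞) + 1 / 4 ≤ 1 := by
      have e1 : (2 / 3 : ℝ≥0∞) = ENNReal.ofReal (2 / 3) := by
        rw [ENNReal.ofReal_div_of_pos (by norm_num)]; simp
      have e2 : (1 / 4 : ℝ≥0∞) = ENNReal.ofReal (1 / 4) := by
        rw [ENNReal.ofReal_div_of_pos (by norm_num)]; simp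
      rw [e1, e2, ← ENNReal.ofReal_add (by norm_num) (by norm_num), ← ENNReal.ofReal_one]
      exact ENNReal.ofReal_le_ofReal (by norm_num)
    have h4 : (2 / 3 : ℝ≥0∞) + 1 / 4 ≤ μ.toOuterMeasure Z + 1 / 4 :=
      h3.trans (h1.symm.trans_le (add_le_add le_rfl h2))
    exact (ENNReal.add_le_add_iff_right (by simp)).1 h4

end HittingGraph

namespace HittingGraph

open WordRAM

/-! ### The input of the program -/

theorem index_lt {p d : ℕ} (i : Fin p) (c : Fin d) : i * d + c < p * d := by
  calc i * d + c < (i + 1) * d := by rw [Nat.add_mul, Nat.one_mul]; omega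
    _ ≤ p * d := Nat.mul_le_mul_right _ i.2

theorem vectorEntries_eq {p d : ℕ} (U : Fin p → Fin d → Bool) :
    vectorEntries U = List.ofFn fun k : Fin (p * d) => (U k.divNat k.modNat).toNat := by
  rw [List.ofFn_mul, vectorEntries]
  congr 2
  funext i
  congr 1
  funext c
  have h := finProdFinEquiv.symm_apply_apply (i, c)
  rw [finProdFinEquiv_symm_apply, Prod.mk.injEq] at h
  have e : (⟨i * d + c, index_lt i c⟩ : Fin (p * d)) = finProdFinEquiv (i, c) := by
    ext; simp [finProdFinEquiv, mul_comm, add_comm]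
  rw [e, h.1, h.2]

theorem length_vectorEntries {p d : ℕ} (U : Fin p → Fin d → Bool) :
    (vectorEntries U).length = p * d := by
  rw [vectorEntries_eq, List.length_ofFn]

theorem getElem?_vectorEntries {p d : ℕ} (U : Fin p → Fin d → Bool) (i : Fin p) (c : Fin d) :
    (vectorEntries U)[i * d + c]? = some (U i c).toNat := by
  have h := finProdFinEquiv.symm_apply_apply (i, c)
  rw [finProdFinEquiv_symm_apply, Prod.mk.injEq] at h
  have e : (⟨i * d + c, index_lt i c⟩ : Fin (p * d)) = finProdFinEquiv (i, c) := by
    ext; simp [finProdFinEquiv, mul_comm, add_comm]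
  rw [vectorEntries_eq, List.getElem?_ofFn, dif_pos (index_lt i c), e, h.1, h.2]

section

variable {n q r d : ℕ} (U : Fin n → Fin d → Bool) (V : Fin q → Fin d → Bool)
  (W : Fin r → Fin d → Bool)

theorem initial_apply (l : List ℕ) (i : ℕ) : initial l 0 i = (l[i]?).getD 0 := by
  simp [initial, Memory.input]

theorem initial_of_ne (l : List ℕ) {a : ℕ} (ha : a ≠ 0) : initial l a = 0 := by
  funext i
  simp [initial, Memory.input, ha]

theorem holds_hittingSetInput : Holds U V (initial (hittingSetInput U V W) 0) := by
  constructor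
  · intro u c
    have hlt := index_lt u c
    have h : (hittingSetInput U V W)[4 + u * d + c]? = some (U u c).toNat := by
      rw [hittingSetInput, List.append_assoc, List.append_assoc, List.getElem?_append_right (by simp; omega),
        List.getElem?_append_left (by rw [length_vectorEntries]; simp; omega),
        ← getElem?_vectorEntries U u c]
      congr 1
      simp; omega
    rw [initial_apply, h, Option.getD_some]
  · intro v c
    have hlt := index_lt v c
    have h : (hittingSetInput U V W)[4 + (n + v) * d + c]? = some (V v c).toNat := by
      rw [Nat.add_mul]
      rw [hittingSetInput, List.append_assoc, List.append_assoc, List.getElem?_append_right (by simp; omega),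
        List.getElem?_append_right (by rw [length_vectorEntries]; simp; omega),
        List.getElem?_append_left (by rw [length_vectorEntries, length_vectorEntries]; simp; omega),
        ← getElem?_vectorEntries V v c]
      congr 1
      rw [length_vectorEntries]; simp; omega
    rw [initial_apply, h, Option.getD_some]

theorem hittingSetInput_last (w : Fin r) (c : Fin d) :
    initial (hittingSetInput U V W) 0 (4 + (n + q + w) * d + c) = (W w c).toNat := by
  have hlt := index_lt w c
  have h : (hittingSetInput U V W)[4 + (n + q + w) * d + c]? = some (W w c).toNat := by
    rw [Nat.add_mul, Nat.add_mul]
    rw [hittingSetInput, List.getElem?_append_right (by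
        simp only [List.length_append, length_vectorEntries]; simp; omega),
      ← getElem?_vectorEntries W w c]
    congr 1
    simp only [List.length_append, length_vectorEntries]; simp; omega
  rw [initial_apply, h, Option.getD_some]

theorem hittingSetInput_le (i : ℕ) :
    initial (hittingSetInput U V W) 0 i ≤ n + q + r + d + 1 := by
  rw [initial_apply]
  cases h : (hittingSetInput U V W)[i]? with
  | none => simp
  | some x =>
    have hx := List.mem_of_getElem? h
    have hbool : ∀ {p : ℕ} (Z : Fin p → Fin d → Bool), x ∈ vectorEntries Z → x ≤ 1 := by
      intro p Z hZ
      rw [vectorEntries_eq, List.mem_ofFn] at hZ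
      obtain ⟨k, rfl⟩ := hZ
      exact Bool.toNat_le _
    simp only [hittingSetInput, List.mem_append, List.mem_cons, List.not_mem_nil, or_false] at hx
    rw [Option.getD_some]
    rcases hx with ((hx | hx) | hx) | hx
    · rcases hx with rfl | rfl | rfl | rfl <;> omega
    · have := hbool U hx; omega
    · have := hbool V hx; omega
    · have := hbool W hx; omega

end

/-! ### The votes of the dynamic algorithm -/

/-- Some vector of `U` hits all vectors of `V` together with `w`. -/
def HitsAll {n q d : ℕ} (U : Fin n → Fin d → Bool) (V : Fin q → Fin d → Bool)
    (w : Fin d → Bool) : Prop := ∃ u, ∀ v, Hits (U u) (V v) w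

theorem hasHittingSet_iff {n q r d : ℕ} {U : Fin n → Fin d → Bool} {V : Fin q → Fin d → Bool}
    {W : Fin r → Fin d → Bool} : HasHittingSet U V W ↔ ∃ w, HitsAll U V (W w) := by
  simp only [HasHittingSet, HitsAll, tripleProduct_ne_zero_iff]
  exact exists_comm

/-- The two radius bounds, 4 (g + 1) + 1 and 6 (g + 1), are further apart than the factor α, so an
approximate radius decides between them. -/
theorem lt_iff_hitsAll {n q d g : ℕ} {U : Fin n → Fin d → Bool} {V : Fin q → Fin d → Bool}
    {w : Fin d → Bool} (hn : 0 < n) (hg : 1 ≤ g) {α : ℝ}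
    (hα : α * (4 * (g + 1) + 1) < 6 * (g + 1)) {R : ℕ}
    (h : ApproximatesRadius α (graph g U V w) R) : R < 6 * (g + 1) ↔ HitsAll U V w := by
  obtain ⟨h1, h2⟩ := h
  constructor
  · intro hR
    by_contra hy
    have hu : ∀ u, ∃ v, ¬ Hits (U u) (V v) w := by
      simpa [HitsAll] using hy
    have h3 := (le_radius hn hu).trans h1
    rw [Nat.cast_le] at h3
    omega
  · rintro ⟨u, hu⟩
    have h3 := radius_le hg hu
    have h4 : (graph g U V w).radius.toNat ≤ 4 * (g + 1) + 1 := ENat.toNat_le_of_le_natCast h3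
    have h5 : ((graph g U V w).radius.toNat : ℝ) ≤ 4 * (g + 1) + 1 := by exact_mod_cast h4
    have h6 : (R : ℝ) < 6 * (g + 1) := by
      -- A negative α can occur, as ε is not assumed to be small; the approximation is then at most
      -- 0.
      rcases le_or_gt 0 α with h0 | h0
      · exact (h2.trans (mul_le_mul_of_nonneg_left h5 h0)).trans_lt hα
      · have : α * ((graph g U V w).radius.toNat : ℝ) ≤ 0 :=
          mul_nonpos_of_nonpos_of_nonneg h0.le (Nat.cast_nonneg _)
        have : (0 : ℝ) < 6 * (g + 1) := by positivity
        linarith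
    exact_mod_cast h6

/-- The weight is 1 plus the indicator of a wrong answer, and a wrong answer has probability at most
1/3. -/
theorem ev_answerWeight_le {μ : PMF (Option Memory)} (hμ : none ∉ μ.support) {g : ℕ} {y : Prop}
    {Z : Set (Option Memory)} (hZ : 2 / 3 ≤ μ.toOuterMeasure Z)
    (h : ∀ s, some s ∈ Z → (s 0 0 < 6 * (g + 1) ↔ y)) :
    μ.ev (liftTop (answerWeight g y)) ≤ 4 / 3 := by
  have h1 := μ.ev_indicator_compl Z
  have h2 : μ.ev (Zᶜ.indicator 1) ≤ 1 / 3 := by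
    have h3 : (2 / 3 : ℝ≥0∞) + 1 / 3 = 1 := by
      rw [ENNReal.div_add_div_same]; norm_num
      exact ENNReal.div_self (by simp) (by simp)
    have h4 : (2 / 3 : ℝ≥0∞) + μ.ev (Zᶜ.indicator 1) ≤ 2 / 3 + 1 / 3 := by
      rw [h3]; exact (add_le_add hZ le_rfl).trans_eq h1
    refine (ENNReal.add_le_add_iff_left ?_).1 h4
    exact ENNReal.div_ne_top (by simp) (by simp)
  have h5 : μ.ev (liftTop (answerWeight g y)) ≤ μ.ev (fun o => 1 + Zᶜ.indicator 1 o) := by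
    refine PMF.ev_mono_support fun o ho => ?_
    rcases o with _ | s
    · exact absurd ho hμ
    · rw [liftTop_some, answerWeight]
      split_ifs with hs
      · exact le_self_add
      · have hm : some s ∈ Zᶜ := fun hm => hs (h s hm)
        rw [Set.indicator_of_mem hm]
        exact (one_add_one_eq_two (R := ℝ≥0∞)).ge
  rw [PMF.ev_add, PMF.ev_const] at h5
  refine h5.trans ((add_le_add le_rfl h2).trans_eq ?_)
  calc (1 : ℝ≥0∞) + 1 / 3 = 3 / 3 + 1 / 3 := by rw [ENNReal.div_self (by simp) (by simp)]
    _ = 4 / 3 := by rw [ENNReal.div_add_div_same]; norm_num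

/-- One bound for both time measures: in the worst-case setting the total of k single budgets is an
integer below the real number ρ' m, hence below its floor. -/
theorem simTime_budget_le (M : TimeMeasure) (K : ℕ) {ρ ρ' : ℝ} (h : ρ ≤ ρ') (h0 : 0 ≤ ρ') {k m : ℕ}
    (hk : k ≤ m) : simTime M K (M.budget ρ k) k ≤ K * ⌊ρ' * m⌋₊ := by
  cases M with
  | amortized =>
    refine Nat.mul_le_mul_left _ (Nat.floor_le_floor ?_)
    have : (k : ℝ) ≤ m := by exact_mod_cast hk
    calc ρ * k ≤ ρ' * k := by gcongr
      _ ≤ ρ' * m := by gcongr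
  | worstCase =>
    change K * ⌊ρ⌋₊ * k ≤ _
    rw [mul_assoc]
    refine Nat.mul_le_mul_left _ (Nat.le_floor ?_)
    push_cast
    have h1 : (⌊ρ⌋₊ : ℝ) ≤ ρ' :=
      (Nat.cast_le.2 (Nat.floor_le_floor h)).trans (Nat.floor_le h0)
    have : (k : ℝ) ≤ m := by exact_mod_cast hk
    exact mul_le_mul h1 this (Nat.cast_nonneg _) h0

end HittingGraph

namespace HittingGraph

open WordRAM

/-! ### Word length -/

theorem numVertices_le {n d g : ℕ} (hn : 1 ≤ n) (hd : 1 ≤ d) :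
    numVertices n n d g ≤ 24 * (g + 1) * (n * d) := by
  have h1 : n ≤ n * d := Nat.le_mul_of_pos_right n hd
  have h2 : d ≤ n * d := Nat.le_mul_of_pos_left d hn
  have h3 : (n + n + 2) * (d + 2) ≤ 12 * (n * d) := by nlinarith
  have h4 : 2 * ((n + n + 2) * (d + 2)) * g ≤ 2 * (12 * (n * d)) * g :=
    Nat.mul_le_mul_right _ (Nat.mul_le_mul_left _ h3)
  have e : 24 * (g + 1) * (n * d) = 24 * (n * d) + 2 * (12 * (n * d)) * g := by ring
  rw [e, numVertices, numNodes, numSlots]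
  omega

theorem numEdges_le {n d g : ℕ} (hn : 1 ≤ n) (hd : 1 ≤ d) (init : Bool) :
    numEdges n n d g init ≤ 26 * (g + 1) * (n * d) := by
  have h2 : d ≤ n * d := Nat.le_mul_of_pos_left d hn
  have h3 : (n + n + 2) * (d + 2) ≤ 12 * (n * d) := by nlinarith
  have h4 : 2 * ((n + n + 2) * (d + 2)) * (g + 1) ≤ 2 * (12 * (n * d)) * (g + 1) :=
    Nat.mul_le_mul_right _ (Nat.mul_le_mul_left _ h3)
  have e : 26 * (g + 1) * (n * d) = 2 * (12 * (n * d)) * (g + 1) + 2 * (n * d) + 2 * (n * d) * g := by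
    ring
  have h5 : (if init then 2 * d else 0) ≤ 2 * d := by split_ifs <;> omega
  rw [e, numEdges, numSlots]
  omega

/-- Constant factors are turned into exponents by c ≤ Y^c, so that polynomial bounds become plain
powers of Y. -/
theorem le_pow_of_le_mul {Y x c k : ℕ} (hY : 2 ≤ Y) (h : x ≤ c * Y ^ k) : x ≤ Y ^ (c + k) := by
  refine h.trans ?_
  rw [pow_add]
  exact Nat.mul_le_mul_right _ (Nat.lt_pow_self (by omega)).le

/-- Together with `pow_lt_wordBound` this places the word bound between two powers of the size
parameter. Words for N-vertex graphs therefore fit into somewhat longer words for size n + d, as N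
is polynomial in n + d. -/
theorem wordBound_le {κ N : ℕ} (hN : N ≠ 0) : wordBound κ N ≤ (2 * N) ^ κ := by
  rw [wordBound, mul_comm, pow_mul, pow_succ, mul_comm]
  exact Nat.pow_le_pow_left (Nat.mul_le_mul_left _ (Nat.pow_log_le_self 2 hN)) _

theorem pow_lt_wordBound {κ Y : ℕ} (hκ : κ ≠ 0) : Y ^ κ < wordBound κ Y := by
  rw [wordBound, mul_comm, pow_mul]
  exact Nat.pow_lt_pow_left (Nat.lt_pow_succ_log_self (by omega) Y) hκ

theorem card_le_two_pow {r d : ℕ} {W : Fin r → Fin d → Bool} (h : Function.Injective W) :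
    r ≤ 2 ^ d := by
  simpa using Fintype.card_le_of_injective W h

theorem ceil_rpow_le {n : ℕ} (hn : 1 ≤ n) {t : ℝ} (ht : 0 < t) :
    (⌈(n : ℝ) ^ t⌉₊ : ℝ) ≤ 2 * (n : ℝ) ^ t := by
  have h1 : (1 : ℝ) ≤ (n : ℝ) ^ t := Real.one_le_rpow (by exact_mod_cast hn) ht.le
  have := (Nat.ceil_lt_add_one (show 0 ≤ (n : ℝ) ^ t by positivity)).le
  linarith

theorem ceil_rpow_le_pow {n : ℕ} (hn : 1 ≤ n) (t : ℝ) : ⌈(n : ℝ) ^ t⌉₊ ≤ n ^ ⌈t⌉₊ := by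
  rw [Nat.ceil_le]
  push_cast
  rw [← Real.rpow_natCast]
  exact Real.rpow_le_rpow_of_exponent_le (by exact_mod_cast hn) (Nat.le_ceil t)

/-- Memory contents and words are polynomially bounded. -/
theorem exists_word_bounds (g κ : ℕ) (init : Bool) (t : ℝ) :
    ∃ κ', ∀ n d : ℕ, 1 ≤ n → 1 ≤ d → ∃ X, Fits X (wordBound κ' (n + d)) g init ∧
      wordBound κ (numVertices n n d g) ≤ X ∧
      numVertices n n d g + (2 + 2 * numEdges n n d g init) + 2 * d ≤ X ∧
      12 * (d + 2) * (⌈(n : ℝ) ^ t⌉₊ + 1) ≤ X ∧ n + n + ⌈(n : ℝ) ^ t⌉₊ + d + 1 ≤ X := by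
  set a := 24 * (g + 1) with ha
  set c := a + 52 * (g + 1) + 4 with hc
  -- One summand for each of the four size requirements below; with X = Y^m they all hold at once.
  set m := (2 * a + 2) * κ + (c + 2) + (72 + (⌈t⌉₊ + 1)) + (5 + (⌈t⌉₊ + 1)) with hm
  set Δ := ((exprs g init).map Expr.deg).sum with hΔ
  -- The part m Δ leaves room for the values X^deg of the expressions, and m + 2 for 2X + 4 ≤ 4X ≤
  -- Y^2 X.
  refine ⟨m * Δ + m + 2, fun n d hn hd => ?_⟩
  set Y := n + d with hY
  have hY2 : 2 ≤ Y := by omega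
  have hnd : n * d ≤ Y ^ 2 := by rw [hY]; nlinarith
  have hmono : ∀ {x k}, x ≤ Y ^ k → k ≤ m → x ≤ Y ^ m := fun h hk =>
    h.trans (Nat.pow_le_pow_right (by omega) hk)
  have hNle := numVertices_le (g := g) hn hd
  have hEle := numEdges_le (g := g) hn hd init
  have hrle := ceil_rpow_le_pow hn t
  set r := ⌈(n : ℝ) ^ t⌉₊ with hr
  have hrY : r ≤ Y ^ ⌈t⌉₊ := hrle.trans (Nat.pow_le_pow_left (by omega) _)
  have hYpos : 1 ≤ Y ^ ⌈t⌉₊ := Nat.one_le_pow _ _ (by omega)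
  have hYle : Y ≤ Y ^ (⌈t⌉₊ + 1) := Nat.le_self_pow (by omega) _
  have hrY' : r ≤ Y ^ (⌈t⌉₊ + 1) := hrY.trans (Nat.pow_le_pow_right (by omega) (by omega))
  have hX2 : 2 ≤ Y ^ m := hmono (k := 1) (by simpa using hY2) (by omega)
  refine ⟨Y ^ m, ⟨hX2, ?_, fun e he => ?_⟩, ?_, ?_, ?_, ?_⟩
  · have h1 : Y ^ (m + 2) < wordBound (m * Δ + m + 2) Y :=
      (Nat.pow_le_pow_right (by omega) (by omega)).trans_lt (pow_lt_wordBound (by omega))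
    have h2 : 2 ^ 2 ≤ Y ^ 2 := Nat.pow_le_pow_left hY2 2
    rw [pow_add] at h1
    nlinarith
  · have h1 : e.deg ≤ Δ := List.single_le_sum (by simp) _ (List.mem_map_of_mem he)
    rw [← pow_mul]
    have h2 : m * e.deg ≤ m * Δ := Nat.mul_le_mul_left _ h1
    exact (Nat.pow_le_pow_right (by omega) (by omega)).trans_lt (pow_lt_wordBound (by omega))
  · refine (wordBound_le (by rw [numVertices, numNodes]; omega)).trans ?_
    have h1 : 2 * numVertices n n d g ≤ Y ^ (2 * a + 2) := by
      refine le_pow_of_le_mul hY2 ?_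
      rw [mul_assoc]
      exact Nat.mul_le_mul_left _ (hNle.trans (Nat.mul_le_mul_left _ hnd))
    refine (Nat.pow_le_pow_left h1 κ).trans ?_
    rw [← pow_mul]
    exact Nat.pow_le_pow_right (by omega) (by omega)
  · refine hmono (le_pow_of_le_mul (c := c) (k := 2) hY2 ?_) (by omega)
    have h1 : numVertices n n d g ≤ a * Y ^ 2 := hNle.trans (Nat.mul_le_mul_left _ hnd)
    have h2 : numEdges n n d g init ≤ 26 * (g + 1) * Y ^ 2 :=
      hEle.trans (Nat.mul_le_mul_left _ hnd)
    have h3 : Y ≤ Y ^ 2 := Nat.le_self_pow (by omega) _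
    have e : c * Y ^ 2 = a * Y ^ 2 + 2 * (26 * (g + 1) * Y ^ 2) + 4 * Y ^ 2 := by rw [hc]; ring
    rw [e]
    omega
  · refine hmono (le_pow_of_le_mul (c := 72) (k := ⌈t⌉₊ + 1) hY2 ?_) (by omega)
    calc 12 * (d + 2) * (r + 1) ≤ 12 * (3 * Y) * (2 * Y ^ ⌈t⌉₊) :=
          Nat.mul_le_mul (by omega) (by omega)
      _ = 72 * Y ^ (⌈t⌉₊ + 1) := by ring
  · exact hmono (le_pow_of_le_mul (c := 5) (k := ⌈t⌉₊ + 1) hY2 (by omega)) (by omega)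

/-! ### Running time -/

theorem rpow_mul_le {a n d : ℕ} (ha : 1 ≤ a) (hn : 1 ≤ n) (hd : 1 ≤ d) {N : ℕ}
    (hN : N ≤ a * (n * d)) {s : ℝ} (hs : 0 ≤ s) {k : ℕ} (hk : s ≤ k) :
    (N : ℝ) ^ s ≤ (a : ℝ) ^ k * ((n : ℝ) ^ s * (d : ℝ) ^ k) := by
  have h1 : (N : ℝ) ≤ a * (n * d) := by exact_mod_cast hN
  calc (N : ℝ) ^ s ≤ ((a : ℝ) * (n * d)) ^ s := Real.rpow_le_rpow (Nat.cast_nonneg _) h1 hs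
    _ = (a : ℝ) ^ s * ((n : ℝ) ^ s * (d : ℝ) ^ s) := by
      rw [Real.mul_rpow (by positivity) (by positivity), Real.mul_rpow (by positivity) (by positivity)]
    _ ≤ _ := by
      have e1 : (a : ℝ) ^ s ≤ (a : ℝ) ^ k := by
        rw [← Real.rpow_natCast]
        exact Real.rpow_le_rpow_of_exponent_le (by exact_mod_cast ha) hk
      have e2 : (d : ℝ) ^ s ≤ (d : ℝ) ^ k := by
        rw [← Real.rpow_natCast]
        exact Real.rpow_le_rpow_of_exponent_le (by exact_mod_cast hd) hk
      gcongr

-- Two terms dominate: the preprocessing, of order n^t, and |W| times the work for one vector, of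
-- order n^t · n^(2-η). The power of d is ⌈t⌉ + 3 for one repetition, covering both the
-- preprocessing and the d^3 of the updates, and one more for the number of repetitions.
set_option maxHeartbeats 800000 in
theorem exists_mainCost_le (K g : ℕ) (init : Bool) (C : ℝ) {t η ε' : ℝ} (ht : 0 < t)
    (hη : η ≤ 1) (hη' : η ≤ ε') (hη0 : 0 < η) :
    ∃ C' : ℝ, ∀ n d : ℕ, 1 ≤ n → 1 ≤ d →
      mainCost K (K * ⌊|C| * (numVertices n n d g : ℝ) ^ (2 - ε') * (2 * d + 1 : ℕ)⌋₊)
        ⌊C * (numVertices n n d g : ℝ) ^ t⌋₊ g n n ⌈(n : ℝ) ^ t⌉₊ d init ≤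
      ⌊C' * (n : ℝ) ^ (1 + 1 + t - η) * (d : ℝ) ^ (⌈t⌉₊ + 4)⌋₊ := by
  set a := 24 * (g + 1) with ha
  set cI := (inputCost g init : ℝ) with hcI
  set cs := (switchCost init : ℝ) with hcs
  set cv := (((reg 5).cost + (voteE g).cost + 1 : ℕ) : ℝ) with hcv
  set cr := (rE.cost : ℝ) with hcr
  set cL := (repsE.cost : ℝ) with hcL
  set cm := (((Expr.ltE repsE (2 * .read 3 (reg 5))).cost : ℕ) : ℝ) with hcm
  have hcI0 : 0 ≤ cI := Nat.cast_nonneg _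
  have hcs0 : 0 ≤ cs := Nat.cast_nonneg _
  have hcv0 : 0 ≤ cv := Nat.cast_nonneg _
  have hcr0 : 0 ≤ cr := Nat.cast_nonneg _
  have hcL0 : 0 ≤ cL := Nat.cast_nonneg _
  have hcm0 : 0 ≤ cm := Nat.cast_nonneg _
  clear_value cI cs cv cr cL cm
  set c₁ : ℝ := 21 + (3 + 52 * (g + 1)) * cI + K * (|C| * (a : ℝ) ^ ⌈t⌉₊) +
    (2 * (K * (|C| * (a : ℝ) ^ 2 * 3)) + 2 * (9 + 3 * cs + cv + cr + 10) + (cr + 4)) with hc₁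
  have hc₁0 : 0 ≤ c₁ := by positivity
  clear_value c₁
  refine ⟨6 + 36 * (c₁ + cL + 10) + (cL + 4) + (14 + (2 * (cm + cr + 14) + cr)),
    fun n d hn hd => Nat.le_floor ?_⟩
  have hnR : (1 : ℝ) ≤ n := by exact_mod_cast hn
  have hdR : (1 : ℝ) ≤ d := by exact_mod_cast hd
  set N := numVertices n n d g with hN
  set p := (n : ℝ) ^ (1 + 1 + t - η) with hp
  set δ := (d : ℝ) with hδ
  set z := δ ^ (⌈t⌉₊ + 3) with hz
  set r := ⌈(n : ℝ) ^ t⌉₊ with hr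
  have hrle : (r : ℝ) ≤ 2 * (n : ℝ) ^ t := ceil_rpow_le hn ht
  have hN1 : (1 : ℝ) ≤ N := by
    have : 1 ≤ N := by rw [hN, numVertices, numNodes]; omega
    exact_mod_cast this
  have hp1 : 1 ≤ p := Real.one_le_rpow hnR (by linarith)
  have hnp : (n : ℝ) ≤ p := by
    calc (n : ℝ) = (n : ℝ) ^ (1 : ℝ) := (Real.rpow_one _).symm
      _ ≤ p := Real.rpow_le_rpow_of_exponent_le hnR (by linarith)
  have htp : (n : ℝ) ^ t ≤ p := Real.rpow_le_rpow_of_exponent_le hnR (by linarith)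
  -- This identity is the heart of the running time: |W| times the time per vector is exactly the
  -- forbidden bound.
  have hmul : (n : ℝ) ^ t * (n : ℝ) ^ (2 - η) = p := by
    rw [← Real.rpow_add (by linarith), hp]; congr 1; ring
  have hz1 : 1 ≤ z := one_le_pow₀ hdR
  have hdz : δ ≤ z := le_self_pow₀ hdR (by omega)
  have htz : δ ^ ⌈t⌉₊ ≤ z := pow_le_pow_right₀ hdR (by omega)
  have h3z : δ ^ 3 ≤ z := pow_le_pow_right₀ hdR (by omega)
  have hpz : 1 ≤ p * z := one_le_mul_of_one_le_of_one_le hp1 hz1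
  have hE : (numEdges n n d g init : ℝ) ≤ 26 * (g + 1) * (p * z) := by
    have h1 : (numEdges n n d g init : ℝ) ≤ 26 * (g + 1) * (n * d) := by
      exact_mod_cast numEdges_le hn hd init
    refine h1.trans ?_
    gcongr
  have hNle := numVertices_le (g := g) hn hd
  have hT : (⌊C * (N : ℝ) ^ t⌋₊ : ℝ) ≤ |C| * (a : ℝ) ^ ⌈t⌉₊ * (p * z) := by
    have h1 : (⌊C * (N : ℝ) ^ t⌋₊ : ℝ) ≤ |C| * (N : ℝ) ^ t := by
      refine (Nat.cast_le.2 (Nat.floor_le_floor ?_)).trans (Nat.floor_le (by positivity))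
      exact mul_le_mul_of_nonneg_right (le_abs_self C) (by positivity)
    refine h1.trans ?_
    rw [mul_assoc]
    refine mul_le_mul_of_nonneg_left ?_ (abs_nonneg C)
    refine (rpow_mul_le (by omega) hn hd hNle ht.le (Nat.le_ceil t)).trans ?_
    gcongr
  have hD : (⌊|C| * (N : ℝ) ^ (2 - ε') * (2 * d + 1 : ℕ)⌋₊ : ℝ) ≤
      |C| * (a : ℝ) ^ 2 * 3 * ((n : ℝ) ^ (2 - η) * δ ^ 3) := by
    refine (Nat.floor_le (by positivity)).trans ?_
    -- The exponent 2 - ε' might be negative, so it is first raised to 2 - η, which is positive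
    -- since η ≤ 1; only then is N replaced by its bound.
    have h1 : (N : ℝ) ^ (2 - ε') ≤ (a : ℝ) ^ 2 * ((n : ℝ) ^ (2 - η) * δ ^ 2) :=
      (Real.rpow_le_rpow_of_exponent_le hN1 (by linarith)).trans
        (rpow_mul_le (by omega) hn hd hNle (by linarith) (by push_cast; linarith))
    have h2 : ((2 * d + 1 : ℕ) : ℝ) ≤ 3 * δ := by push_cast; linarith
    calc |C| * (N : ℝ) ^ (2 - ε') * (2 * d + 1 : ℕ)
        ≤ |C| * ((a : ℝ) ^ 2 * ((n : ℝ) ^ (2 - η) * δ ^ 2)) * (3 * δ) := by gcongr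
      _ = _ := by ring
  set D := ⌊|C| * (N : ℝ) ^ (2 - ε') * (2 * d + 1 : ℕ)⌋₊ with hDdef
  set T₀ := ⌊C * (N : ℝ) ^ t⌋₊ with hT₀
  clear_value D T₀ N r p
  have hrD : (r : ℝ) * (K * D) ≤ 2 * (K * (|C| * (a : ℝ) ^ 2 * 3)) * (p * z) := by
    calc (r : ℝ) * (K * D) ≤ 2 * (n : ℝ) ^ t *
          (K * (|C| * (a : ℝ) ^ 2 * 3 * ((n : ℝ) ^ (2 - η) * z))) := by
            have h1 : (D : ℝ) ≤ |C| * (a : ℝ) ^ 2 * 3 * ((n : ℝ) ^ (2 - η) * z) :=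
              hD.trans (by gcongr)
            gcongr
      _ = 2 * (K * (|C| * (a : ℝ) ^ 2 * 3)) * ((n : ℝ) ^ t * (n : ℝ) ^ (2 - η) * z) := by ring
      _ = _ := by rw [hmul]
  have hrv : (r : ℝ) * (9 + (2 * δ + 1) * cs + cv + cr + 10) ≤
      2 * (9 + 3 * cs + cv + cr + 10) * (p * z) := by
    have h1 : 9 + (2 * δ + 1) * cs + cv + cr + 10 ≤ (9 + 3 * cs + cv + cr + 10) * z := by
      have h4 : (2 * δ + 1) * cs ≤ 3 * z * cs := mul_le_mul_of_nonneg_right (by linarith) hcs0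
      have h5 : 9 + cv + cr + 10 ≤ (9 + cv + cr + 10) * z :=
        le_mul_of_one_le_right (by linarith) hz1
      linear_combination h4 + h5
    calc (r : ℝ) * (9 + (2 * δ + 1) * cs + cv + cr + 10)
        ≤ 2 * p * ((9 + 3 * cs + cv + cr + 10) * z) := by
          refine mul_le_mul (hrle.trans (by linarith)) h1 ?_ (by linarith)
          positivity
      _ = _ := by ring
  have hone : ∀ {x : ℝ}, 0 ≤ x → x ≤ x * (p * z) := fun hx => le_mul_of_one_le_right hx hpz
  have hrep : (repCost K (K * D) T₀ g n n r d init : ℝ) ≤ c₁ * (p * z) := by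
    have e : (repCost K (K * D) T₀ g n n r d init : ℝ) = 21 +
        (3 + 2 * (numEdges n n d g init : ℝ)) * cI + K * T₀ +
        (r * (K * D) + r * (9 + (2 * δ + 1) * cs + cv + cr + 10) + (cr + 4)) := by
      simp only [repCost, vectorCost, hcI, hcs, hcv, hcr, hδ]
      push_cast
      ring
    have i1 : (3 + 2 * (numEdges n n d g init : ℝ)) * cI ≤ (3 + 52 * (g + 1)) * cI * (p * z) := by
      have : 3 + 2 * (numEdges n n d g init : ℝ) ≤ (3 + 52 * (g + 1)) * (p * z) := by linarith
      calc _ ≤ (3 + 52 * (g + 1)) * (p * z) * cI := mul_le_mul_of_nonneg_right this hcI0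
        _ = _ := by ring
    have i2 : (K : ℝ) * T₀ ≤ K * (|C| * (a : ℝ) ^ ⌈t⌉₊) * (p * z) := by
      rw [mul_assoc]
      exact mul_le_mul_of_nonneg_left hT (Nat.cast_nonneg _)
    have i3 := hone (show (0 : ℝ) ≤ 21 by norm_num)
    have i4 := hone (show (0 : ℝ) ≤ cr + 4 by linarith)
    rw [e, hc₁]
    linear_combination i1 + i2 + i3 + i4 + hrD + hrv
  have hdz' : δ ^ (⌈t⌉₊ + 4) = z * δ := by rw [hz, ← pow_succ]
  set x := p * z * δ with hx
  have hpzx : p * z ≤ x := le_mul_of_one_le_right (by positivity) hdR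
  have hx1 : 1 ≤ x := hpz.trans hpzx
  have hpx : p ≤ x := (le_mul_of_one_le_right (by positivity) hz1).trans hpzx
  have e : ((mainCost K (K * D) T₀ g n n r d init : ℕ) : ℝ) = 6 + (12 * (δ + 2) *
      ((repCost K (K * D) T₀ g n n r d init : ℝ) + cL + 10) + (cL + 4)) +
      (14 + (r * (cm + cr + 14) + cr)) := by
    simp only [mainCost, majorityCost, hcm, hcr, hcL, hδ]
    push_cast
    ring
  rw [e, hdz', mul_assoc _ p, ← mul_assoc p z δ]
  have j1 : 12 * (δ + 2) * ((repCost K (K * D) T₀ g n n r d init : ℝ) + cL + 10) ≤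
      36 * (c₁ + cL + 10) * x := by
    have i1 : (repCost K (K * D) T₀ g n n r d init : ℝ) + cL + 10 ≤ (c₁ + cL + 10) * (p * z) := by
      linear_combination hrep + hone (show 0 ≤ cL + 10 by linarith)
    calc _ ≤ 36 * δ * ((c₁ + cL + 10) * (p * z)) := by
          refine mul_le_mul (by linarith) i1 ?_ (by positivity)
          positivity
      _ = _ := by rw [hx]; ring
  have j2 : (r : ℝ) * (cm + cr + 14) ≤ 2 * (cm + cr + 14) * x := by
    calc (r : ℝ) * (cm + cr + 14) ≤ 2 * x * (cm + cr + 14) := by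
          refine mul_le_mul_of_nonneg_right ?_ (by linarith)
          linarith
      _ = _ := by ring
  have j3 : cL + 4 ≤ (cL + 4) * x := le_mul_of_one_le_right (by linarith) hx1
  have j4 : cr ≤ cr * x := le_mul_of_one_le_right (by linarith) hx1
  have j5 : (20 : ℝ) ≤ 20 * x := by linarith
  linear_combination j1 + j2 + j3 + j4 + j5

end HittingGraph

/-! ### The reduction -/

namespace HittingGraph

open WordRAM

/-- A fast dynamic algorithm for Radius gives a fast algorithm for unbalanced 3-Hitting-Set. -/
theorem solvesUnbalancedHS {A : DynamicAlgorithm} {S : DynamicSetting} {M : TimeMeasure}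
    {init : Bool} (hS : PermitsSwitch S init) {α c t ε' η : ℝ} {k g : ℕ} (hc : 2 ≤ c) (hg : 1 ≤ g)
    (hα : α * (4 * (g + 1) + 1) < 6 * (g + 1)) (ht : 0 < t) (hη : 0 < η) (hη1 : η ≤ 1)
    (hηε : η ≤ ε') (hA : A.SolvesRadius S M α c k t (2 - ε')) :
    SolvesUnbalancedHS (mainProgram A g init) 1 t (1 + 1 + t - η) := by
  obtain ⟨κ, C, hA⟩ := hA
  obtain ⟨κ', hκ'⟩ := exists_word_bounds g κ init t
  set K := A.preprocess.overhead + (if init then A.delete else A.insert).overhead +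
    A.query.overhead with hK
  obtain ⟨C', hC'⟩ := exists_mainCost_le K g init C ht hη1 hηε hη
  refine ⟨κ', ⌈t⌉₊ + 4, C', ?_⟩
  intro n d hn hd U V W hU hV hW
  obtain ⟨X, hfit, hBX, hsize, hst, hinp⟩ := hκ' n d hn hd
  have hcost := hC' n d hn hd
  have hr : 0 < ⌈(n : ℝ) ^ t⌉₊ :=
    Nat.ceil_pos.2 (Real.rpow_pos_of_pos (by exact_mod_cast hn) t)
  -- With a = 1 the set V has exactly n elements, but only after rewriting its size.
  have hq : ⌈(n : ℝ) ^ (1 : ℝ)⌉₊ = n := by rw [Real.rpow_one, Nat.ceil_natCast]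
  generalize ⌈(n : ℝ) ^ (1 : ℝ)⌉₊ = q at V hV hq
  subst hq
  generalize ⌈(q : ℝ) ^ t⌉₊ = r at *
  have hN1 : 1 ≤ numVertices q q d g := by rw [numVertices, numNodes]; omega
  have hrun := fun w => hA _ hN1 _ (edgeList g U V init) (isEdgeList hg init)
    (opsFrom g U V init (W w) 0) (by
      have := admissible_opsFrom (U := U) (V := V) hg hS hc k (w := W w) (2 * d) 0 (by omega)
      rwa [stateAt_zero] at this)
  have hfinal : ∀ w, finalGraph ((scheme g U V).graph fun _ => init = true)
      (opsFrom g U V init (W w) 0) = graph g U V (W w) := fun w => by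
    have := finalGraph_opsFrom (U := U) (V := V) hg (init := init) (w := W w) (2 * d) 0 (by omega)
    rwa [stateAt_zero] at this
  have setup : Setup A M K X (wordBound κ (numVertices q q d g)) (wordBound κ' (q + d)) g init U V W
      (initial (hittingSetInput U V W) 0)
      (fun w => M.budget (C * (numVertices q q d g : ℝ) ^ (2 - ε')) (opsFrom g U V init (W w) 0).length)
      (K * ⌊|C| * (numVertices q q d g : ℝ) ^ (2 - ε') * (2 * d + 1 : ℕ)⌋₊) :=
    { fits := hfit
      bound_le := hBX
      preprocess_le := by omega
      update_le := by omega
      query_le := by omega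
      inp_zero := rfl
      inp_one := rfl
      inp_two := rfl
      inp_three := rfl
      holds := holds_hittingSetInput U V W
      holds_last := hittingSetInput_last U V W
      size_le := hsize
      stamps_le := hst
      time_le := fun w => simTime_budget_le M K
        (mul_le_mul_of_nonneg_right (le_abs_self C) (by positivity)) (by positivity)
        length_opsFrom_le }
  have hspec := mainProgram_spec setup (T₀ := ⌊C * (numVertices q q d g : ℝ) ^ t⌋₊) hr
    (card_le_two_pow hW) (fun w => (hrun w).1) (fun w => HitsAll U V (W w)) (fun w => ?_)
    (σ := initial (hittingSetInput U V W)) rfl (fun a ha => initial_of_ne _ ha)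
    (fun i => (hittingSetInput_le U V W i).trans hinp) hcost
  · simp only [hasHittingSet_iff]
    exact hspec
  · refine ev_answerWeight_le (hrun w).1 ((hrun w).2 getLast?_opsFrom ?_) ?_
    · rw [hfinal]; exact connected hg _ hn
    · rintro s ⟨s', hs', happ⟩
      obtain rfl : s = s' := Option.some.inj hs'
      rw [hfinal] at happ
      exact lt_iff_hitsAll hn hg hα happ

/-- The hypothesis is applied with a = 1, b = t and η = min ε' 1; the cap at 1 keeps the terms of
lower order below the bound. The path parameter g = ⌈1/ε⌉ + 1 opens the gap. -/
theorem not_solvesRadius (hHS : UnbalancedHSHypothesis) {S : DynamicSetting} (M : TimeMeasure)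
    {init : Bool} (hS : PermitsSwitch S init) {t ε ε' : ℝ} (ht : 0 < t) (hε : 0 < ε) (hε' : 0 < ε')
    {c : ℝ} (hc : 2 ≤ c) (k : ℕ) :
    ¬ ∃ A : DynamicAlgorithm, A.SolvesRadius S M (3 / 2 - ε) c k t (2 - ε') := by
  rintro ⟨A, hA⟩
  refine hHS 1 t one_pos ht (min ε' 1) (lt_min hε' one_pos) ⟨mainProgram A (⌈1 / ε⌉₊ + 1) init,
    solvesUnbalancedHS hS hc (by omega) ?_ ht (lt_min hε' one_pos) (min_le_right _ _)
      (min_le_left _ _) hA⟩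
  -- The claim amounts to 3/2 < ε (4 g + 5), and already ε g exceeds 1.
  have h1 : 1 / ε ≤ (⌈1 / ε⌉₊ : ℝ) := Nat.le_ceil _
  have h2 : 1 ≤ (⌈1 / ε⌉₊ : ℝ) * ε := (div_le_iff₀ hε).1 h1
  push_cast
  nlinarith

end HittingGraph

/-- Because memory is rolled back instead of undoing operations, insertions alone serve the fully
dynamic and the incremental setting, and deletions alone the decremental one. -/
theorem mainTheorem2 (hHS : UnbalancedHSHypothesis)
    (t ε ε' : ℝ) (ht : 0 < t) (hε : 0 < ε) (hε' : 0 < ε')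
    (c : ℝ) (hc : 2 ≤ c) (k : ℕ) :
    (¬ ∃ A : DynamicAlgorithm,
      A.SolvesRadius .fullyDynamic .amortized (3 / 2 - ε) c k t (2 - ε')) ∧
    (¬ ∃ A : DynamicAlgorithm,
      A.SolvesRadius .incremental .worstCase (3 / 2 - ε) c k t (2 - ε')) ∧
    (¬ ∃ A : DynamicAlgorithm,
      A.SolvesRadius .decremental .worstCase (3 / 2 - ε) c k t (2 - ε')) :=
  ⟨HittingGraph.not_solvesRadius hHS _ (init := false) (by simp [HittingGraph.PermitsSwitch]) ht hε
      hε' hc k,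
    HittingGraph.not_solvesRadius hHS _ (init := false) (by simp [HittingGraph.PermitsSwitch]) ht hε
      hε' hc k,
    HittingGraph.not_solvesRadius hHS _ (init := true) (by simp [HittingGraph.PermitsSwitch]) ht hε
      hε' hc k⟩
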